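/- Write $x=(x_1,x_2,z)\in\mathbb{R}^3$ and $r=\sqrt{x_1^2+x_2^2}$. Let $0<T<\infty$ and $q\in[1,\infty)$. Let $v=v(t,x)$ be a smooth divergence-free vector field on $(0,T)\times\mathbb{R}^3$ (divergence in $x$) that is bounded on $[a,b]\times\mathbb{R}^3$ for all $0<a\le b<T$. Let $\Gamma$ be smooth on $(0,T)\times\mathbb{R}^3$, axisymmetric (that is, $\Gamma(t,\cdot)$ depends only on $(r,z)$), with $\Gamma\in C([0,T);L^q(\mathbb{R}^3))$, and suppose that it solves $$\partial_t\Gamma+v\cdot\nabla\Gamma-\Big(\Delta+\frac2r\partial_r\Big)\Gamma=0\quad\text{at all points of }(0,T)\times\mathbb{R}^3\text{ with }r>0,\qquad \Gamma|_{t=0}=\Gamma_0,$$ where $\Delta$ is the Laplacian of $\mathbb{R}^3$. Then the following hold, for norms with values in $[0,\infty]$. 1. For every $p\in[1,\infty]$ and every $t\in[0,T)$, $\|\Gamma(t)\|_{L^p(\mathbb{R}^3)}\le\|\Gamma_0\|_{L^p(\mathbb{R}^3)}$. 2. If moreover $\Gamma_0$ is not almost everywhere $0$, then for every $p\in[1,\infty]$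 such that $p\ge q$ or $\Gamma_0\in L^p(\mathbb{R}^3)$ the map $t\mapsto\|\Gamma(t)\|_{L^p(\mathbb{R}^3)}$ is strictly decreasing on $[0,T)$. In particular, if $q=1$, it is strictly decreasing for every $p\in[1,\infty]$. -/

import Mathlib

open MeasureTheory Set Filter Topology
open scoped ContDiff ENNReal

noncomputable section

/-- Physical space `ℝ³` with its Euclidean norm; the coordinates are `x 0 = x₁`, `x 1 = x₂`,
`x 2 = z`. -/
abbrev Space3 : Type := EuclideanSpace ℝ (Fin 3)

/-- The distance `r = √(x₁² + x₂²)` to the axis of symmetry. -/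
def cylRadius (x : Space3) : ℝ := √(x 0 ^ 2 + x 1 ^ 2)

/-- The radial unit vector `e_r = (x₁ / r, x₂ / r, 0)`, used only off the axis. -/
def radialUnit (x : Space3) : Space3 := !₂[x 0 / cylRadius x, x 1 / cylRadius x, 0]

/-- The radial derivative `∂_r f = e_r · ∇ f`, used only off the axis. -/
def radialDeriv (f : Space3 → ℝ) (x : Space3) : ℝ := fderiv ℝ f x (radialUnit x)

/-- The divergence `∂₁ w¹ + ∂₂ w² + ∂₃ w³` of a vector field on `ℝ³`. -/
def divergence (w : Space3 → Space3) (x : Space3) : ℝ :=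
  ∑ i : Fin 3, fderiv ℝ w x (EuclideanSpace.single i 1) i

/-- A scalar function is axisymmetric if it depends only on `r` and `z`. -/
def IsAxisymmetric (f : Space3 → ℝ) : Prop :=
  ∀ x y : Space3, cylRadius x = cylRadius y → x 2 = y 2 → f x = f y

/-- A smooth divergence-free time-dependent velocity field on `(0, T) × ℝ³`, bounded on
`[a, b] × ℝ³` for all `0 < a ≤ b < T` (it may blow up as `t → 0`). -/
structure IsSmoothVelocity (T : ℝ) (v : ℝ → Space3 → Space3) : Prop where
  smooth : ContDiffOn ℝ ∞ (fun y : ℝ × Space3 => v y.1 y.2) (Ioo 0 T ×ˢ univ)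
  div_free : ∀ t ∈ Ioo 0 T, ∀ x, divergence (v t) x = 0
  bounded : ∀ a b : ℝ, 0 < a → b < T → ∃ C : ℝ, ∀ t ∈ Icc a b, ∀ x, ‖v t x‖ ≤ C

/-- `Γ` is a smooth axisymmetric solution, continuous in time with values in `L^q(ℝ³)`, of
`∂ₜ Γ + v · ∇Γ - (Δ + (2 / r) ∂_r) Γ = 0` on `(0, T) × ℝ³` with initial value `Γ₀`.
The equation is written where `r > 0`. -/
structure IsSmoothGammaSolution (T : ℝ) (q : ℝ≥0∞) (v : ℝ → Space3 → Space3)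
    (Γ₀ : Space3 → ℝ) (Γ : ℝ → Space3 → ℝ) : Prop where
  smooth : ContDiffOn ℝ ∞ (fun y : ℝ × Space3 => Γ y.1 y.2) (Ioo 0 T ×ˢ univ)
  axisymmetric : ∀ t ∈ Ioo 0 T, IsAxisymmetric (Γ t)
  equation : ∀ t ∈ Ioo 0 T, ∀ x : Space3, 0 < cylRadius x →
    deriv (fun s => Γ s x) t + fderiv ℝ (Γ t) x (v t x)
      - (Laplacian.laplacian (Γ t) x + 2 / cylRadius x * radialDeriv (Γ t) x) = 0
  memLp : ∀ t ∈ Ico 0 T, MemLp (Γ t) q volume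
  continuous_Lq : ∀ t ∈ Ico 0 T,
    Tendsto (fun s => eLpNorm (Γ s - Γ t) q volume) (𝓝[Ico 0 T] t) (𝓝 0)
  initial : Γ 0 =ᵐ[volume] Γ₀

end

/-! Everything is read off from the excess integrals E_k(t) = ∫ (Γ(t) - k)₊ at levels k > 0, which
are finite by Chebyshev because Γ(t) lies in L^q. Testing the equation with a convex function of Γ,
transport disappears since v is divergence-free and diffusion has a sign. The singular drift
(2/r)∂_r also has a sign: the horizontal field x_h/r², with x_h = (x₁, x₂, 0), has as divergence a
positive multiple of the measure on the axis, so integration by parts leaves a nonpositive term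
there (`integral_radial_le`). Hence E_k is nonincreasing for positive times (`energy_le`,
`weighted_excess_le`), and down to t = 0 by continuity in L^q (`excess_antitone`). Since -Γ solves
the same equation, the same holds for the excess of |Γ|, and the layer-cake formula |y|^p = p(p-1)
∫₀^∞ k^(p-2) (|y| - k)₊ dk turns monotone excesses into monotone L^p norms; p = 1 and p = ∞ are
limiting cases (`eLpNorm_le_of_absExcess_le`).

Strict decrease rests on four further facts.

Loss at the axis (`excess_lt`). If E_k were conserved on [s, t], testing with 1 - exp(-l r), whose
value on the axis is zero, would make the moment ∫ (Γ - k)₊ exp(-l r) grow at rate at least l² - 2 C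
l, where C bounds v. That moment starts above a multiple of exp(-l r₁) and never exceeds E_k, which
is impossible for large l. So E_k drops strictly as soon as Γ(s) exceeds k somewhere; this settles p
< ∞ by the layer-cake formula once Γ(s) is known to be nonzero.

Smoothing (`exists_smoothing`). A De Giorgi iteration on levels and times, driven by the energy
inequality and the Sobolev inequality, bounds Γ(t) by k + h as soon as E_k(s) ≤ c h, with c
depending only on the two times. In particular Γ is bounded at positive times.

Strong maximum principle (`lt_of_exists_lt`). A barrier on a moving ball carries strict inequality Γ
< M along segments avoiding the axis; axisymmetry puts any two points off the axis into a common
half-plane. Then E_k(u)/(M - k) tends to 0 as k increases to M, and smoothing from u to t gives a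
bound strictly below M. This is the case p = ∞ (`exists_lt_forall_le`).

Backward uniqueness (`eq_zero_of_later_eq_zero`). With respect to r² dx the operator Δ + (2/r)∂_r is
symmetric, and a Carleman estimate with the weight exp(Λ exp(Kτ)) shows that a bounded solution
vanishing at one time vanishes at all earlier positive times, hence initially by L^q continuity. So
a solution with nonzero data is never identically zero (`exists_ne_zero`). -/

noncomputable section

/-! ### Coordinate derivatives on ℝ³ and integration by parts. -/

/-- The `i`-th partial derivative of a scalar function on `ℝ³`. -/
def partialD (i : Fin 3) (f : Space3 → ℝ) (x : Space3) : ℝ :=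
  fderiv ℝ f x (EuclideanSpace.single i 1)

lemma partialD_add {f g : Space3 → ℝ} {x : Space3} (i : Fin 3) (hf : DifferentiableAt ℝ f x)
    (hg : DifferentiableAt ℝ g x) :
    partialD i (fun y => f y + g y) x = partialD i f x + partialD i g x := by
  simp [partialD, fderiv_fun_add hf hg]

lemma partialD_sub {f g : Space3 → ℝ} {x : Space3} (i : Fin 3) (hf : DifferentiableAt ℝ f x)
    (hg : DifferentiableAt ℝ g x) :
    partialD i (fun y => f y - g y) x = partialD i f x - partialD i g x := by
  simp [partialD, fderiv_fun_sub hf hg]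

lemma partialD_mul {f g : Space3 → ℝ} {x : Space3} (i : Fin 3) (hf : DifferentiableAt ℝ f x)
    (hg : DifferentiableAt ℝ g x) :
    partialD i (fun y => f y * g y) x = f x * partialD i g x + partialD i f x * g x := by
  simp [partialD, fderiv_fun_mul hf hg]; ring

lemma partialD_comp {f : Space3 → ℝ} {x : Space3} (i : Fin 3) {η : ℝ → ℝ} {η' : ℝ}
    (hη : HasDerivAt η η' (f x)) (hf : DifferentiableAt ℝ f x) :
    partialD i (fun y => η (f y)) x = η' * partialD i f x := by
  have h := hη.comp_hasFDerivAt x hf.hasFDerivAt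
  have h2 : HasFDerivAt (fun y => η (f y)) (η' • fderiv ℝ f x) x := h
  simp [partialD, h2.fderiv]

@[simp] lemma partialD_const (i : Fin 3) (c : ℝ) (x : Space3) :
    partialD i (fun _ => c) x = 0 := by
  simp [partialD]

lemma partialD_coord (i j : Fin 3) (x : Space3) :
    partialD i (fun y => y j) x = if j = i then 1 else 0 := by
  have h : HasFDerivAt (fun y : Space3 => y j) (EuclideanSpace.proj j : Space3 →L[ℝ] ℝ) x :=
    (EuclideanSpace.proj j : Space3 →L[ℝ] ℝ).hasFDerivAt
  simp [partialD, h.fderiv]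

lemma ContDiff.partialD {f : Space3 → ℝ} {n m : WithTop ℕ∞} (hf : ContDiff ℝ n f)
    (hmn : m + 1 ≤ n) (i : Fin 3) : ContDiff ℝ m (partialD i f) :=
  (hf.fderiv_right hmn).clm_apply contDiff_const

lemma HasCompactSupport.partialD {f : Space3 → ℝ} (hf : HasCompactSupport f) (i : Fin 3) :
    HasCompactSupport (partialD i f) :=
  hf.fderiv_apply (𝕜 := ℝ) _

lemma integral_partialD_eq_zero {f : Space3 → ℝ} (hf : ContDiff ℝ 1 f)
    (hc : HasCompactSupport f) (i : Fin 3) : ∫ x, partialD i f x = 0 := by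
  have h := integral_mul_fderiv_eq_neg_fderiv_mul_of_integrable (μ := (volume : Measure Space3))
    (f := fun _ => (1 : ℝ)) (g := f) (v := EuclideanSpace.single i 1)
    (by simp) (by
      simp only [one_mul]
      exact ((hf.partialD (m := 0) (by simp) i).continuous).integrable_of_hasCompactSupport
        (hc.partialD i)) (by
      simp only [one_mul]
      exact hf.continuous.integrable_of_hasCompactSupport hc)
    (fun x _ => by fun_prop) (fun x _ => (hf.differentiable (by simp)) x)
  simpa [partialD] using h

lemma laplacian_eq_sum_partialD {f : Space3 → ℝ} (hf : ContDiff ℝ 2 f) (x : Space3) :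
    Laplacian.laplacian f x = ∑ i, partialD i (partialD i f) x := by
  rw [InnerProductSpace.laplacian_eq_iteratedFDeriv_orthonormalBasis f
    (EuclideanSpace.basisFun (Fin 3) ℝ)]
  refine Finset.sum_congr rfl fun i _ => ?_
  rw [iteratedFDeriv_two_apply]
  have hd : DifferentiableAt ℝ (fderiv ℝ f) x :=
    ((hf.fderiv_right (m := 1) (by norm_num)).differentiable (by simp)) x
  have : partialD i (partialD i f) x =
      fderiv ℝ (fun y => fderiv ℝ f y (EuclideanSpace.single i 1)) x
        (EuclideanSpace.single i 1) := rfl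
  rw [this, fderiv_clm_apply hd (by fun_prop)]
  simp

/-! ### Functions on the space-time slab and differentiation under the integral. -/

/-- The open slab `(0, T) × ℝ³`. -/
abbrev slab (T : ℝ) : Set (ℝ × Space3) := Ioo 0 T ×ˢ univ

lemma isOpen_slab (T : ℝ) : IsOpen (slab T) := isOpen_Ioo.prod isOpen_univ

/-- Smoothness of a curried function on the slab `(0, T) × ℝ³`. -/
def SlabSmooth (T : ℝ) (g : ℝ → Space3 → ℝ) : Prop :=
  ContDiffOn ℝ ∞ (fun y : ℝ × Space3 => g y.1 y.2) (slab T)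

/-- Continuity of a curried function on the slab `(0, T) × ℝ³`. -/
def SlabCont (T : ℝ) (g : ℝ → Space3 → ℝ) : Prop :=
  ContinuousOn (fun y : ℝ × Space3 => g y.1 y.2) (slab T)

namespace SlabSmooth

variable {T : ℝ} {g : ℝ → Space3 → ℝ}

lemma slabCont (hg : SlabSmooth T g) : SlabCont T g := ContDiffOn.continuousOn hg

lemma contDiffAt (hg : SlabSmooth T g) {t : ℝ} (ht : t ∈ Ioo 0 T) (x : Space3) :
    ContDiffAt ℝ ∞ (fun y : ℝ × Space3 => g y.1 y.2) (t, x) :=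
  ContDiffOn.contDiffAt hg ((isOpen_slab T).mem_nhds ⟨ht, mem_univ _⟩)

lemma differentiableAt (hg : SlabSmooth T g) {t : ℝ} (ht : t ∈ Ioo 0 T) (x : Space3) :
    DifferentiableAt ℝ (fun y : ℝ × Space3 => g y.1 y.2) (t, x) :=
  (hg.contDiffAt ht x).differentiableAt (by simp)

lemma hasDerivAt_aux (hg : SlabSmooth T g) {t : ℝ} (ht : t ∈ Ioo 0 T) (x : Space3) :
    HasDerivAt (fun s => g s x) (fderiv ℝ (fun y : ℝ × Space3 => g y.1 y.2) (t, x) (1, 0)) t := by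
  have h1 : HasDerivAt (fun s : ℝ => (s, x)) ((1 : ℝ), (0 : Space3)) t :=
    (hasDerivAt_id t).prodMk (hasDerivAt_const t x)
  exact (hg.differentiableAt ht x).hasFDerivAt.comp_hasDerivAt t h1

lemma hasDerivAt (hg : SlabSmooth T g) {t : ℝ} (ht : t ∈ Ioo 0 T) (x : Space3) :
    HasDerivAt (fun s => g s x) (deriv (fun s => g s x) t) t :=
  (hg.hasDerivAt_aux ht x).differentiableAt.hasDerivAt

lemma hasFDerivAt_slice (hg : SlabSmooth T g) {t : ℝ} (ht : t ∈ Ioo 0 T) (x : Space3) :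
    HasFDerivAt (g t) ((fderiv ℝ (fun y : ℝ × Space3 => g y.1 y.2) (t, x)).comp
      (ContinuousLinearMap.inr ℝ ℝ Space3)) x := by
  have h1 : HasFDerivAt (fun z : Space3 => (t, z)) (ContinuousLinearMap.inr ℝ ℝ Space3) x :=
    hasFDerivAt_prodMk_right t x
  exact (hg.differentiableAt ht x).hasFDerivAt.comp x h1

lemma partialD_eq (hg : SlabSmooth T g) {t : ℝ} (ht : t ∈ Ioo 0 T) (x : Space3) (i : Fin 3) :
    _root_.partialD i (g t) x = fderiv ℝ (fun y : ℝ × Space3 => g y.1 y.2) (t, x)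
      (0, EuclideanSpace.single i 1) := by
  rw [_root_.partialD, (hg.hasFDerivAt_slice ht x).fderiv]
  simp

lemma fderiv_apply (hg : SlabSmooth T g) (w : ℝ × Space3) :
    SlabSmooth T fun t x => fderiv ℝ (fun y : ℝ × Space3 => g y.1 y.2) (t, x) w := by
  have h : ContDiffOn ℝ ∞ (fderiv ℝ (fun y : ℝ × Space3 => g y.1 y.2)) (slab T) :=
    ContDiffOn.fderiv_of_isOpen hg (isOpen_slab T) (by simp)
  exact h.clm_apply contDiffOn_const

lemma congr {g' : ℝ → Space3 → ℝ} (hg : SlabSmooth T g)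
    (h : ∀ t ∈ Ioo 0 T, ∀ x, g' t x = g t x) : SlabSmooth T g' :=
  ContDiffOn.congr hg fun y hy => h y.1 hy.1 y.2

lemma timeDeriv (hg : SlabSmooth T g) : SlabSmooth T fun t x => deriv (fun s => g s x) t :=
  (hg.fderiv_apply (1, 0)).congr fun _ ht x => (hg.hasDerivAt_aux ht x).deriv

lemma partialD (hg : SlabSmooth T g) (i : Fin 3) :
    SlabSmooth T fun t x => _root_.partialD i (g t) x :=
  (hg.fderiv_apply (0, EuclideanSpace.single i 1)).congr fun _ ht x => hg.partialD_eq ht x i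

lemma slice (hg : SlabSmooth T g) {t : ℝ} (ht : t ∈ Ioo 0 T) : ContDiff ℝ ∞ (g t) :=
  contDiff_iff_contDiffAt.2 fun x =>
    (hg.contDiffAt ht x).comp x (contDiffAt_const.prodMk contDiffAt_id)

lemma differentiable_slice (hg : SlabSmooth T g) {t : ℝ} (ht : t ∈ Ioo 0 T) :
    Differentiable ℝ (g t) := (hg.slice ht).differentiable (by simp)

/-- Symmetry of the second derivative of the joint function, in the directions (1, 0) and (0, eᵢ).
It allows |∇f|² to be differentiated in time in the Carleman estimate. -/
lemma deriv_partialD (hg : SlabSmooth T g) {t : ℝ} (ht : t ∈ Ioo 0 T) (x : Space3) (i : Fin 3) :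
    deriv (fun s => _root_.partialD i (g s) x) t =
      _root_.partialD i (fun z => deriv (fun s => g s z) t) x := by
  set G : ℝ × Space3 → ℝ := fun y => g y.1 y.2 with hG
  have hd : DifferentiableAt ℝ (fderiv ℝ G) (t, x) :=
    ((hg.contDiffAt ht x).fderiv_right (m := ∞) (by simp)).differentiableAt (by simp)
  have e1 : (fun s => _root_.partialD i (g s) x) =ᶠ[𝓝 t]
      fun s => fderiv ℝ G (s, x) (0, EuclideanSpace.single i 1) := by
    filter_upwards [isOpen_Ioo.mem_nhds ht] with s hs using hg.partialD_eq hs x i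
  have e2 : (fun z => deriv (fun s => g s z) t) = fun z => fderiv ℝ G (t, z) (1, 0) := by
    funext z; exact (hg.hasDerivAt_aux ht z).deriv
  have s1 := ((hg.fderiv_apply (0, EuclideanSpace.single i 1)).hasDerivAt_aux ht x).deriv
  have s2 := (hg.fderiv_apply (1, 0)).partialD_eq ht x i
  rw [e1.deriv_eq, e2, s1, s2]
  change fderiv ℝ (fun y => fderiv ℝ G y _) (t, x) _ = fderiv ℝ (fun y => fderiv ℝ G y _) (t, x) _
  rw [fderiv_clm_apply hd (by fun_prop), fderiv_clm_apply hd (by fun_prop)]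
  have := (hg.contDiffAt ht x).isSymmSndFDerivAt
    (by rw [minSmoothness_of_isRCLikeNormedField]; exact WithTop.coe_le_coe.2 (le_top : (2 : ℕ∞) ≤ ⊤))
  simpa using this.eq _ _

end SlabSmooth

namespace SlabCont

variable {T : ℝ} {g h : ℝ → Space3 → ℝ}

lemma slice (hg : SlabCont T g) {t : ℝ} (ht : t ∈ Ioo 0 T) : Continuous (g t) := by
  have : ContinuousOn (fun x : Space3 => g t x) univ :=
    ContinuousOn.comp (f := fun x : Space3 => (t, x)) hg (by fun_prop) fun x _ => ⟨ht, mem_univ _⟩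
  exact continuousOn_univ.1 this

lemma mul (hg : SlabCont T g) (hh : SlabCont T h) : SlabCont T fun t x => g t x * h t x :=
  ContinuousOn.mul hg hh

lemma add (hg : SlabCont T g) (hh : SlabCont T h) : SlabCont T fun t x => g t x + h t x :=
  ContinuousOn.add hg hh

lemma sub (hg : SlabCont T g) (hh : SlabCont T h) : SlabCont T fun t x => g t x - h t x :=
  ContinuousOn.sub hg hh

lemma sum {G : Fin 3 → ℝ → Space3 → ℝ} (hg : ∀ i, SlabCont T (G i)) :
    SlabCont T fun t x => ∑ i, G i t x :=
  continuousOn_finsetSum _ fun i _ => hg i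

lemma comp (hg : SlabCont T g) {η : ℝ → ℝ} (hη : Continuous η) :
    SlabCont T fun t x => η (g t x) :=
  hη.comp_continuousOn hg

lemma of_space {χ : Space3 → ℝ} (hχ : Continuous χ) : SlabCont T fun _ x => χ x :=
  (hχ.comp continuous_snd).continuousOn

lemma continuousOn_integral (hg : SlabCont T g) {K : Set Space3} (hK : IsCompact K)
    (h0 : ∀ t ∈ Ioo 0 T, ∀ x ∉ K, g t x = 0) : ContinuousOn (fun t => ∫ x, g t x) (Ioo 0 T) :=
  continuousOn_integral_of_compact_support hK hg fun t x ht hx => h0 t ht x hx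

lemma integrable_slice (hg : SlabCont T g) {K : Set Space3} (hK : IsCompact K) {t : ℝ}
    (ht : t ∈ Ioo 0 T) (h0 : ∀ x ∉ K, g t x = 0) : Integrable (g t) :=
  (hg.slice ht).integrable_of_hasCompactSupport (HasCompactSupport.intro hK h0)

/-- A function that vanishes off K at all times has a time derivative vanishing there too, so near t
the derivative is dominated by a constant times the indicator of K. -/
lemma hasDerivAt_integral {g' : ℝ → Space3 → ℝ} (hg : SlabCont T g) (hg' : SlabCont T g')
    (hd : ∀ t ∈ Ioo 0 T, ∀ x, HasDerivAt (fun s => g s x) (g' t x) t)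
    {K : Set Space3} (hK : IsCompact K) (h0 : ∀ t ∈ Ioo 0 T, ∀ x ∉ K, g t x = 0)
    {t : ℝ} (ht : t ∈ Ioo 0 T) :
    HasDerivAt (fun s => ∫ x, g s x) (∫ x, g' t x) t := by
  have h0' : ∀ t ∈ Ioo 0 T, ∀ x ∉ K, g' t x = 0 := by
    intro t ht x hx
    have e : (fun s => g s x) =ᶠ[𝓝 t] fun _ => 0 := by
      filter_upwards [isOpen_Ioo.mem_nhds ht] with s hs using h0 s hs x hx
    exact (hd t ht x).unique (((hasDerivAt_const t (0 : ℝ))).congr_of_eventuallyEq e)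
  obtain ⟨ε, hε, hball⟩ := Metric.isOpen_iff.1 isOpen_Ioo t ht
  have hsub : Metric.closedBall t (ε / 2) ⊆ Ioo 0 T :=
    (Metric.closedBall_subset_ball (by linarith)).trans hball
  obtain ⟨C, hC⟩ := ((isCompact_closedBall t (ε / 2)).prod hK).exists_bound_of_continuousOn
    (ContinuousOn.mono hg' (prod_mono hsub (subset_univ _)))
  have := hasDerivAt_integral_of_dominated_loc_of_deriv_le (μ := (volume : Measure Space3))
    (F := g) (F' := g') (x₀ := t) (s := Metric.ball t (ε / 2)) (bound := K.indicator fun _ => C)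
    (Metric.ball_mem_nhds t (by linarith))
    (by
      filter_upwards [isOpen_Ioo.mem_nhds ht] with s hs
      exact (hg.slice hs).aestronglyMeasurable)
    (hg.integrable_slice hK ht (h0 t ht)) (hg'.slice ht).aestronglyMeasurable
    (by
      refine Eventually.of_forall fun x s hs => ?_
      have hs' := Metric.ball_subset_closedBall hs
      by_cases hx : x ∈ K
      · simpa [hx] using hC (s, x) ⟨hs', hx⟩
      · simp [hx, h0' s (hsub hs') x hx])
    ((integrable_indicator_iff hK.measurableSet).2 (integrableOn_const hK.measure_lt_top.ne))
    (by
      refine Eventually.of_forall fun x s hs => ?_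
      exact hd s (hsub (Metric.ball_subset_closedBall hs)) x)
  exact this.2

/-- The fundamental theorem of calculus for the integral over space of a function supported in a
fixed compact set. -/
lemma integral_sub_eq {g' : ℝ → Space3 → ℝ} (hg : SlabCont T g) (hg' : SlabCont T g')
    (hd : ∀ t ∈ Ioo 0 T, ∀ x, HasDerivAt (fun s => g s x) (g' t x) t)
    {K : Set Space3} (hK : IsCompact K) (h0 : ∀ t ∈ Ioo 0 T, ∀ x ∉ K, g t x = 0)
    {s t : ℝ} (hs : 0 < s) (hst : s ≤ t) (ht : t < T) :
    ∫ τ in s..t, ∫ x, g' τ x = (∫ x, g t x) - ∫ x, g s x := by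
  have hsub : uIcc s t ⊆ Ioo 0 T := by
    rw [uIcc_of_le hst]; exact fun τ hτ => ⟨hs.trans_le hτ.1, hτ.2.trans_lt ht⟩
  have h0' : ∀ t ∈ Ioo 0 T, ∀ x ∉ K, g' t x = 0 := by
    intro t ht x hx
    have e : (fun s => g s x) =ᶠ[𝓝 t] fun _ => 0 := by
      filter_upwards [isOpen_Ioo.mem_nhds ht] with s hs using h0 s hs x hx
    exact (hd t ht x).unique (((hasDerivAt_const t (0 : ℝ))).congr_of_eventuallyEq e)
  refine intervalIntegral.integral_eq_sub_of_hasDerivAt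
    (fun τ hτ => hg.hasDerivAt_integral hg' hd hK h0 (hsub hτ)) ?_
  exact ((hg'.continuousOn_integral hK h0').mono hsub).intervalIntegrable

end SlabCont

/-! ### The axis of symmetry and admissible test functions. -/

/-- The squared distance to the axis. -/
def axisSq (x : Space3) : ℝ := x 0 ^ 2 + x 1 ^ 2

lemma axisSq_nonneg (x : Space3) : 0 ≤ axisSq x := by unfold axisSq; positivity

lemma contDiff_axisSq {n : WithTop ℕ∞} : ContDiff ℝ n axisSq := by
  unfold axisSq; fun_prop

lemma continuous_axisSq : Continuous axisSq := (contDiff_axisSq (n := 0)).continuous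

lemma differentiable_axisSq : Differentiable ℝ axisSq :=
  (contDiff_axisSq (n := 1)).differentiable (by simp)

lemma sq_cylRadius (x : Space3) : cylRadius x ^ 2 = axisSq x := Real.sq_sqrt (axisSq_nonneg x)

lemma cylRadius_pos_iff {x : Space3} : 0 < cylRadius x ↔ 0 < axisSq x := Real.sqrt_pos

lemma partialD_axisSq (i : Fin 3) (x : Space3) :
    partialD i axisSq x = if i = 2 then 0 else 2 * x i := by
  have h : axisSq = fun y => y 0 * y 0 + y 1 * y 1 := by funext y; simp [axisSq]; ring
  have hd : ∀ j : Fin 3, DifferentiableAt ℝ (fun y : Space3 => y j) x := fun j => by fun_prop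
  rw [h, partialD_add i ((hd 0).fun_mul (hd 0)) ((hd 1).fun_mul (hd 1)), partialD_mul i (hd 0) (hd 0),
    partialD_mul i (hd 1) (hd 1)]
  simp only [partialD_coord]
  fin_cases i <;> simp <;> ring

/-- The axis lies in the hyperplane x₁ = 0. Regularizations r² + δ of r² may therefore be removed by
dominated convergence off the axis. -/
lemma ae_axisSq_pos : ∀ᵐ x : Space3, 0 < axisSq x := by
  have h0 : volume ((LinearMap.ker (EuclideanSpace.proj (0 : Fin 3) : Space3 →L[ℝ] ℝ).toLinearMap :
      Submodule ℝ Space3) : Set Space3) = 0 := by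
    refine Measure.addHaar_submodule _ _ fun h => ?_
    have : EuclideanSpace.single (0 : Fin 3) (1 : ℝ) ∈
        LinearMap.ker (EuclideanSpace.proj (0 : Fin 3) : Space3 →L[ℝ] ℝ).toLinearMap := by
      rw [h]; trivial
    simp at this
  refine measure_mono_null (fun x hx => ?_) h0
  simp only [mem_compl_iff, mem_ofPred_eq, not_lt] at hx
  have : x 0 ^ 2 + x 1 ^ 2 = 0 := le_antisymm hx (axisSq_nonneg x)
  have h1 : x 0 = 0 := by nlinarith [sq_nonneg (x 0), sq_nonneg (x 1)]
  simpa using h1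

/-- A nonnegative compactly supported `C²` test function `χ` whose radial derivative satisfies
`r ∂_r χ = r² κ` with `κ` continuous and compactly supported. -/
structure IsTestFn (χ κ : Space3 → ℝ) : Prop where
  contDiff : ContDiff ℝ 2 χ
  compact : HasCompactSupport χ
  nonneg : ∀ x, 0 ≤ χ x
  cont_quot : Continuous κ
  compact_quot : HasCompactSupport κ
  radial : ∀ x, x 0 * partialD 0 χ x + x 1 * partialD 1 χ x = axisSq x * κ x

/-- The sum of the squares of the partial derivatives. -/
def gradSq (f : Space3 → ℝ) (x : Space3) : ℝ := ∑ i, partialD i f x ^ 2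

/-- The sum of the second partial derivatives. -/
def lap (f : Space3 → ℝ) (x : Space3) : ℝ := ∑ i, partialD i (partialD i f) x

/-- The derivative of `f` in the direction `w`, in coordinates. -/
def advect (w : Space3 → Space3) (f : Space3 → ℝ) (x : Space3) : ℝ := ∑ i, w x i * partialD i f x

lemma gradSq_nonneg (f : Space3 → ℝ) (x : Space3) : 0 ≤ gradSq f x :=
  Finset.sum_nonneg fun _ _ => sq_nonneg _

/-! ### Integral identities at a fixed time. -/

section Static

variable {u χ κ N : Space3 → ℝ} {w : Space3 → Space3} {η : ℝ → ℝ}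

/-- The divergence theorem for the compactly supported field χ η'(u) ∇u - η(u) (∇χ + χ w); the term
with div w drops out. -/
lemma integral_energy_flux (hu : ContDiff ℝ 2 u) (hw : ContDiff ℝ 1 w)
    (hdiv : ∀ x, divergence w x = 0) (hη : ContDiff ℝ 2 η) (hχ : ContDiff ℝ 2 χ)
    (hc : HasCompactSupport χ) :
    ∫ x, deriv η (u x) * χ x * (lap u x - advect w u x) =
      ∫ x, (η (u x) * (advect w χ x + lap χ x) - deriv (deriv η) (u x) * gradSq u x * χ x) := by
  have hη1 : ContDiff ℝ 1 (deriv η) := ((contDiff_succ_iff_deriv (n := 1)).1 hη).2.2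
  have hη' : ∀ y, HasDerivAt η (deriv η y) y := fun y =>
    ((hη.differentiable (by simp)) y).hasDerivAt
  have hη'' : ∀ y, HasDerivAt (deriv η) (deriv (deriv η) y) y := fun y =>
    ((hη1.differentiable (by simp)) y).hasDerivAt
  have hud : Differentiable ℝ u := hu.differentiable (by simp)
  have hχd : Differentiable ℝ χ := hχ.differentiable (by simp)
  have hui : ∀ i, ContDiff ℝ 1 (partialD i u) := fun i => hu.partialD (by norm_num) i
  have hχi : ∀ i, ContDiff ℝ 1 (partialD i χ) := fun i => hχ.partialD (by norm_num) i
  have hwi : ∀ i, ContDiff ℝ 1 fun x => w x i := fun i => by fun_prop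
  have hwd : ∀ i, Differentiable ℝ fun x => w x i := fun i => (hwi i).differentiable (by simp)
  have hdivw : ∀ x, ∑ i, partialD i (fun y => w y i) x = 0 := by
    intro x
    rw [← hdiv x]
    refine Finset.sum_congr rfl fun i _ => ?_
    have h : HasFDerivAt (fun y => w y i)
        ((EuclideanSpace.proj i : Space3 →L[ℝ] ℝ).comp (fderiv ℝ w x)) x :=
      (EuclideanSpace.proj i : Space3 →L[ℝ] ℝ).hasFDerivAt.comp x
        ((hw.differentiable (by simp)) x).hasFDerivAt
    simp [partialD, h.fderiv]
  let V : Fin 3 → Space3 → ℝ := fun i x =>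
    χ x * (deriv η (u x) * partialD i u x) -
      η (u x) * (partialD i χ x + χ x * w x i)
  have hV : ∀ i, ContDiff ℝ 1 (V i) := fun i =>
    ((hχ.of_le (by norm_num)).mul ((hη1.comp (hu.of_le (by norm_num))).mul (hui i))).sub
      (((hη.of_le (by norm_num)).comp (hu.of_le (by norm_num))).mul
        ((hχi i).add ((hχ.of_le (by norm_num)).mul (hwi i))))
  have hVc : ∀ i, HasCompactSupport (V i) := fun i => by
    refine HasCompactSupport.sub hc.mul_right (HasCompactSupport.mul_left ?_)
    exact (hc.partialD i).add hc.mul_right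
  have hVd : ∀ x, ∑ i, partialD i (V i) x =
      deriv η (u x) * χ x * (lap u x - advect w u x) -
      (η (u x) * (advect w χ x + lap χ x) - deriv (deriv η) (u x) * gradSq u x * χ x) := by
    intro x
    have key : ∀ i, partialD i (V i) x =
        deriv η (u x) * χ x * (partialD i (partialD i u) x - w x i * partialD i u x) -
        (η (u x) * (w x i * partialD i χ x + partialD i (partialD i χ) x) -
          deriv (deriv η) (u x) * partialD i u x ^ 2 * χ x) -
        η (u x) * χ x * partialD i (fun y => w y i) x := by
      intro i
      have d1 : DifferentiableAt ℝ (fun y => deriv η (u y)) x :=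
        ((hη'' (u x)).differentiableAt).comp x (hud x)
      have d2 : DifferentiableAt ℝ (fun y => η (u y)) x :=
        ((hη' (u x)).differentiableAt).comp x (hud x)
      have d3 : DifferentiableAt ℝ (partialD i u) x := (hui i).differentiable (by simp) x
      have d4 : DifferentiableAt ℝ (partialD i χ) x := (hχi i).differentiable (by simp) x
      change partialD i (fun x => χ x * (deriv η (u x) * partialD i u x) -
        η (u x) * (partialD i χ x + χ x * w x i)) x = _
      rw [partialD_sub i ((hχd x).fun_mul (d1.fun_mul d3)) (d2.fun_mul (d4.fun_add ((hχd x).fun_mul (hwd i x)))),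
        partialD_mul i (hχd x) (d1.fun_mul d3), partialD_mul i d1 d3,
        partialD_mul i d2 (d4.fun_add ((hχd x).fun_mul (hwd i x))),
        partialD_add i d4 ((hχd x).fun_mul (hwd i x)), partialD_mul i (hχd x) (hwd i x),
        partialD_comp i (hη'' (u x)) (hud x), partialD_comp i (hη' (u x)) (hud x)]
      ring
    have hs := hdivw x
    simp only [key, lap, advect, gradSq, Fin.sum_univ_three] at hs ⊢
    linear_combination (-(η (u x) * χ x)) * hs
  have hi1 : ∀ i, Continuous (partialD i (partialD i u)) := fun i =>
    ((hui i).partialD (m := 0) (by simp) i).continuous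
  have hi2 : ∀ i, Continuous (partialD i (partialD i χ)) := fun i =>
    ((hχi i).partialD (m := 0) (by simp) i).continuous
  have hi3 := fun i => (hui i).continuous
  have hi4 := fun i => (hχi i).continuous
  have hηc := hη1.continuous
  have hηcc : Continuous (deriv (deriv η)) := ((contDiff_succ_iff_deriv (n := 0)).1 hη1).2.2.continuous
  have hηc0 := hη.continuous
  have huc := hu.continuous
  have hχc := hχ.continuous
  have hwc := fun i => (hwi i).continuous
  have I1 : Integrable fun x => deriv η (u x) * χ x * (lap u x - advect w u x) := by
    refine Continuous.integrable_of_hasCompactSupport ?_ ?_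
    · unfold lap advect; fun_prop
    · exact (hc.mul_left).mul_right
  have I2 : Integrable fun x =>
      (η (u x) * (advect w χ x + lap χ x) - deriv (deriv η) (u x) * gradSq u x * χ x) := by
    refine Continuous.integrable_of_hasCompactSupport ?_ ?_
    · unfold lap advect gradSq; fun_prop
    · refine HasCompactSupport.sub (HasCompactSupport.mul_left ?_) hc.mul_left
      simp only [advect, lap, Fin.sum_univ_three]
      exact (((hc.partialD 0).mul_left.add (hc.partialD 1).mul_left).add
        (hc.partialD 2).mul_left).add
        ((((hc.partialD 0).partialD 0).add ((hc.partialD 1).partialD 1)).add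
          ((hc.partialD 2).partialD 2))
  have : ∫ x, ∑ i, partialD i (V i) x = 0 := by
    rw [integral_finsetSum]
    · exact Finset.sum_eq_zero fun i _ => integral_partialD_eq_zero (hV i) (hVc i) i
    · intro i _
      exact ((hV i).partialD (m := 0) (by simp) i).continuous.integrable_of_hasCompactSupport
        ((hVc i).partialD i)
  simp only [hVd] at this
  rw [integral_sub I1 I2] at this
  linarith

/-- Here N plays the role of (2/r)∂_r u, extended continuously across the axis, and κ that of
(1/r)∂_r χ. Formally the two sides differ by -4π times the integral of η(u) χ over the axis, the
divergence of 2 x_h/r² being a measure on the axis; only its sign is kept, which is where η ≥ 0 and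
χ ≥ 0 enter. -/
lemma integral_radial_le (hu : ContDiff ℝ 1 u) (hN : Continuous N)
    (hrad : ∀ x, x 0 * partialD 0 u x + x 1 * partialD 1 u x = axisSq x / 2 * N x)
    (hη : ContDiff ℝ 1 η) (hη0 : ∀ y, 0 ≤ η y) (hχ : IsTestFn χ κ) :
    ∫ x, deriv η (u x) * χ x * N x ≤ ∫ x, -(2 * (η (u x) * κ x)) := by
  have hη' : ∀ y, HasDerivAt η (deriv η y) y := fun y =>
    ((hη.differentiable (by simp)) y).hasDerivAt
  have hud : Differentiable ℝ u := hu.differentiable (by simp)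
  have hχd : Differentiable ℝ χ := hχ.contDiff.differentiable (by simp)
  have hηc : Continuous (deriv η) := ((contDiff_succ_iff_deriv (n := 0)).1 hη).2.2.continuous
  let g : Space3 → ℝ := fun x => η (u x) * χ x
  have hg : ContDiff ℝ 1 g := (hη.comp hu).mul (hχ.contDiff.of_le (by norm_num))
  have hgd : Differentiable ℝ g := hg.differentiable (by simp)
  have hgc : HasCompactSupport g := hχ.compact.mul_left
  -- Twice the integral of H is the left side minus the right side of the claim, so it suffices that
  -- ∫ H ≤ 0.
  let H : Space3 → ℝ := fun x => deriv η (u x) * χ x * N x / 2 + η (u x) * κ x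
  have hHc : Continuous H := by
    have := hη.continuous; have := hu.continuous; have := hχ.contDiff.continuous
    have := hχ.cont_quot
    fun_prop
  have hHs : HasCompactSupport H := by
    refine HasCompactSupport.add ?_ hχ.compact_quot.mul_left
    simp only [div_eq_mul_inv]
    exact (hχ.compact.mul_left).mul_right.mul_right
  have hHi : Integrable H := hHc.integrable_of_hasCompactSupport hHs
  have step : ∀ δ : ℝ, 0 < δ → ∫ x, axisSq x / (axisSq x + δ) * H x ≤ 0 := by
    intro δ hδ
    have hpos : ∀ x, 0 < axisSq x + δ := fun x => by linarith [axisSq_nonneg x]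
    have hinv : ContDiff ℝ 1 fun x => (axisSq x + δ)⁻¹ :=
      (contDiff_axisSq.add contDiff_const).inv fun x => (hpos x).ne'
    have hinvd : Differentiable ℝ fun x => (axisSq x + δ)⁻¹ := hinv.differentiable (by simp)
    -- The first two components of x/(r² + δ), times g. The divergence of this regularized
    -- horizontal field is 2δ/(r² + δ)² ≥ 0, which replaces the measure on the axis.
    let V : Fin 3 → Space3 → ℝ := fun i x => (x i * (axisSq x + δ)⁻¹) * g x
    have hcoord : ∀ i : Fin 3, ContDiff ℝ 1 fun x : Space3 => x i := fun i => by fun_prop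
    have hV : ∀ i, ContDiff ℝ 1 (V i) := fun i => ((hcoord i).mul hinv).mul hg
    have hVc : ∀ i, HasCompactSupport (V i) := fun i => hgc.mul_left
    have hpinv : ∀ i x, partialD i (fun x => (axisSq x + δ)⁻¹) x =
        -((axisSq x + δ) ^ 2)⁻¹ * partialD i axisSq x := by
      intro i x
      have := partialD_comp (f := axisSq) (x := x) i (η := fun y => (y + δ)⁻¹)
        (η' := -((axisSq x + δ) ^ 2)⁻¹)
        (by
          have := ((hasDerivAt_id (axisSq x)).add_const δ).fun_inv (hpos x).ne'
          simpa [neg_div] using this)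
        (differentiable_axisSq x)
      simpa using this
    have hVi : ∀ i : Fin 3, i ≠ 2 → ∀ x, partialD i (V i) x =
        x i * (axisSq x + δ)⁻¹ * partialD i g x +
        ((axisSq x + δ)⁻¹ - 2 * x i ^ 2 * ((axisSq x + δ) ^ 2)⁻¹) * g x := by
      intro i hi x
      have hc : DifferentiableAt ℝ (fun x : Space3 => x i) x := by fun_prop
      change partialD i (fun x => (x i * (axisSq x + δ)⁻¹) * g x) x = _
      rw [partialD_mul i (hc.fun_mul (hinvd x)) (hgd x), partialD_mul i hc (hinvd x), hpinv,
        partialD_coord, partialD_axisSq]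
      simp only [hi, if_true, if_false]; ring
    have hgi : ∀ i x, partialD i g x =
        η (u x) * partialD i χ x + deriv η (u x) * partialD i u x * χ x := by
      intro i x
      change partialD i (fun x => η (u x) * χ x) x = _
      have d2 : DifferentiableAt ℝ (fun y => η (u y)) x :=
        ((hη' (u x)).differentiableAt).comp x (hud x)
      rw [partialD_mul i d2 (hχd x),
        partialD_comp i (hη' (u x)) (hud x)]
    have hsum : ∀ x, axisSq x / (axisSq x + δ) * H x =
        (partialD 0 (V 0) x + partialD 1 (V 1) x) - 2 * δ / (axisSq x + δ) ^ 2 * g x := by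
      intro x
      have hp := (hpos x).ne'
      have h1 := hrad x
      have h2 := hχ.radial x
      rw [hVi 0 (by decide) x, hVi 1 (by decide) x, hgi, hgi]
      simp only [H, g]
      have e1 : x 0 ^ 2 = axisSq x - x 1 ^ 2 := by simp [axisSq]
      rw [e1]
      field_simp
      linear_combination (-2 * deriv η (u x) * χ x * (axisSq x + δ)) * h1 -
        (2 * η (u x) * (axisSq x + δ)) * h2
    have hVint : ∀ i, Integrable (partialD i (V i)) := fun i =>
      ((hV i).partialD (m := 0) (by simp) i).continuous.integrable_of_hasCompactSupport
        ((hVc i).partialD i)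
    have hgint : Integrable fun x => 2 * δ / (axisSq x + δ) ^ 2 * g x := by
      refine Continuous.integrable_of_hasCompactSupport ?_ hgc.mul_left
      have := continuous_axisSq
      have := hg.continuous
      exact (continuous_const.div (by fun_prop) fun x => pow_ne_zero _ (hpos x).ne').mul this
    simp only [hsum]
    have hadd : Integrable fun x => partialD 0 (V 0) x + partialD 1 (V 1) x :=
      (hVint 0).add (hVint 1)
    rw [integral_sub hadd hgint, integral_add (hVint 0) (hVint 1),
      integral_partialD_eq_zero (hV 0) (hVc 0), integral_partialD_eq_zero (hV 1) (hVc 1)]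
    have : 0 ≤ ∫ x, 2 * δ / (axisSq x + δ) ^ 2 * g x := by
      refine integral_nonneg fun x => ?_
      have := hpos x
      have := hη0 (u x)
      have := hχ.nonneg x
      simp only [g, Pi.zero_apply]
      positivity
    linarith
  -- As δ tends to 0 the factor r²/(r² + δ) tends to 1 off the axis and stays at most 1.
  have hlim : Tendsto (fun n : ℕ => ∫ x, axisSq x / (axisSq x + 1 / ((n : ℝ) + 1)) * H x) atTop
      (𝓝 (∫ x, H x)) := by
    refine tendsto_integral_of_dominated_convergence (fun x => ‖H x‖) (fun n => ?_) hHi.norm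
      (fun n => Eventually.of_forall fun x => ?_) ?_
    · have h : ∀ x, axisSq x + 1 / ((n : ℝ) + 1) ≠ 0 := fun x => by
        have := axisSq_nonneg x
        positivity
      have := continuous_axisSq
      exact ((this.div (by fun_prop) h).mul hHc).aestronglyMeasurable
    · have h1 := axisSq_nonneg x
      have h2 : 0 < 1 / ((n : ℝ) + 1) := by positivity
      rw [norm_mul, Real.norm_of_nonneg (by positivity)]
      exact mul_le_of_le_one_left (norm_nonneg _) ((div_le_one (by positivity)).2 (by linarith))
    · filter_upwards [ae_axisSq_pos] with x hx
      have h1 : Tendsto (fun n : ℕ => axisSq x + 1 / ((n : ℝ) + 1)) atTop (𝓝 (axisSq x + 0)) :=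
        tendsto_const_nhds.add tendsto_one_div_add_atTop_nhds_zero_nat
      rw [add_zero] at h1
      have := ((tendsto_const_nhds (x := axisSq x)).div h1 hx.ne').mul_const (H x)
      simpa [hx.ne'] using this
  have hle : ∫ x, H x ≤ 0 := le_of_tendsto' hlim fun n => step _ (by positivity)
  have i1 : Integrable fun x => deriv η (u x) * χ x * N x := by
    refine Continuous.integrable_of_hasCompactSupport ?_ (hχ.compact.mul_left).mul_right
    have := hu.continuous; have := hχ.contDiff.continuous
    fun_prop
  have i2 : Integrable fun x => η (u x) * κ x := by
    refine Continuous.integrable_of_hasCompactSupport ?_ hχ.compact_quot.mul_left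
    have := hη.continuous; have := hu.continuous; have := hχ.cont_quot
    fun_prop
  have e : ∫ x, H x = (∫ x, deriv η (u x) * χ x * N x) / 2 + ∫ x, η (u x) * κ x := by
    rw [integral_add (i1.div_const 2) i2, integral_div]
  rw [integral_neg, integral_const_mul]
  linarith

end Static

/-! ### The equation in coordinates and the local energy inequality. -/

lemma fderiv_eq_advect (f : Space3 → ℝ) (w : Space3 → Space3) (x : Space3) :
    fderiv ℝ f x (w x) = advect w f x := by
  have h : w x = ∑ i, w x i • EuclideanSpace.single i (1 : ℝ) := by
    ext j
    fin_cases j <;> simp [Fin.sum_univ_three]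
  rw [h, map_sum]
  simp [advect, partialD]

lemma radialDeriv_eq (f : Space3 → ℝ) (x : Space3) :
    radialDeriv f x = (x 0 * partialD 0 f x + x 1 * partialD 1 f x) / cylRadius x := by
  rw [radialDeriv, fderiv_eq_advect]
  simp [advect, radialUnit, Fin.sum_univ_three]
  ring

/-- The continuous function `∂ₜ Γ + v · ∇Γ - ΔΓ`, which equals `(2 / r) ∂_r Γ` off the axis. -/
def axisResidual (v : ℝ → Space3 → Space3) (Γ : ℝ → Space3 → ℝ) (t : ℝ) (x : Space3) : ℝ :=
  deriv (fun s => Γ s x) t + advect (v t) (Γ t) x - lap (Γ t) x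

namespace IsSmoothVelocity

variable {T : ℝ} {v : ℝ → Space3 → Space3}

lemma coord (hv : IsSmoothVelocity T v) (i : Fin 3) : SlabSmooth T fun t x => v t x i := by
  have := hv.smooth
  exact (EuclideanSpace.proj i : Space3 →L[ℝ] ℝ).contDiff.comp_contDiffOn this

lemma slice (hv : IsSmoothVelocity T v) {t : ℝ} (ht : t ∈ Ioo 0 T) : ContDiff ℝ ∞ (v t) :=
  contDiff_iff_contDiffAt.2 fun x =>
    (hv.smooth.contDiffAt ((isOpen_slab T).mem_nhds ⟨ht, mem_univ _⟩)).comp x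
      (contDiffAt_const.prodMk contDiffAt_id)

lemma slabCont_advect (hv : IsSmoothVelocity T v) {g : ℝ → Space3 → ℝ}
    (hg : ∀ i, SlabCont T fun t x => partialD i (g t) x) :
    SlabCont T fun t x => advect (v t) (g t) x :=
  SlabCont.sum fun i => (hv.coord i).slabCont.mul (hg i)

end IsSmoothVelocity

namespace SlabSmooth

variable {T : ℝ} {g : ℝ → Space3 → ℝ}

lemma slabCont_lap (hg : SlabSmooth T g) : SlabCont T fun t x => lap (g t) x :=
  SlabCont.sum fun i => ((hg.partialD i).partialD i).slabCont

lemma slabCont_gradSq (hg : SlabSmooth T g) : SlabCont T fun t x => gradSq (g t) x :=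
  SlabCont.sum fun i => (hg.partialD i).slabCont.comp (η := fun y => y ^ 2) (by fun_prop)

end SlabSmooth

lemma tsupport_partialD_subset (f : Space3 → ℝ) (i : Fin 3) :
    tsupport (partialD i f) ⊆ tsupport f := tsupport_fderiv_apply_subset ℝ _

lemma partialD_eq_zero_of_notMem {f : Space3 → ℝ} {x : Space3} (hx : x ∉ tsupport f)
    (i : Fin 3) : partialD i f x = 0 :=
  image_eq_zero_of_notMem_tsupport fun h => hx (tsupport_partialD_subset f i h)

lemma advect_eq_zero_of_notMem {f : Space3 → ℝ} {x : Space3} (hx : x ∉ tsupport f)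
    (w : Space3 → Space3) : advect w f x = 0 := by
  simp [advect, partialD_eq_zero_of_notMem hx]

lemma lap_eq_zero_of_notMem {f : Space3 → ℝ} {x : Space3} (hx : x ∉ tsupport f) :
    lap f x = 0 :=
  Finset.sum_eq_zero fun i _ =>
    partialD_eq_zero_of_notMem (fun h => hx (tsupport_partialD_subset f i h)) i

lemma continuous_lap {f : Space3 → ℝ} (hf : ContDiff ℝ 2 f) : Continuous (lap f) := by
  have : ∀ i, Continuous (partialD i (partialD i f)) := fun i =>
    ((hf.partialD (m := 1) (by norm_num) i).partialD (m := 0) (by simp) i).continuous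
  unfold lap; fun_prop

lemma IsSmoothVelocity.slabCont_flux {T : ℝ} {v : ℝ → Space3 → Space3}
    (hv : IsSmoothVelocity T v) {χ κ : Space3 → ℝ} (hχ : ContDiff ℝ 2 χ) (hκ : Continuous κ) :
    SlabCont T fun t x => advect (v t) χ x + lap χ x - 2 * κ x :=
  ((hv.slabCont_advect (g := fun _ => χ) fun i => SlabCont.of_space
    (hχ.partialD (m := 1) (by norm_num) i).continuous).add
      (SlabCont.of_space (continuous_lap hχ))).sub (SlabCont.of_space (by fun_prop))

lemma two_le_infty : (2 : WithTop ℕ∞) ≤ ((⊤ : ℕ∞) : WithTop ℕ∞) :=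
  WithTop.coe_le_coe.2 (le_top : (2 : ℕ∞) ≤ ⊤)

namespace IsSmoothGammaSolution

variable {T : ℝ} {q : ℝ≥0∞} {v : ℝ → Space3 → Space3} {Γ₀ : Space3 → ℝ} {Γ : ℝ → Space3 → ℝ}

lemma slabSmooth (hΓ : IsSmoothGammaSolution T q v Γ₀ Γ) : SlabSmooth T Γ := hΓ.smooth

lemma slabCont_axisResidual (hv : IsSmoothVelocity T v) (hΓ : IsSmoothGammaSolution T q v Γ₀ Γ) :
    SlabCont T (axisResidual v Γ) :=
  (hΓ.slabSmooth.timeDeriv.slabCont.add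
    (hv.slabCont_advect fun i => (hΓ.slabSmooth.partialD i).slabCont)).sub
    hΓ.slabSmooth.slabCont_lap

/-- Off the axis this is the equation multiplied by r²/2; on the axis both sides vanish. In this
form no singular coefficient remains and the identity holds at every point. -/
lemma radial_eq (hΓ : IsSmoothGammaSolution T q v Γ₀ Γ) {t : ℝ} (ht : t ∈ Ioo 0 T)
    (x : Space3) : x 0 * partialD 0 (Γ t) x + x 1 * partialD 1 (Γ t) x =
      axisSq x / 2 * axisResidual v Γ t x := by
  rcases (axisSq_nonneg x).eq_or_lt with h | h
  · have h0 : x 0 = 0 := by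
      have : x 0 ^ 2 + x 1 ^ 2 = 0 := h.symm
      nlinarith [sq_nonneg (x 0), sq_nonneg (x 1)]
    have h1 : x 1 = 0 := by
      have : x 0 ^ 2 + x 1 ^ 2 = 0 := h.symm
      nlinarith [sq_nonneg (x 0), sq_nonneg (x 1)]
    rw [← h, h0, h1]; ring
  · have hr := cylRadius_pos_iff.2 h
    have e := hΓ.equation t ht x hr
    rw [fderiv_eq_advect, laplacian_eq_sum_partialD
      ((hΓ.slabSmooth.slice ht).of_le two_le_infty),
      radialDeriv_eq] at e
    have e' : axisResidual v Γ t x = 2 / cylRadius x *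
        ((x 0 * partialD 0 (Γ t) x + x 1 * partialD 1 (Γ t) x) / cylRadius x) := by
      simp only [axisResidual, lap]; linarith
    rw [e', ← sq_cylRadius]
    field_simp

/-- The equation is linear, so bounds on the excess above positive levels also control the negative
part. -/
lemma neg (hΓ : IsSmoothGammaSolution T q v Γ₀ Γ) :
    IsSmoothGammaSolution T q v (fun x => -Γ₀ x) (fun t x => -Γ t x) where
  smooth := hΓ.smooth.neg
  axisymmetric t ht x y h1 h2 := congrArg Neg.neg (hΓ.axisymmetric t ht x y h1 h2)
  equation t ht x hx := by
    have e := hΓ.equation t ht x hx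
    have hd : fderiv ℝ (fun x => -Γ t x) x = -fderiv ℝ (Γ t) x := fderiv_fun_neg
    have hl : Laplacian.laplacian (fun x => -Γ t x) x = -Laplacian.laplacian (Γ t) x := by
      have := congrFun (InnerProductSpace.laplacian_neg (f := Γ t)) x
      exact this
    simp only [radialDeriv] at e ⊢
    rw [hd, hl, deriv.fun_neg]
    simp only [_root_.neg_apply]
    linarith
  memLp t ht := (hΓ.memLp t ht).neg
  continuous_Lq t ht := by
    refine (hΓ.continuous_Lq t ht).congr fun s => ?_
    rw [← eLpNorm_neg]
    congr 1
    funext x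
    simp only [Pi.neg_apply, Pi.sub_apply]
    ring
  initial := by filter_upwards [hΓ.initial] with x hx; rw [hx]

/-- The flux identity and the sign of the axis term, added at each time and integrated over [s, t].
Convexity of η is not needed here; it enters only when the dissipation term is discarded or
exploited. -/
lemma energy_le (hv : IsSmoothVelocity T v) (hΓ : IsSmoothGammaSolution T q v Γ₀ Γ)
    {η : ℝ → ℝ} (hη : ContDiff ℝ 2 η) (hη0 : ∀ y, 0 ≤ η y) {χ κ : Space3 → ℝ}
    (hχ : IsTestFn χ κ) {s t : ℝ} (hs : 0 < s) (hst : s ≤ t) (ht : t < T) :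
    (∫ x, η (Γ t x) * χ x) +
        ∫ τ in s..t, ∫ x, deriv (deriv η) (Γ τ x) * gradSq (Γ τ) x * χ x ≤
      (∫ x, η (Γ s x) * χ x) +
        ∫ τ in s..t, ∫ x, η (Γ τ x) * (advect (v τ) χ x + lap χ x - 2 * κ x) := by
  have hS := hΓ.slabSmooth
  have hη1 : ContDiff ℝ 1 (deriv η) := ((contDiff_succ_iff_deriv (n := 1)).1 hη).2.2
  have hηcc : Continuous (deriv (deriv η)) :=
    ((contDiff_succ_iff_deriv (n := 0)).1 hη1).2.2.continuous
  have hη' : ∀ y, HasDerivAt η (deriv η y) y := fun y =>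
    ((hη.differentiable (by simp)) y).hasDerivAt
  have cχ := SlabCont.of_space (T := T) hχ.contDiff.continuous
  have cκ := SlabCont.of_space (T := T) hχ.cont_quot
  have ciχ : ∀ i, ContDiff ℝ 1 (partialD i χ) := fun i => hχ.contDiff.partialD (by norm_num) i
  have clap := continuous_lap hχ.contDiff
  have c1 : SlabCont T fun t x => η (Γ t x) * χ x := (hS.slabCont.comp hη.continuous).mul cχ
  have c2 : SlabCont T fun t x => deriv η (Γ t x) * deriv (fun s => Γ s x) t * χ x :=
    ((hS.slabCont.comp hη1.continuous).mul hS.timeDeriv.slabCont).mul cχ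
  have c3 : SlabCont T fun t x => deriv (deriv η) (Γ t x) * gradSq (Γ t) x * χ x :=
    ((hS.slabCont.comp hηcc).mul hS.slabCont_gradSq).mul cχ
  have c4 : SlabCont T fun t x => η (Γ t x) * (advect (v t) χ x + lap χ x - 2 * κ x) :=
    (hS.slabCont.comp hη.continuous).mul (hv.slabCont_flux hχ.contDiff hχ.cont_quot)
  set K : Set Space3 := tsupport χ ∪ tsupport κ with hKdef
  have hK : IsCompact K := IsCompact.union hχ.compact hχ.compact_quot
  have z1 : ∀ x ∉ K, χ x = 0 := fun x hx =>
    image_eq_zero_of_notMem_tsupport fun h => hx (Or.inl h)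
  have z2 : ∀ x ∉ K, κ x = 0 := fun x hx =>
    image_eq_zero_of_notMem_tsupport fun h => hx (Or.inr h)
  have z5 : ∀ x ∉ K, lap χ x = 0 := fun x hx => lap_eq_zero_of_notMem fun h => hx (Or.inl h)
  have z6 : ∀ τ, ∀ x ∉ K, advect (v τ) χ x = 0 := fun τ x hx =>
    advect_eq_zero_of_notMem (fun h => hx (Or.inl h)) _
  have hsub : uIcc s t ⊆ Ioo 0 T := by
    rw [uIcc_of_le hst]; exact fun τ hτ => ⟨hs.trans_le hτ.1, hτ.2.trans_lt ht⟩
  have hftc := c1.integral_sub_eq c2 (fun t ht x => by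
    have h1 := (hη' (Γ t x)).comp t (hS.hasDerivAt ht x)
    exact h1.mul_const (χ x)) hK (fun t _ x hx => by simp [z1 x hx]) hs hst ht
  have k2 := c2.continuousOn_integral hK (fun t _ x hx => by simp [z1 x hx])
  have k3 := c3.continuousOn_integral hK (fun t _ x hx => by simp [z1 x hx])
  have k4 := c4.continuousOn_integral hK
    (fun t _ x hx => by simp [z2 x hx, z6 t x hx, z5 x hx])
  have i2 : IntervalIntegrable _ volume s t := (k2.mono hsub).intervalIntegrable
  have i3 : IntervalIntegrable _ volume s t := (k3.mono hsub).intervalIntegrable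
  have i4 : IntervalIntegrable _ volume s t := (k4.mono hsub).intervalIntegrable
  have hpt : ∀ τ ∈ Icc s t, (∫ x, deriv η (Γ τ x) * deriv (fun s => Γ s x) τ * χ x) ≤
      (∫ x, η (Γ τ x) * (advect (v τ) χ x + lap χ x - 2 * κ x)) -
        ∫ x, deriv (deriv η) (Γ τ x) * gradSq (Γ τ) x * χ x := by
    intro τ hτ
    have hτ' : τ ∈ Ioo 0 T := ⟨hs.trans_le hτ.1, hτ.2.trans_lt ht⟩
    have hu : ContDiff ℝ 2 (Γ τ) := (hS.slice hτ').of_le two_le_infty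
    have f1 := integral_energy_flux hu ((hv.slice hτ').of_le 
      (le_trans (by norm_num) two_le_infty)) (hv.div_free τ hτ') hη hχ.contDiff hχ.compact
    have cN := slabCont_axisResidual hv hΓ
    have f2 := integral_radial_le (hu.of_le (by norm_num)) (cN.slice hτ') (hΓ.radial_eq hτ')
      (hη.of_le (by norm_num)) hη0 hχ
    have j1 : Integrable fun x => deriv η (Γ τ x) * χ x * (lap (Γ τ) x - advect (v τ) (Γ τ) x) := by
      have := ((hS.slabCont.comp hη1.continuous).mul cχ).mul (hS.slabCont_lap.sub
        (hv.slabCont_advect fun i => (hS.partialD i).slabCont))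
      exact this.integrable_slice hK hτ' fun x hx => by simp [z1 x hx]
    have j2 : Integrable fun x => deriv η (Γ τ x) * χ x * axisResidual v Γ τ x := by
      have := ((hS.slabCont.comp hη1.continuous).mul cχ).mul cN
      exact this.integrable_slice hK hτ' fun x hx => by simp [z1 x hx]
    -- The time derivative is split as ΔΓ - v·∇Γ plus the residual, to which the two fixed-time
    -- lemmas apply separately.
    have e1 : (∫ x, deriv η (Γ τ x) * deriv (fun s => Γ s x) τ * χ x) =
        (∫ x, deriv η (Γ τ x) * χ x * (lap (Γ τ) x - advect (v τ) (Γ τ) x)) +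
        ∫ x, deriv η (Γ τ x) * χ x * axisResidual v Γ τ x := by
      rw [← integral_add j1 j2]
      congr 1
      funext x
      simp only [axisResidual]; ring
    have j3 : Integrable fun x => η (Γ τ x) * (advect (v τ) χ x + lap χ x) -
        deriv (deriv η) (Γ τ x) * gradSq (Γ τ) x * χ x := by
      have := ((hS.slabCont.comp hη.continuous).mul ((hv.slabCont_advect (g := fun _ => χ)
        fun i => SlabCont.of_space (ciχ i).continuous).add (SlabCont.of_space clap))).sub c3
      exact this.integrable_slice hK hτ' fun x hx => by simp [z1 x hx, z6 τ x hx, z5 x hx]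
    have j4 : Integrable fun x => -(2 * (η (Γ τ x) * κ x)) :=
      (((((hS.slabCont.comp hη.continuous).mul cκ).integrable_slice hK hτ'
        fun x hx => by simp [z2 x hx])).const_mul 2).neg
    have e2 : (∫ x, η (Γ τ x) * (advect (v τ) χ x + lap χ x - 2 * κ x)) -
        (∫ x, deriv (deriv η) (Γ τ x) * gradSq (Γ τ) x * χ x) =
        (∫ x, (η (Γ τ x) * (advect (v τ) χ x + lap χ x) -
          deriv (deriv η) (Γ τ x) * gradSq (Γ τ) x * χ x)) + ∫ x, -(2 * (η (Γ τ x) * κ x)) := by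
      rw [← integral_add j3 j4, ← integral_sub
        (c4.integrable_slice hK hτ' fun x hx => by simp [z2 x hx, z6 τ x hx, z5 x hx])
        (c3.integrable_slice hK hτ' fun x hx => by simp [z1 x hx])]
      congr 1
      funext x
      ring
    rw [e1, e2, ← f1]
    linarith
  have hmono := intervalIntegral.integral_mono_on hst i2 (i4.sub i3) hpt
  rw [intervalIntegral.integral_sub i4 i3] at hmono
  linarith

end IsSmoothGammaSolution

/-! ### Convex profiles vanishing on a half-line -/

lemma hasDerivAt_posPart_sq (y : ℝ) : HasDerivAt (fun z : ℝ => max z 0 ^ 2) (2 * max y 0) y := by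
  rcases lt_trichotomy y 0 with h | h | h
  · have e : (fun z : ℝ => max z 0 ^ 2) =ᶠ[𝓝 y] fun _ => 0 := by
      filter_upwards [isOpen_Iio.mem_nhds h] with z hz
      simp [max_eq_right (le_of_lt (mem_Iio.1 hz))]
    rw [max_eq_right h.le, mul_zero]
    exact (hasDerivAt_const y (0 : ℝ)).congr_of_eventuallyEq e
  · subst h
    simp only [max_self, mul_zero]
    rw [hasDerivAt_iff_isLittleO_nhds_zero]
    have h1 : (fun h : ℝ => h ^ 2) =o[𝓝 0] fun h => h := by
      simpa using Asymptotics.isLittleO_pow_pow (𝕜 := ℝ) (m := 1) (n := 2) (by norm_num)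
    refine Asymptotics.IsBigO.trans_isLittleO (Asymptotics.IsBigO.of_bound 1 ?_) h1
    refine Eventually.of_forall fun h => ?_
    simp only [zero_add, max_self, smul_zero, ne_eq, OfNat.ofNat_ne_zero, not_false_eq_true,
      zero_pow, sub_zero, norm_pow, Real.norm_eq_abs, one_mul]
    have : |max h 0| ≤ |h| := by
      rw [abs_of_nonneg (le_max_right _ _)]
      exact max_le (le_abs_self h) (abs_nonneg h)
    exact pow_le_pow_left₀ (abs_nonneg _) this 2
  · have e : (fun z : ℝ => max z 0 ^ 2) =ᶠ[𝓝 y] fun z => z ^ 2 := by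
      filter_upwards [isOpen_Ioi.mem_nhds h] with z hz
      rw [max_eq_left (le_of_lt (mem_Ioi.1 hz))]
    rw [max_eq_left h.le]
    have := (hasDerivAt_pow 2 y).congr_of_eventuallyEq e
    simpa using this

lemma contDiff_one_of_hasDerivAt {f f' : ℝ → ℝ} (h : ∀ y, HasDerivAt f (f' y) y)
    (hc : Continuous f') : ContDiff ℝ 1 f := by
  rw [contDiff_one_iff_deriv]
  refine ⟨fun y => (h y).differentiableAt, ?_⟩
  have : deriv f = f' := funext fun y => (h y).deriv
  rwa [this]

lemma contDiff_posPart_sq : ContDiff ℝ 1 fun z : ℝ => max z 0 ^ 2 :=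
  contDiff_one_of_hasDerivAt hasDerivAt_posPart_sq (by fun_prop)

/-- The primitive of `φ` vanishing at `k`, with the argument of `φ` shifted by `k`. -/
def shiftPrim (φ : ℝ → ℝ) (k y : ℝ) : ℝ := ∫ σ in (0 : ℝ)..(y - k), φ σ

section ShiftPrim

variable {φ : ℝ → ℝ} {k A : ℝ}

lemma hasDerivAt_shiftPrim (hφ : Continuous φ) (y : ℝ) :
    HasDerivAt (shiftPrim φ k) (φ (y - k)) y := by
  have h := intervalIntegral.integral_hasDerivAt_right (hφ.intervalIntegrable 0 (y - k))
    hφ.aestronglyMeasurable.stronglyMeasurableAtFilter hφ.continuousAt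
  exact h.comp_sub_const y k

lemma deriv_shiftPrim (hφ : Continuous φ) : deriv (shiftPrim φ k) = fun y => φ (y - k) :=
  funext fun y => (hasDerivAt_shiftPrim hφ y).deriv

lemma contDiff_shiftPrim (hφ : ContDiff ℝ 1 φ) : ContDiff ℝ 2 (shiftPrim φ k) := by
  have : ContDiff ℝ (1 + 1) (shiftPrim φ k) := by
    rw [contDiff_succ_iff_deriv]
    refine ⟨fun y => (hasDerivAt_shiftPrim hφ.continuous y).differentiableAt, by simp, ?_⟩
    rw [deriv_shiftPrim hφ.continuous]
    exact hφ.comp (contDiff_id.sub contDiff_const)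
  norm_num at this
  exact this

lemma shiftPrim_nonneg (h0 : ∀ y, 0 ≤ φ y) (hneg : ∀ y ≤ 0, φ y = 0) (y : ℝ) :
    0 ≤ shiftPrim φ k y := by
  rcases le_total 0 (y - k) with h | h
  · exact intervalIntegral.integral_nonneg h fun σ _ => h0 σ
  · rw [shiftPrim, intervalIntegral.integral_zero_ae]
    refine Eventually.of_forall fun σ hσ => hneg σ ?_
    rw [uIoc_of_ge h] at hσ; exact hσ.2

lemma shiftPrim_le (hφ : Continuous φ) (hA : ∀ y, φ y ≤ A)
    (hneg : ∀ y ≤ 0, φ y = 0) (y : ℝ) : shiftPrim φ k y ≤ A * max (y - k) 0 := by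
  rcases le_total 0 (y - k) with h | h
  · rw [max_eq_left h]
    calc shiftPrim φ k y ≤ ∫ _ in (0 : ℝ)..(y - k), A :=
          intervalIntegral.integral_mono_on h (hφ.intervalIntegrable _ _) (by simp)
            fun σ _ => hA σ
      _ = A * (y - k) := by simp [mul_comm]
  · rw [max_eq_right h, mul_zero, shiftPrim, intervalIntegral.integral_zero_ae]
    refine Eventually.of_forall fun σ hσ => hneg σ ?_
    rw [uIoc_of_ge h] at hσ; exact hσ.2

end ShiftPrim

/-- A smooth approximation of the Heaviside function. -/
def softStep (δ y : ℝ) : ℝ := max y 0 ^ 2 / (max y 0 ^ 2 + δ ^ 2)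

section SoftStep

variable {δ : ℝ}

lemma contDiff_softStep (hδ : 0 < δ) : ContDiff ℝ 1 (softStep δ) :=
  contDiff_posPart_sq.div (contDiff_posPart_sq.add contDiff_const) fun y => by positivity

lemma softStep_nonneg (y : ℝ) : 0 ≤ softStep δ y := by unfold softStep; positivity

lemma softStep_le_one (y : ℝ) : softStep δ y ≤ 1 :=
  div_le_one_of_le₀ (by nlinarith [sq_nonneg δ]) (by positivity)

lemma softStep_of_nonpos (y : ℝ) (hy : y ≤ 0) : softStep δ y = 0 := by
  simp [softStep, max_eq_right hy]

lemma monotone_softStep (hδ : 0 < δ) : Monotone (softStep δ) := by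
  intro a b hab
  unfold softStep
  have h : max a 0 ^ 2 ≤ max b 0 ^ 2 :=
    pow_le_pow_left₀ (le_max_right _ _) (max_le_max_right 0 hab) 2
  have hd : 0 < δ ^ 2 := by positivity
  rw [div_le_div_iff₀ (by positivity) (by positivity)]
  nlinarith

lemma tendsto_softStep {y : ℝ} (hy : 0 < y) :
    Tendsto (fun n : ℕ => softStep (1 / ((n : ℝ) + 1)) y) atTop (𝓝 1) := by
  unfold softStep
  have h0 : 0 < max y 0 ^ 2 := by rw [max_eq_left hy.le]; positivity
  have h1 : Tendsto (fun n : ℕ => max y 0 ^ 2 + (1 / ((n : ℝ) + 1)) ^ 2) atTop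
      (𝓝 (max y 0 ^ 2 + 0 ^ 2)) :=
    tendsto_const_nhds.add (tendsto_one_div_add_atTop_nhds_zero_nat.pow 2)
  have h2 := (tendsto_const_nhds (x := max y 0 ^ 2)).div h1 (by simpa using h0.ne')
  rw [zero_pow two_ne_zero, add_zero, div_self h0.ne'] at h2
  exact h2

lemma tendsto_shiftPrim_softStep (k y : ℝ) :
    Tendsto (fun n : ℕ => shiftPrim (softStep (1 / ((n : ℝ) + 1))) k y) atTop
      (𝓝 (max (y - k) 0)) := by
  have hpos : ∀ n : ℕ, 0 < 1 / ((n : ℝ) + 1) := fun n => by positivity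
  rcases le_total (y - k) 0 with h | h
  · have : ∀ n : ℕ, shiftPrim (softStep (1 / ((n : ℝ) + 1))) k y = 0 := fun n => by
      refine le_antisymm ?_ (shiftPrim_nonneg softStep_nonneg softStep_of_nonpos y)
      have := shiftPrim_le (k := k) (contDiff_softStep (hpos n)).continuous softStep_le_one
        softStep_of_nonpos y
      simpa [max_eq_right h] using this
    simp only [this, max_eq_right h, tendsto_const_nhds_iff]
  · rw [max_eq_left h]
    have e : y - k = ∫ _ in (0 : ℝ)..(y - k), (1 : ℝ) := by simp
    rw [show 𝓝 (y - k) = 𝓝 (∫ _ in (0 : ℝ)..(y - k), (1 : ℝ)) by rw [← e]]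
    refine intervalIntegral.tendsto_integral_filter_of_dominated_convergence (fun _ => 1)
      (Eventually.of_forall fun n =>
        (contDiff_softStep (hpos n)).continuous.aestronglyMeasurable)
      (Eventually.of_forall fun n => Eventually.of_forall fun σ _ => ?_) (by simp)
      (Eventually.of_forall fun σ hσ => ?_)
    · rw [Real.norm_of_nonneg (softStep_nonneg σ)]; exact softStep_le_one σ
    · rw [uIoc_of_le h] at hσ
      exact tendsto_softStep hσ.1

end SoftStep

/-! ### Spatial cutoffs -/

/-- The squared Euclidean norm, in coordinates. -/
def normSq3 (x : Space3) : ℝ := x 0 ^ 2 + x 1 ^ 2 + x 2 ^ 2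

lemma normSq3_eq (x : Space3) : normSq3 x = ‖x‖ ^ 2 := by
  rw [EuclideanSpace.norm_sq_eq]
  simp [normSq3, Fin.sum_univ_three]

lemma contDiff_normSq3 {n : WithTop ℕ∞} : ContDiff ℝ n normSq3 := by
  unfold normSq3; fun_prop

lemma differentiable_normSq3 : Differentiable ℝ normSq3 :=
  (contDiff_normSq3 (n := 1)).differentiable (by simp)

lemma normSq3_nonneg (x : Space3) : 0 ≤ normSq3 x := by unfold normSq3; positivity

lemma sq_coord_le_normSq3 (x : Space3) (i : Fin 3) : x i ^ 2 ≤ normSq3 x := by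
  unfold normSq3
  fin_cases i <;> simp <;> nlinarith [sq_nonneg (x 0), sq_nonneg (x 1), sq_nonneg (x 2)]

lemma axisSq_le_normSq3 (x : Space3) : axisSq x ≤ normSq3 x := by
  unfold normSq3 axisSq; nlinarith [sq_nonneg (x 2)]

lemma partialD_normSq3 (i : Fin 3) (x : Space3) : partialD i normSq3 x = 2 * x i := by
  have h : normSq3 = fun y => axisSq y + y 2 * y 2 := by
    funext y; simp [normSq3, axisSq]; ring
  have hd : DifferentiableAt ℝ (fun y : Space3 => y 2) x := by fun_prop
  rw [h, partialD_add i (differentiable_axisSq x) (hd.fun_mul hd), partialD_mul i hd hd,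
    partialD_axisSq, partialD_coord]
  fin_cases i <;> simp <;> ring

lemma partialD_comp_normSq3 {f f' : ℝ → ℝ} (hf : ∀ y, HasDerivAt f (f' y) y) (i : Fin 3)
    (x : Space3) : partialD i (fun y => f (normSq3 y)) x = f' (normSq3 x) * (2 * x i) := by
  rw [partialD_comp i (hf _) (differentiable_normSq3 x), partialD_normSq3]

lemma lap_comp_normSq3 {f f' f'' : ℝ → ℝ} (hf : ∀ y, HasDerivAt f (f' y) y)
    (hf' : ∀ y, HasDerivAt f' (f'' y) y) (x : Space3) :
    lap (fun y => f (normSq3 y)) x = 4 * normSq3 x * f'' (normSq3 x) + 6 * f' (normSq3 x) := by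
  have h : ∀ i, partialD i (partialD i fun y => f (normSq3 y)) x =
      f' (normSq3 x) * 2 + f'' (normSq3 x) * (2 * x i) * (2 * x i) := by
    intro i
    have e : (partialD i fun y => f (normSq3 y)) = fun y => f' (normSq3 y) * (2 * y i) :=
      funext fun y => partialD_comp_normSq3 hf i y
    have d1 : DifferentiableAt ℝ (fun y => f' (normSq3 y)) x :=
      (hf' _).differentiableAt.comp x (differentiable_normSq3 x)
    have d2 : DifferentiableAt ℝ (fun y : Space3 => y i) x := by fun_prop
    rw [e, partialD_mul i d1 (d2.const_mul 2), partialD_comp_normSq3 hf',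
      partialD_mul i (by fun_prop) d2, partialD_coord]
    simp
  have hn : normSq3 x = x 0 ^ 2 + x 1 ^ 2 + x 2 ^ 2 := rfl
  simp only [lap, h, Fin.sum_univ_three]
  linear_combination (-(4 * f'' (normSq3 x))) * hn

/-- The profile of the cutoffs: `1` on `(-∞, 1]` and `0` on `[2, ∞)`. -/
def cutProfile (y : ℝ) : ℝ := Real.smoothTransition (2 - y)

lemma contDiff_cutProfile {n : ℕ∞} : ContDiff ℝ n cutProfile :=
  Real.smoothTransition.contDiff.comp (contDiff_const.sub contDiff_id)

lemma cutProfile_eq_one {y : ℝ} (h : y ≤ 1) : cutProfile y = 1 :=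
  Real.smoothTransition.one_of_one_le (by linarith)

lemma cutProfile_eq_zero {y : ℝ} (h : 2 ≤ y) : cutProfile y = 0 :=
  Real.smoothTransition.zero_of_nonpos (by linarith)

lemma hasDerivAt_cutProfile (y : ℝ) : HasDerivAt cutProfile (deriv cutProfile y) y :=
  ((contDiff_cutProfile (n := 1)).differentiable (by simp) y).hasDerivAt

lemma contDiff_deriv_cutProfile : ContDiff ℝ 1 (deriv cutProfile) :=
  ((contDiff_succ_iff_deriv (n := 1)).1 (by
    have := contDiff_cutProfile (n := 2); norm_num; exact this)).2.2

lemma hasDerivAt_deriv_cutProfile (y : ℝ) :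
    HasDerivAt (deriv cutProfile) (deriv (deriv cutProfile) y) y :=
  (contDiff_deriv_cutProfile.differentiable (by simp) y).hasDerivAt

lemma deriv_cutProfile_eq_zero {y : ℝ} (h : y < 1 ∨ 2 < y) :
    deriv cutProfile y = 0 ∧ deriv (deriv cutProfile) y = 0 := by
  have key : ∀ z, z < 1 ∨ 2 < z → deriv cutProfile z = 0 := by
    rintro z (hz | hz)
    · have e : cutProfile =ᶠ[𝓝 z] fun _ => 1 := by
        filter_upwards [isOpen_Iio.mem_nhds hz] with w hw using cutProfile_eq_one (le_of_lt hw)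
      rw [e.deriv_eq]; simp
    · have e : cutProfile =ᶠ[𝓝 z] fun _ => 0 := by
        filter_upwards [isOpen_Ioi.mem_nhds hz] with w hw using cutProfile_eq_zero (le_of_lt hw)
      rw [e.deriv_eq]; simp
  refine ⟨key y h, ?_⟩
  have hopen : IsOpen {z : ℝ | z < 1 ∨ 2 < z} := isOpen_Iio.union isOpen_Ioi
  have e : deriv cutProfile =ᶠ[𝓝 y] fun _ => 0 := by
    filter_upwards [hopen.mem_nhds h] with w hw using key w hw
  rw [e.deriv_eq]; simp

lemma exists_bound_cutProfile : ∃ C : ℝ, 0 ≤ C ∧ ∀ y, |deriv cutProfile y| ≤ C ∧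
    |deriv (deriv cutProfile) y| ≤ C := by
  have hc := contDiff_deriv_cutProfile.continuous
  have hcc : Continuous (deriv (deriv cutProfile)) :=
    ((contDiff_succ_iff_deriv (n := 0)).1 contDiff_deriv_cutProfile).2.2.continuous
  obtain ⟨C1, h1⟩ := (isCompact_Icc (a := (1 : ℝ)) (b := 2)).exists_bound_of_continuousOn
    hc.continuousOn
  obtain ⟨C2, h2⟩ := (isCompact_Icc (a := (1 : ℝ)) (b := 2)).exists_bound_of_continuousOn
    hcc.continuousOn
  refine ⟨max (max C1 C2) 0, le_max_right _ _, fun y => ?_⟩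
  by_cases hy : y ∈ Icc (1 : ℝ) 2
  · exact ⟨(h1 y hy).trans (by simp), (h2 y hy).trans (by simp)⟩
  · have : y < 1 ∨ 2 < y := by
      by_contra! h
      exact hy ⟨h.1, h.2⟩
    simp [deriv_cutProfile_eq_zero this]

/-- The smooth cutoff at scale `R`. -/
def cut (R : ℝ) (x : Space3) : ℝ := cutProfile (normSq3 x / R ^ 2)

/-- The radial quotient of the cutoff at scale `R`. -/
def cutQuot (R : ℝ) (x : Space3) : ℝ := 2 * deriv cutProfile (normSq3 x / R ^ 2) / R ^ 2

section Cut

variable {R : ℝ}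

lemma cut_nonneg (x : Space3) : 0 ≤ cut R x := Real.smoothTransition.nonneg _

lemma cut_le_one (x : Space3) : cut R x ≤ 1 := Real.smoothTransition.le_one _

lemma contDiff_cut {n : ℕ∞} : ContDiff ℝ n (cut R) :=
  contDiff_cutProfile.comp (contDiff_normSq3.div_const _)

lemma differentiable_cut : Differentiable ℝ (cut R) :=
  (contDiff_cut (n := 1)).differentiable (by simp)

lemma cut_eq_one (hR : 0 < R) {x : Space3} (h : normSq3 x ≤ R ^ 2) : cut R x = 1 :=
  cutProfile_eq_one (by rw [div_le_one (by positivity)]; exact h)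

lemma hasCompactSupport_comp_normSq3_div (hR : 0 < R) {f : ℝ → ℝ} (hf : ∀ y, 2 < y → f y = 0) :
    HasCompactSupport fun x => f (normSq3 x / R ^ 2) := by
  refine HasCompactSupport.intro (isCompact_closedBall (0 : Space3) (2 * R)) fun x hx => hf _ ?_
  simp only [Metric.mem_closedBall, dist_zero_right, not_le] at hx
  rw [lt_div_iff₀ (by positivity), normSq3_eq]
  nlinarith

lemma hasCompactSupport_cut (hR : 0 < R) : HasCompactSupport (cut R) :=
  hasCompactSupport_comp_normSq3_div hR fun _ hy => cutProfile_eq_zero hy.le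

lemma hasCompactSupport_cutQuot (hR : 0 < R) : HasCompactSupport (cutQuot R) :=
  hasCompactSupport_comp_normSq3_div hR (f := fun y => 2 * deriv cutProfile y / R ^ 2)
    fun _ hy => by simp [deriv_cutProfile_eq_zero (Or.inr hy)]

lemma continuous_cutQuot : Continuous (cutQuot R) := by
  have h := contDiff_deriv_cutProfile.continuous
  have h2 : Continuous normSq3 := (contDiff_normSq3 (n := 0)).continuous
  unfold cutQuot
  fun_prop

lemma partialD_cut (i : Fin 3) (x : Space3) : partialD i (cut R) x = cutQuot R x * x i := by
  have := partialD_comp_normSq3 (f := fun y => cutProfile (y / R ^ 2))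
    (f' := fun y => deriv cutProfile (y / R ^ 2) / R ^ 2)
    (fun y => by
      have := (hasDerivAt_cutProfile (y / R ^ 2)).comp y ((hasDerivAt_id y).div_const (R ^ 2))
      simpa [div_eq_mul_inv, Function.comp_def] using this) i x
  change partialD i (fun y => cutProfile (normSq3 y / R ^ 2)) x = _
  rw [this, cutQuot]; ring

lemma lap_cut (x : Space3) : lap (cut R) x =
    4 * (normSq3 x / R ^ 2) * deriv (deriv cutProfile) (normSq3 x / R ^ 2) / R ^ 2 +
      3 * cutQuot R x := by
  have := lap_comp_normSq3 (f := fun y => cutProfile (y / R ^ 2))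
    (f' := fun y => deriv cutProfile (y / R ^ 2) / R ^ 2)
    (f'' := fun y => deriv (deriv cutProfile) (y / R ^ 2) / R ^ 2 / R ^ 2)
    (fun y => by
      have := (hasDerivAt_cutProfile (y / R ^ 2)).comp y ((hasDerivAt_id y).div_const (R ^ 2))
      simpa [div_eq_mul_inv, Function.comp_def] using this)
    (fun y => by
      have := ((hasDerivAt_deriv_cutProfile (y / R ^ 2)).comp y
        ((hasDerivAt_id y).div_const (R ^ 2))).div_const (R ^ 2)
      simpa [div_eq_mul_inv, Function.comp_def] using this) x
  change lap (fun y => cutProfile (normSq3 y / R ^ 2)) x = _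
  rw [this, cutQuot]; ring

lemma radial_cut (x : Space3) :
    x 0 * partialD 0 (cut R) x + x 1 * partialD 1 (cut R) x = axisSq x * cutQuot R x := by
  rw [partialD_cut, partialD_cut, axisSq]; ring

lemma cut_deriv_eq_zero (hR : 0 < R) {x : Space3} (hx : normSq3 x < R ^ 2) :
    cutQuot R x = 0 ∧ (∀ i, partialD i (cut R) x = 0) ∧ lap (cut R) x = 0 := by
  have h : normSq3 x / R ^ 2 < 1 := by rwa [div_lt_one (by positivity)]
  have h1 : cutQuot R x = 0 := by simp [cutQuot, deriv_cutProfile_eq_zero (Or.inl h)]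
  refine ⟨h1, fun i => by rw [partialD_cut, h1, zero_mul], ?_⟩
  rw [lap_cut, h1, (deriv_cutProfile_eq_zero (Or.inl h)).2]; ring

/-- Derivatives of the cutoff live where |x|² ≤ 2R². First derivatives are O(1/R); the Laplacian and
the radial quotient are O(1/R²), which is weakened to the common rate O(1/R) using R ≥ 1. -/
lemma exists_bound_cut : ∃ C : ℝ, 0 ≤ C ∧ ∀ R : ℝ, 1 ≤ R → ∀ x, |cutQuot R x| ≤ C / R ∧
    (∀ i, |partialD i (cut R) x| ≤ C / R) ∧ |lap (cut R) x| ≤ C / R := by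
  obtain ⟨C, hC0, hC⟩ := exists_bound_cutProfile
  -- 14 = 8 + 3 · 2: the second-derivative term of the Laplacian contributes 8C, and three times the
  -- radial quotient contributes 6C.
  refine ⟨14 * C, by positivity, fun R hR x => ?_⟩
  have hR0 : 0 < R := by linarith
  have hq : |cutQuot R x| ≤ 2 * C / R ^ 2 := by
    rw [cutQuot, abs_div, abs_mul, abs_of_pos (show (0 : ℝ) < R ^ 2 by positivity)]
    gcongr
    · norm_num
    · exact (hC _).1
  have hRR : 1 / R ^ 2 ≤ 1 / R := by
    apply one_div_le_one_div_of_le hR0; nlinarith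
  have hq2 : |cutQuot R x| ≤ 2 * C * (1 / R) := by
    refine hq.trans ?_
    rw [div_eq_mul_one_div]; gcongr
  have hCR : 0 ≤ C * (1 / R) := by positivity
  have e14 : 14 * C / R = 14 * (C * (1 / R)) := by ring
  rw [e14]
  by_cases h2 : 2 < normSq3 x / R ^ 2
  · have h0 : cutQuot R x = 0 := by simp [cutQuot, deriv_cutProfile_eq_zero (Or.inr h2)]
    refine ⟨by rw [h0]; simpa using hCR, fun i => by rw [partialD_cut, h0]; simpa using hCR, ?_⟩
    rw [lap_cut, h0, (deriv_cutProfile_eq_zero (Or.inr h2)).2]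
    simpa using hCR
  · push Not at h2
    have hx2 : normSq3 x ≤ 2 * R ^ 2 := by rwa [div_le_iff₀ (by positivity)] at h2
    refine ⟨by linarith, fun i => ?_, ?_⟩
    · have hxi : |x i| ≤ 2 * R := by
        refine abs_le_of_sq_le_sq ?_ (by positivity)
        have := sq_coord_le_normSq3 x i
        nlinarith
      rw [partialD_cut, abs_mul]
      calc |cutQuot R x| * |x i| ≤ (2 * C / R ^ 2) * (2 * R) := by gcongr
        _ = 4 * (C * (1 / R)) := by field_simp; ring
        _ ≤ _ := by linarith
    · rw [lap_cut]
      have hn := normSq3_nonneg x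
      have h0 : 0 ≤ normSq3 x / R ^ 2 := by positivity
      have : |4 * (normSq3 x / R ^ 2) * deriv (deriv cutProfile) (normSq3 x / R ^ 2) / R ^ 2| ≤
          8 * (C * (1 / R)) := by
        rw [abs_div, abs_mul, abs_of_pos (show (0 : ℝ) < R ^ 2 by positivity),
          abs_of_nonneg (by positivity : 0 ≤ 4 * (normSq3 x / R ^ 2))]
        calc _ ≤ 4 * 2 * C / R ^ 2 := by
              gcongr
              exact (hC _).2
          _ = 8 * (C * (1 / R ^ 2)) := by ring
          _ ≤ _ := by gcongr
      calc _ ≤ _ := abs_add_le _ _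
        _ ≤ 8 * (C * (1 / R)) + 3 * (2 * C * (1 / R)) := by
            rw [abs_mul 3, abs_of_pos (by norm_num : (0 : ℝ) < 3)]; gcongr
        _ = _ := by ring

lemma tendsto_cut (x : Space3) : Tendsto (fun n : ℕ => cut ((n : ℝ) + 1) x) atTop (𝓝 1) := by
  refine tendsto_const_nhds.congr' ?_
  obtain ⟨N, hN⟩ := exists_nat_ge ‖x‖
  filter_upwards [eventually_ge_atTop N] with n hn
  have : (N : ℝ) ≤ n := by exact_mod_cast hn
  refine (cut_eq_one (by positivity) ?_).symm
  rw [normSq3_eq]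
  exact pow_le_pow_left₀ (norm_nonneg x) (by linarith) 2

end Cut

/-! ### Bounded weights and the error caused by cutting them off. -/

/-- A bounded nonnegative weight with bounded first derivatives and continuous radial quotient. -/
structure IsWeight (ψ κ : Space3 → ℝ) (B : ℝ) : Prop where
  contDiff : ContDiff ℝ 2 ψ
  nonneg : ∀ x, 0 ≤ ψ x
  le : ∀ x, ψ x ≤ B
  partialD_le : ∀ i x, |partialD i ψ x| ≤ B
  cont_quot : Continuous κ
  radial : ∀ x, x 0 * partialD 0 ψ x + x 1 * partialD 1 ψ x = axisSq x * κ x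

lemma isWeight_one : IsWeight (fun _ => 1) (fun _ => 0) 1 where
  contDiff := contDiff_const
  nonneg _ := zero_le_one
  le _ := le_rfl
  partialD_le i x := by simp
  cont_quot := continuous_const
  radial x := by simp

lemma lap_mul {f g : Space3 → ℝ} (hf : ContDiff ℝ 2 f) (hg : ContDiff ℝ 2 g) (x : Space3) :
    lap (fun y => f y * g y) x =
      f x * lap g x + 2 * (∑ i, partialD i f x * partialD i g x) + lap f x * g x := by
  have hfd : Differentiable ℝ f := hf.differentiable (by simp)
  have hgd : Differentiable ℝ g := hg.differentiable (by simp)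
  have hfi : ∀ i, Differentiable ℝ (partialD i f) := fun i =>
    (hf.partialD (m := 1) (by norm_num) i).differentiable (by simp)
  have hgi : ∀ i, Differentiable ℝ (partialD i g) := fun i =>
    (hg.partialD (m := 1) (by norm_num) i).differentiable (by simp)
  have h : ∀ i, partialD i (partialD i fun y => f y * g y) x =
      f x * partialD i (partialD i g) x + 2 * (partialD i f x * partialD i g x) +
        partialD i (partialD i f) x * g x := by
    intro i
    have e : (partialD i fun y => f y * g y) =
        fun y => f y * partialD i g y + partialD i f y * g y :=
      funext fun y => partialD_mul i (hfd y) (hgd y)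
    rw [e, partialD_add i ((hfd x).fun_mul (hgi i x)) ((hfi i x).fun_mul (hgd x)),
      partialD_mul i (hfd x) (hgi i x), partialD_mul i (hfi i x) (hgd x)]
    ring
  unfold lap
  simp only [h, Fin.sum_univ_three]
  ring

lemma IsWeight.isTestFn {ψ κ : Space3 → ℝ} {B : ℝ} (h : IsWeight ψ κ B) {R : ℝ} (hR : 0 < R) :
    IsTestFn (fun x => ψ x * cut R x) (fun x => ψ x * cutQuot R x + κ x * cut R x) where
  contDiff := h.contDiff.mul (contDiff_cut (n := 2))
  compact := (hasCompactSupport_cut hR).mul_left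
  nonneg x := mul_nonneg (h.nonneg x) (cut_nonneg x)
  cont_quot := (h.contDiff.continuous.mul continuous_cutQuot).add
    (h.cont_quot.mul (contDiff_cut (n := 0)).continuous)
  compact_quot := (hasCompactSupport_cutQuot hR).mul_left.add (hasCompactSupport_cut hR).mul_left
  radial x := by
    have hψ : DifferentiableAt ℝ ψ x := h.contDiff.differentiable (by simp) x
    have hc : DifferentiableAt ℝ (cut R) x := differentiable_cut x
    rw [partialD_mul 0 hψ hc, partialD_mul 1 hψ hc]
    linear_combination (cut R x) * h.radial x + ψ x * radial_cut (R := R) x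

/-- Each term in which a derivative falls on the cutoff is O(1/R), uniformly over all fields with
components bounded by Cv. What remains is the flux of ψ itself times the cutoff. -/
lemma IsWeight.flux_le {ψ κ : Space3 → ℝ} {B : ℝ} (h : IsWeight ψ κ B) (Cv : ℝ) :
    ∃ E : ℝ, 0 ≤ E ∧ ∀ R : ℝ, 1 ≤ R → ∀ (w : Space3 → Space3) (x : Space3) (W : ℝ),
      (∀ i, |w x i| ≤ Cv) → advect w ψ x + lap ψ x - 2 * κ x ≤ W →
      advect w (fun x => ψ x * cut R x) x + lap (fun x => ψ x * cut R x) x -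
        2 * (ψ x * cutQuot R x + κ x * cut R x) ≤ W * cut R x + E / R := by
  obtain ⟨C, hC0, hC⟩ := exists_bound_cut
  have hB : 0 ≤ B := (h.nonneg 0).trans (h.le 0)
  refine ⟨B * (3 * (|Cv| * C) + C + 2 * C) + 6 * (B * C), by positivity,
    fun R hR w x W hw hW => ?_⟩
  obtain ⟨h1, h2, h3⟩ := hC R hR x
  have hR0 : 0 < R := by linarith
  have hψ : DifferentiableAt ℝ ψ x := h.contDiff.differentiable (by simp) x
  have hc : DifferentiableAt ℝ (cut R) x := differentiable_cut x
  have ea : advect w (fun x => ψ x * cut R x) x =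
      ψ x * advect w (cut R) x + advect w ψ x * cut R x := by
    simp only [advect, partialD_mul _ hψ hc, Fin.sum_univ_three]; ring
  rw [ea, lap_mul h.contDiff (contDiff_cut (n := 2))]
  have b1 : advect w (cut R) x ≤ 3 * (|Cv| * (C / R)) := by
    have : ∀ i, w x i * partialD i (cut R) x ≤ |Cv| * (C / R) := fun i => by
      refine (le_abs_self _).trans ?_
      rw [abs_mul]
      exact mul_le_mul ((hw i).trans (le_abs_self _)) (h2 i) (abs_nonneg _) (abs_nonneg _)
    simp only [advect, Fin.sum_univ_three]
    linarith [this 0, this 1, this 2]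
  have b2 : ∑ i, partialD i ψ x * partialD i (cut R) x ≤ 3 * (B * (C / R)) := by
    have : ∀ i, partialD i ψ x * partialD i (cut R) x ≤ B * (C / R) := fun i => by
      refine (le_abs_self _).trans ?_
      rw [abs_mul]
      exact mul_le_mul (h.partialD_le i x) (h2 i) (abs_nonneg _) hB
    simp only [Fin.sum_univ_three]
    linarith [this 0, this 1, this 2]
  have b3 : ψ x * (advect w (cut R) x + lap (cut R) x - 2 * cutQuot R x) ≤
      B * (3 * (|Cv| * (C / R)) + C / R + 2 * (C / R)) := by
    have hu : advect w (cut R) x + lap (cut R) x - 2 * cutQuot R x ≤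
        3 * (|Cv| * (C / R)) + C / R + 2 * (C / R) := by
      have := (abs_le.1 h3).2
      have := (abs_le.1 h1).1
      linarith
    refine (mul_le_mul_of_nonneg_left hu (h.nonneg x)).trans ?_
    exact mul_le_mul_of_nonneg_right (h.le x) (by positivity)
  have b4 := mul_le_mul_of_nonneg_right hW (cut_nonneg (R := R) x)
  have eE : (B * (3 * (|Cv| * C) + C + 2 * C) + 6 * (B * C)) / R =
      B * (3 * (|Cv| * (C / R)) + C / R + 2 * (C / R)) + 2 * (3 * (B * (C / R))) := by ring
  rw [eE]
  linarith

/-! ### The excess over a level and its monotonicity. -/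

lemma max_sub_le_rpow {h q y : ℝ} (hh : 0 < h) (hq : 1 ≤ q) :
    max (y - h) 0 ≤ h ^ (1 - q) * |y| ^ q := by
  refine max_le ?_ (by positivity)
  rcases le_or_gt y h with hy | hy
  · exact (sub_nonpos.2 hy).trans (by positivity)
  · have hy0 : 0 < y := hh.trans hy
    rw [abs_of_pos hy0]
    calc y - h ≤ y := by linarith
      -- Chebyshev's argument: the exponent 1 - q is nonpositive, so y > h gives y^(1-q) ≤ h^(1-q).
      _ = y ^ (1 - q) * y ^ q := by rw [← Real.rpow_add hy0]; simp
      _ ≤ _ := by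
        gcongr ?_ * _
        exact Real.rpow_le_rpow_of_nonpos hh hy.le (by linarith)

/-- The integral of the excess of `Γ t` over the level `k`. -/
def excess (Γ : ℝ → Space3 → ℝ) (k t : ℝ) : ℝ := ∫ x, max (Γ t x - k) 0

lemma excess_nonneg (Γ : ℝ → Space3 → ℝ) (k t : ℝ) : 0 ≤ excess Γ k t :=
  integral_nonneg fun _ => le_max_right _ _

lemma integrable_max_sub {f : Space3 → ℝ} {q : ℝ≥0∞} (hf : MemLp f q volume) (hq : 1 ≤ q)
    (hq' : q ≠ ⊤) {k : ℝ} (hk : 0 < k) : Integrable fun x => max (f x - k) 0 := by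
  have h1 : 1 ≤ q.toReal := by
    simpa using ENNReal.toReal_mono hq' hq
  have h := (hf.integrable_norm_rpow (by positivity) hq').const_mul (k ^ (1 - q.toReal))
  refine h.mono' ((hf.1.sub aestronglyMeasurable_const).sup aestronglyMeasurable_const)
    (Eventually.of_forall fun x => ?_)
  rw [Real.norm_of_nonneg (le_max_right _ _)]
  exact max_sub_le_rpow hk h1

lemma integral_max_sub_le {f : Space3 → ℝ} {q : ℝ≥0∞} (hf : MemLp f q volume) (hq : 1 ≤ q)
    (hq' : q ≠ ⊤) {k : ℝ} (hk : 0 < k) :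
    ∫ x, max (f x - k) 0 ≤ k ^ (1 - q.toReal) * (eLpNorm f q volume).toReal ^ q.toReal := by
  have h1 : 1 ≤ q.toReal := by
    simpa using ENNReal.toReal_mono hq' hq
  have hi := hf.integrable_norm_rpow (by positivity) hq'
  have e : (eLpNorm f q volume).toReal ^ q.toReal = ∫ x, ‖f x‖ ^ q.toReal := by
    rw [hf.eLpNorm_eq_integral_rpow_norm (by positivity) hq', ENNReal.toReal_ofReal
      (by positivity), Real.rpow_inv_rpow (by positivity) (by positivity)]
  rw [e, ← integral_const_mul]
  refine integral_mono (integrable_max_sub hf hq hq' hk) (hi.const_mul _) fun x => ?_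
  exact max_sub_le_rpow hk h1

namespace IsSmoothGammaSolution

variable {T : ℝ} {q : ℝ≥0∞} {v : ℝ → Space3 → Space3} {Γ₀ : Space3 → ℝ} {Γ : ℝ → Space3 → ℝ}

/-- Continuity in L^q bounds the norm near each time, and compactness of [s, t] makes the bound
uniform. The initial time s = 0 is allowed. -/
lemma exists_eLpNorm_le (hΓ : IsSmoothGammaSolution T q v Γ₀ Γ) (hq : 1 ≤ q) {s t : ℝ}
    (hs : 0 ≤ s) (ht : t < T) :
    ∃ M : ℝ≥0∞, M ≠ ⊤ ∧ ∀ τ ∈ Icc s t, eLpNorm (Γ τ) q volume ≤ M := by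
  have hsub : Icc s t ⊆ Ico 0 T := fun τ hτ => ⟨hs.trans hτ.1, hτ.2.trans_lt ht⟩
  have key : ∃ M : ℝ≥0∞, M ≠ ⊤ ∧ ∀ τ ∈ Icc s t, τ ∈ Icc s t → eLpNorm (Γ τ) q volume ≤ M := by
    refine isCompact_Icc.induction_on
      (p := fun S => ∃ M : ℝ≥0∞, M ≠ ⊤ ∧ ∀ τ ∈ S, τ ∈ Icc s t → eLpNorm (Γ τ) q volume ≤ M)
      ⟨0, by simp, by simp⟩ ?_ ?_ ?_
    · rintro A B hAB ⟨M, hM, h⟩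
      exact ⟨M, hM, fun τ hτ => h τ (hAB hτ)⟩
    · rintro A B ⟨M, hM, h⟩ ⟨M', hM', h'⟩
      refine ⟨max M M', by simp [hM, hM'], fun τ hτ hτ' => ?_⟩
      rcases hτ with hτ | hτ
      · exact (h τ hτ hτ').trans (le_max_left _ _)
      · exact (h' τ hτ hτ').trans (le_max_right _ _)
    · intro τ hτ
      have h := (hΓ.continuous_Lq τ (hsub hτ)).eventually (gt_mem_nhds (zero_lt_one))
      have h' : {σ | eLpNorm (Γ σ - Γ τ) q volume < 1} ∈ 𝓝[Icc s t] τ :=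
        nhdsWithin_mono τ hsub h
      refine ⟨_, inter_mem h' self_mem_nhdsWithin, 1 + eLpNorm (Γ τ) q volume,
        by simp [(hΓ.memLp τ (hsub hτ)).2.ne], fun σ hσ hσ' => ?_⟩
      have e : Γ σ = (Γ σ - Γ τ) + Γ τ := by simp
      calc eLpNorm (Γ σ) q volume = eLpNorm ((Γ σ - Γ τ) + Γ τ) q volume := by rw [← e]
        _ ≤ eLpNorm (Γ σ - Γ τ) q volume + eLpNorm (Γ τ) q volume :=
            eLpNorm_add_le (((hΓ.memLp σ (hsub hσ')).1).sub (hΓ.memLp τ (hsub hτ)).1)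
              (hΓ.memLp τ (hsub hτ)).1 hq
        _ ≤ _ := by gcongr; exact (mem_ofPred.1 hσ.1).le
  obtain ⟨M, hM, h⟩ := key
  exact ⟨M, hM, fun τ hτ => h τ hτ hτ⟩

lemma integrable_excess (hΓ : IsSmoothGammaSolution T q v Γ₀ Γ) (hq : 1 ≤ q) (hq' : q ≠ ⊤)
    {k t : ℝ} (hk : 0 < k) (ht : t ∈ Ico 0 T) : Integrable fun x => max (Γ t x - k) 0 :=
  integrable_max_sub (hΓ.memLp t ht) hq hq' hk

lemma exists_excess_le (hΓ : IsSmoothGammaSolution T q v Γ₀ Γ) (hq : 1 ≤ q) (hq' : q ≠ ⊤)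
    {k s t : ℝ} (hk : 0 < k) (hs : 0 ≤ s) (ht : t < T) :
    ∃ M : ℝ, 0 ≤ M ∧ ∀ τ ∈ Icc s t, excess Γ k τ ≤ M := by
  obtain ⟨M, hM, h⟩ := hΓ.exists_eLpNorm_le hq hs ht
  refine ⟨k ^ (1 - q.toReal) * M.toReal ^ q.toReal, by positivity, fun τ hτ => ?_⟩
  refine (integral_max_sub_le (hΓ.memLp τ ⟨hs.trans hτ.1, hτ.2.trans_lt ht⟩) hq hq' hk).trans ?_
  gcongr
  exact h τ hτ

/-- The localized energy inequality with the weight `ψ` and the cutoff at scale `R`. -/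
lemma energy_le_cut (hv : IsSmoothVelocity T v) (hΓ : IsSmoothGammaSolution T q v Γ₀ Γ)
    {ψ κ W : Space3 → ℝ} {B : ℝ} (hψ : IsWeight ψ κ B) (hWc : Continuous W)
    {s t : ℝ} (hs : 0 < s) (hst : s ≤ t) (ht : t < T)
    (hW : ∀ τ ∈ Icc s t, ∀ x, advect (v τ) ψ x + lap ψ x - 2 * κ x ≤ W x) :
    ∃ E : ℝ, 0 ≤ E ∧ ∀ R : ℝ, 1 ≤ R → ∀ η : ℝ → ℝ, ContDiff ℝ 2 η → (∀ y, 0 ≤ η y) → ∀ M : ℝ,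
      (∀ τ ∈ Icc s t, Integrable (fun x => η (Γ τ x)) ∧ ∫ x, η (Γ τ x) ≤ M) →
      (∫ x, η (Γ t x) * (ψ x * cut R x)) +
        (∫ τ in s..t, ∫ x, deriv (deriv η) (Γ τ x) * gradSq (Γ τ) x * (ψ x * cut R x)) ≤
      (∫ x, η (Γ s x) * (ψ x * cut R x)) +
        (∫ τ in s..t, ∫ x, η (Γ τ x) * (W x * cut R x)) + E * M / R := by
  obtain ⟨Cv, hCv⟩ := hv.bounded s t hs ht
  obtain ⟨E, hE0, hE⟩ := hψ.flux_le Cv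
  have hst' : 0 ≤ t - s := by linarith
  -- The cutoff error is at most (E/R) ∫ η(Γ) ≤ E M/R at each time; integration in time brings the
  -- factor t - s.
  refine ⟨E * (t - s), by positivity, fun R hR η hη hη0 M hM => ?_⟩
  have hR0 : 0 < R := by linarith
  have hχ := hψ.isTestFn hR0
  have main := hΓ.energy_le hv hη hη0 hχ hs hst ht
  refine main.trans ?_
  rw [add_assoc]
  gcongr ?_ + ?_
  · exact le_rfl
  have hS := hΓ.slabSmooth
  have hsub : uIcc s t ⊆ Ioo 0 T := by
    rw [uIcc_of_le hst]; exact fun τ hτ => ⟨hs.trans_le hτ.1, hτ.2.trans_lt ht⟩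
  set K : Set Space3 := tsupport (fun x => ψ x * cut R x) ∪
    tsupport (fun x => ψ x * cutQuot R x + κ x * cut R x) with hKdef
  have hK : IsCompact K := IsCompact.union hχ.compact hχ.compact_quot
  have c4 := (hS.slabCont.comp hη.continuous).mul (hv.slabCont_flux hχ.contDiff hχ.cont_quot)
  have z4 : ∀ τ ∈ Ioo 0 T, ∀ x ∉ K, η (Γ τ x) * (advect (v τ) (fun x => ψ x * cut R x) x +
      lap (fun x => ψ x * cut R x) x - 2 * (ψ x * cutQuot R x + κ x * cut R x)) = 0 := by
    intro τ _ x hx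
    have h1 : x ∉ tsupport (fun x => ψ x * cut R x) := fun h => hx (Or.inl h)
    have h2 : ψ x * cutQuot R x + κ x * cut R x = 0 :=
      image_eq_zero_of_notMem_tsupport (f := fun x => ψ x * cutQuot R x + κ x * cut R x)
        fun h => hx (Or.inr h)
    rw [advect_eq_zero_of_notMem h1, lap_eq_zero_of_notMem h1, h2]; simp
  have hKc : IsCompact (tsupport (cut R)) := hasCompactSupport_cut hR0
  have z5 : ∀ τ ∈ Ioo 0 T, ∀ x ∉ tsupport (cut R), η (Γ τ x) * (W x * cut R x) = 0 :=
    fun τ _ x hx => by simp [image_eq_zero_of_notMem_tsupport hx]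
  have c5 : SlabCont T fun t x => η (Γ t x) * (W x * cut R x) :=
    (hS.slabCont.comp hη.continuous).mul (SlabCont.of_space
      (hWc.mul (contDiff_cut (n := 0)).continuous))
  have i4 : IntervalIntegrable _ volume s t :=
    ((c4.continuousOn_integral hK z4).mono hsub).intervalIntegrable
  have i5 : IntervalIntegrable _ volume s t :=
    ((c5.continuousOn_integral hKc z5).mono hsub).intervalIntegrable
  calc _ ≤ ∫ τ in s..t, ((∫ x, η (Γ τ x) * (W x * cut R x)) + E / R * M) := by
        refine intervalIntegral.integral_mono_on hst i4 (i5.add (by simp)) fun τ hτ => ?_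
        have hτ' : τ ∈ Ioo 0 T := ⟨hs.trans_le hτ.1, hτ.2.trans_lt ht⟩
        obtain ⟨hi, hle⟩ := hM τ hτ
        have j5 : Integrable fun x => η (Γ τ x) * (W x * cut R x) :=
          c5.integrable_slice hKc hτ' (z5 τ hτ')
        calc _ ≤ ∫ x, (η (Γ τ x) * (W x * cut R x) + E / R * η (Γ τ x)) := by
              refine integral_mono (c4.integrable_slice hK hτ' (z4 τ hτ'))
                (j5.add (hi.const_mul _)) fun x => ?_
              have hw : ∀ i, |v τ x i| ≤ Cv := fun i =>
                (PiLp.norm_apply_le (v τ x) i).trans (hCv τ hτ x)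
              have := mul_le_mul_of_nonneg_left (hE R hR (v τ) x (W x) hw (hW τ hτ x))
                (hη0 (Γ τ x))
              dsimp only
              linarith
          _ = (∫ x, η (Γ τ x) * (W x * cut R x)) + E / R * ∫ x, η (Γ τ x) := by
              rw [integral_add j5 (hi.const_mul _), integral_const_mul]
          _ ≤ _ := by gcongr
    _ = _ := by
        rw [intervalIntegral.integral_add i5 (by simp)]
        simp only [intervalIntegral.integral_const, smul_eq_mul]
        ring

end IsSmoothGammaSolution

lemma lap_const (c : ℝ) (x : Space3) : lap (fun _ => c) x = 0 := by
  have h : ∀ i, (partialD i fun _ : Space3 => c) = fun _ => 0 := fun i =>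
    funext fun y => partialD_const i c y
  simp [lap, h]

namespace IsSmoothGammaSolution

variable {T : ℝ} {q : ℝ≥0∞} {v : ℝ → Space3 → Space3} {Γ₀ : Space3 → ℝ} {Γ : ℝ → Space3 → ℝ}

/-- The excess of a solution over a level is a subsolution, tested with a bounded weight. -/
lemma weighted_excess_le (hv : IsSmoothVelocity T v) (hΓ : IsSmoothGammaSolution T q v Γ₀ Γ)
    {ψ κ W : Space3 → ℝ} {B Wb : ℝ} (hψ : IsWeight ψ κ B) (hWc : Continuous W)
    (hWb : ∀ x, |W x| ≤ Wb)
    {s t : ℝ} (hs : 0 < s) (hst : s ≤ t) (ht : t < T)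
    (hW : ∀ τ ∈ Icc s t, ∀ x, advect (v τ) ψ x + lap ψ x - 2 * κ x ≤ W x)
    {k M : ℝ} (hM : ∀ τ ∈ Icc s t, Integrable (fun x => max (Γ τ x - k) 0) ∧ excess Γ k τ ≤ M) :
    ∫ x, max (Γ t x - k) 0 * ψ x ≤ (∫ x, max (Γ s x - k) 0 * ψ x) +
      ∫ τ in s..t, ∫ x, max (Γ τ x - k) 0 * W x := by
  obtain ⟨E, hE0, hE⟩ := hΓ.energy_le_cut hv hψ hWc hs hst ht hW
  have hS := hΓ.slabSmooth
  have hsub : uIcc s t ⊆ Ioo 0 T := by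
    rw [uIcc_of_le hst]; exact fun τ hτ => ⟨hs.trans_le hτ.1, hτ.2.trans_lt ht⟩
  have hsub' : Icc s t ⊆ Ioo 0 T := by rwa [uIcc_of_le hst] at hsub
  let δ : ℕ → ℝ := fun n => 1 / ((n : ℝ) + 1)
  have hδ : ∀ n, 0 < δ n := fun n => by positivity
  -- C² convex profiles below (y - k)₊ and converging to it. The same index gives the width 1/(n +
  -- 1) and the cutoff radius n + 1, so one limit removes both approximations.
  let η : ℕ → ℝ → ℝ := fun n => shiftPrim (softStep (δ n)) k
  have hη2 : ∀ n, ContDiff ℝ 2 (η n) := fun n => contDiff_shiftPrim (contDiff_softStep (hδ n))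
  have hη0 : ∀ n y, 0 ≤ η n y := fun n y => shiftPrim_nonneg softStep_nonneg softStep_of_nonpos y
  have hηle : ∀ n y, η n y ≤ max (y - k) 0 := fun n y => by
    simpa using shiftPrim_le (k := k) (contDiff_softStep (hδ n)).continuous softStep_le_one
      softStep_of_nonpos y
  have hηnorm : ∀ n y, ‖η n y‖ ≤ max (y - k) 0 := fun n y => by
    rw [Real.norm_of_nonneg (hη0 n y)]; exact hηle n y
  have hηlim : ∀ y, Tendsto (fun n => η n y) atTop (𝓝 (max (y - k) 0)) := fun y =>
    tendsto_shiftPrim_softStep k y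
  have hcut : ∀ n, Continuous (cut ((n : ℕ) + 1 : ℝ)) := fun n => (contDiff_cut (n := 0)).continuous
  have hψc := hψ.contDiff.continuous
  have slice : ∀ τ ∈ Icc s t, Continuous (Γ τ) := fun τ hτ => hS.slabCont.slice (hsub' hτ)
  have hint : ∀ n, ∀ τ ∈ Icc s t, Integrable (fun x => η n (Γ τ x)) ∧ ∫ x, η n (Γ τ x) ≤ M := by
    intro n τ hτ
    have hi : Integrable (fun x => η n (Γ τ x)) :=
      (hM τ hτ).1.mono' ((hη2 n).continuous.comp (slice τ hτ)).aestronglyMeasurable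
        (Eventually.of_forall fun x => hηnorm n _)
    exact ⟨hi, (integral_mono hi (hM τ hτ).1 fun x => hηle n _).trans (hM τ hτ).2⟩
  have hineq : ∀ n : ℕ, (∫ x, η n (Γ t x) * (ψ x * cut ((n : ℝ) + 1) x)) ≤
      (∫ x, η n (Γ s x) * (ψ x * cut ((n : ℝ) + 1) x)) +
        (∫ τ in s..t, ∫ x, η n (Γ τ x) * (W x * cut ((n : ℝ) + 1) x)) +
          E * M / ((n : ℝ) + 1) := by
    intro n
    have h := hE ((n : ℝ) + 1) (by linarith [(Nat.cast_nonneg n : (0 : ℝ) ≤ n)]) (η n) (hη2 n)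
      (hη0 n) M (hint n)
    -- The dissipation is nonnegative because the derivative of the profile is a shifted increasing
    -- step.
    have hpos : 0 ≤ ∫ τ in s..t, ∫ x, deriv (deriv (η n)) (Γ τ x) * gradSq (Γ τ) x *
        (ψ x * cut ((n : ℝ) + 1) x) := by
      refine intervalIntegral.integral_nonneg hst fun τ _ => integral_nonneg fun x => ?_
      have h1 : 0 ≤ deriv (deriv (η n)) (Γ τ x) := by
        refine Monotone.deriv_nonneg ?_
        rw [deriv_shiftPrim (contDiff_softStep (hδ n)).continuous]
        exact fun a b hab => monotone_softStep (hδ n) (by linarith)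
      have h2 := gradSq_nonneg (Γ τ) x
      have h3 := hψ.nonneg x
      have h4 := cut_nonneg (R := (n : ℝ) + 1) x
      simp only [Pi.zero_apply]
      positivity
    linarith
  have lim : ∀ (G : Space3 → ℝ) (Cb : ℝ), Continuous G → (∀ x, |G x| ≤ Cb) → ∀ τ ∈ Icc s t,
      Tendsto (fun n : ℕ => ∫ x, η n (Γ τ x) * (G x * cut ((n : ℝ) + 1) x)) atTop
        (𝓝 (∫ x, max (Γ τ x - k) 0 * G x)) := by
    intro G Cb hG hGb τ hτ
    refine tendsto_integral_of_dominated_convergence (fun x => max (Γ τ x - k) 0 * Cb)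
      (fun n => ?_) ((hM τ hτ).1.mul_const _) (fun n => Eventually.of_forall fun x => ?_)
      (Eventually.of_forall fun x => ?_)
    · exact (((hη2 n).continuous.comp (slice τ hτ)).mul (hG.mul (hcut n))).aestronglyMeasurable
    · rw [norm_mul]
      refine mul_le_mul (hηnorm n _) ?_ (norm_nonneg _) (le_max_right _ _)
      rw [norm_mul, Real.norm_of_nonneg (cut_nonneg x)]
      exact (mul_le_of_le_one_right (norm_nonneg _) (cut_le_one x)).trans (hGb x)
    · have := (hηlim (Γ τ x)).mul ((tendsto_cut x).const_mul (G x))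
      simpa using this
  have bnd : ∀ n : ℕ, ∀ τ ∈ Icc s t,
      ‖∫ x, η n (Γ τ x) * (W x * cut ((n : ℝ) + 1) x)‖ ≤ M * Wb := by
    intro n τ hτ
    have hWb0 : 0 ≤ Wb := (abs_nonneg _).trans (hWb 0)
    calc _ ≤ ∫ x, max (Γ τ x - k) 0 * Wb := by
          refine norm_integral_le_of_norm_le ((hM τ hτ).1.mul_const _)
            (Eventually.of_forall fun x => ?_)
          rw [norm_mul]
          refine mul_le_mul (hηnorm n _) ?_ (norm_nonneg _) (le_max_right _ _)
          rw [norm_mul, Real.norm_of_nonneg (cut_nonneg x)]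
          exact (mul_le_of_le_one_right (norm_nonneg _) (cut_le_one x)).trans (hWb x)
      _ = excess Γ k τ * Wb := integral_mul_const _ _
      _ ≤ _ := by gcongr; exact (hM τ hτ).2
  have limT : Tendsto (fun n : ℕ => ∫ τ in s..t, ∫ x, η n (Γ τ x) * (W x * cut ((n : ℝ) + 1) x))
      atTop (𝓝 (∫ τ in s..t, ∫ x, max (Γ τ x - k) 0 * W x)) := by
    refine intervalIntegral.tendsto_integral_filter_of_dominated_convergence (fun _ => M * Wb)
      (Eventually.of_forall fun n => ?_)
      (Eventually.of_forall fun n => Eventually.of_forall fun τ hτ => ?_) (by simp)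
      (Eventually.of_forall fun τ hτ => ?_)
    · have hR0 : (0 : ℝ) < (n : ℝ) + 1 := by positivity
      have c : SlabCont T fun τ x => η n (Γ τ x) * (W x * cut ((n : ℝ) + 1) x) :=
        (hS.slabCont.comp (hη2 n).continuous).mul (SlabCont.of_space (hWc.mul (hcut n)))
      have := ((c.continuousOn_integral (hasCompactSupport_cut hR0) fun τ _ x hx => by
        simp [image_eq_zero_of_notMem_tsupport hx]).mono hsub).mono uIoc_subset_uIcc
      exact this.aestronglyMeasurable measurableSet_uIoc
    · rw [uIoc_of_le hst] at hτ
      exact bnd n τ ⟨hτ.1.le, hτ.2⟩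
    · rw [uIoc_of_le hst] at hτ
      exact lim W Wb hWc hWb τ ⟨hτ.1.le, hτ.2⟩
  have hψb : ∀ x, |ψ x| ≤ B := fun x => by rw [abs_of_nonneg (hψ.nonneg x)]; exact hψ.le x
  have limE : Tendsto (fun n : ℕ => E * M / ((n : ℝ) + 1)) atTop (𝓝 0) := by
    have := (tendsto_one_div_add_atTop_nhds_zero_nat (𝕜 := ℝ)).const_mul (E * M)
    simpa [div_eq_mul_inv] using this
  have := le_of_tendsto_of_tendsto' (lim ψ B hψc hψb t ⟨hst, le_rfl⟩)
    (((lim ψ B hψc hψb s ⟨le_rfl, hst⟩).add limT).add limE) hineq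
  simpa using this

/-- The weight is the constant 1, whose flux is zero. The level is unrestricted because
integrability is assumed; this permits k = 0 for the L¹ norm. -/
lemma excess_le_of_integrable (hv : IsSmoothVelocity T v)
    (hΓ : IsSmoothGammaSolution T q v Γ₀ Γ) {k M s t : ℝ} (hs : 0 < s) (hst : s ≤ t) (ht : t < T)
    (hM : ∀ τ ∈ Icc s t, Integrable (fun x => max (Γ τ x - k) 0) ∧ excess Γ k τ ≤ M) :
    excess Γ k t ≤ excess Γ k s := by
  have := hΓ.weighted_excess_le hv isWeight_one (W := fun _ => 0) (Wb := 0) continuous_const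
    (by simp) hs hst ht (fun τ _ x => by simp [advect, lap_const]) hM
  simpa [excess] using this

lemma excess_le_of_pos (hv : IsSmoothVelocity T v) (hΓ : IsSmoothGammaSolution T q v Γ₀ Γ)
    (hq : 1 ≤ q) (hq' : q ≠ ⊤) {k s t : ℝ} (hk : 0 < k) (hs : 0 < s) (hst : s ≤ t) (ht : t < T) :
    excess Γ k t ≤ excess Γ k s := by
  obtain ⟨M, _, hM⟩ := hΓ.exists_excess_le hq hq' hk hs.le ht
  exact hΓ.excess_le_of_integrable hv hs hst ht fun τ hτ =>
    ⟨hΓ.integrable_excess hq hq' hk ⟨hs.le.trans hτ.1, hτ.2.trans_lt ht⟩, hM τ hτ⟩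

/-- The excess over a positive level is nonincreasing in time. -/
lemma excess_antitone (hv : IsSmoothVelocity T v) (hΓ : IsSmoothGammaSolution T q v Γ₀ Γ)
    (hq : 1 ≤ q) (hq' : q ≠ ⊤) {k s t : ℝ} (hk : 0 < k) (hs : 0 ≤ s) (hst : s ≤ t) (ht : t < T) :
    excess Γ k t ≤ excess Γ k s := by
  rcases hs.eq_or_lt with rfl | hs
  swap
  · exact hΓ.excess_le_of_pos hv hq hq' hk hs hst ht
  rcases hst.eq_or_lt with rfl | h0t
  · exact le_rfl
  have hT : 0 < T := h0t.trans ht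
  have h0 : (0 : ℝ) ∈ Ico 0 T := ⟨le_rfl, hT⟩
  have hr1 : 1 ≤ q.toReal := by simpa using ENNReal.toReal_mono hq' hq
  -- Passage to the initial time at the cost of lowering the level: with h = k - k', (Γ(s) - k)₊ ≤
  -- (Γ(0) - k')₊ + (Γ(s) - Γ(0) - h)₊, and by Chebyshev the last integral is at most h^(1-q) ‖Γ(s)
  -- - Γ(0)‖_q^q, which tends to 0 as s tends to 0.
  have step : ∀ k', 0 < k' → k' < k → excess Γ k t ≤ excess Γ k' 0 := by
    intro k' hk' hkk
    set h : ℝ := k - k' with hh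
    have hpos : 0 < h := by simp [hh, hkk]
    have hs : ∀ s ∈ Ioo 0 t, excess Γ k t ≤ excess Γ k' 0 +
        h ^ (1 - q.toReal) * (eLpNorm (Γ s - Γ 0) q volume).toReal ^ q.toReal := by
      intro s hs
      have hsT : s ∈ Ico 0 T := ⟨hs.1.le, hs.2.trans ht⟩
      have hd : MemLp (Γ s - Γ 0) q volume := (hΓ.memLp s hsT).sub (hΓ.memLp 0 h0)
      calc excess Γ k t ≤ excess Γ k s := hΓ.excess_le_of_pos hv hq hq' hk hs.1 hs.2.le ht
        _ ≤ ∫ x, (max (Γ 0 x - k') 0 + max ((Γ s - Γ 0) x - h) 0) := by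
            refine integral_mono (hΓ.integrable_excess hq hq' hk hsT)
              ((hΓ.integrable_excess hq hq' hk' h0).add (integrable_max_sub hd hq hq' hpos))
              fun x => ?_
            refine max_le ?_ (add_nonneg (le_max_right _ _) (le_max_right _ _))
            have h1 := le_max_left (Γ 0 x - k') 0
            have h2 := le_max_left ((Γ s - Γ 0) x - h) 0
            simp only [Pi.sub_apply] at h2 ⊢
            linarith
        _ = excess Γ k' 0 + ∫ x, max ((Γ s - Γ 0) x - h) 0 :=
            integral_add (hΓ.integrable_excess hq hq' hk' h0) (integrable_max_sub hd hq hq' hpos)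
        _ ≤ _ := by gcongr; exact integral_max_sub_le hd hq hq' hpos
    have hne : (𝓝[Ioo 0 t] (0 : ℝ)).NeBot := by
      rw [nhdsWithin_Ioo_eq_nhdsGT h0t]; infer_instance
    have hl := (hΓ.continuous_Lq 0 h0).mono_left
      (nhdsWithin_mono (0 : ℝ) (show Ioo 0 t ⊆ Ico 0 T from
        fun s hs => ⟨hs.1.le, hs.2.trans ht⟩))
    have hl2 : Tendsto (fun s => excess Γ k' 0 + h ^ (1 - q.toReal) *
        (eLpNorm (Γ s - Γ 0) q volume).toReal ^ q.toReal) (𝓝[Ioo 0 t] 0)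
        (𝓝 (excess Γ k' 0 + h ^ (1 - q.toReal) * (0 : ℝ) ^ q.toReal)) := by
      refine tendsto_const_nhds.add (Tendsto.const_mul _ ?_)
      have h1 := (ENNReal.tendsto_toReal (a := 0) (by simp)).comp hl
      exact (h1.rpow_const (Or.inr (by linarith)))
    rw [Real.zero_rpow (by linarith), mul_zero, add_zero] at hl2
    exact ge_of_tendsto hl2 (by
      filter_upwards [self_mem_nhdsWithin] with s hs' using hs s hs')
  -- The loss of level is then recovered by letting k' increase to k through levels in [k/2, k).
  have hlim : Tendsto (fun n : ℕ => excess Γ (k - k / 2 * (1 / ((n : ℝ) + 1))) 0) atTop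
      (𝓝 (excess Γ k 0)) := by
    have hle : ∀ n : ℕ, 1 / ((n : ℝ) + 1) ≤ 1 := fun n => by
      rw [div_le_one (by positivity)]; linarith [(Nat.cast_nonneg n : (0 : ℝ) ≤ n)]
    refine tendsto_integral_of_dominated_convergence (fun x => max (Γ 0 x - k / 2) 0)
      (fun n => ?_) (hΓ.integrable_excess hq hq' (by positivity) h0)
      (fun n => Eventually.of_forall fun x => ?_) (Eventually.of_forall fun x => ?_)
    · exact ((hΓ.memLp 0 h0).1.sub aestronglyMeasurable_const).sup aestronglyMeasurable_const
    · rw [Real.norm_of_nonneg (le_max_right _ _)]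
      refine max_le_max_right 0 ?_
      have := hle n
      nlinarith
    · have h1 : Tendsto (fun n : ℕ => k - k / 2 * (1 / ((n : ℝ) + 1))) atTop
          (𝓝 (k - k / 2 * 0)) :=
        tendsto_const_nhds.sub (tendsto_one_div_add_atTop_nhds_zero_nat.const_mul _)
      rw [mul_zero, sub_zero] at h1
      exact (tendsto_const_nhds.sub h1).max tendsto_const_nhds
  refine ge_of_tendsto' hlim fun n => step _ ?_ ?_
  · have : 1 / ((n : ℝ) + 1) ≤ 1 := by
      rw [div_le_one (by positivity)]; linarith [(Nat.cast_nonneg n : (0 : ℝ) ≤ n)]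
    nlinarith
  · have : 0 < k / 2 * (1 / ((n : ℝ) + 1)) := by positivity
    linarith

end IsSmoothGammaSolution

/-! ### The weight 1 - exp(-l r) and its flux. -/

lemma partialD_comp_axisSq {f : ℝ → ℝ} {f' : ℝ} {x : Space3} (hf : HasDerivAt f f' (axisSq x))
    (i : Fin 3) : partialD i (fun y => f (axisSq y)) x = if i = 2 then 0 else f' * (2 * x i) := by
  rw [partialD_comp i hf (differentiable_axisSq x), partialD_axisSq]
  split_ifs <;> simp

lemma lap_comp_axisSq {f f' f'' : ℝ → ℝ} (hf : ∀ y, 0 ≤ y → HasDerivAt f (f' y) y)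
    (hf' : ∀ y, 0 ≤ y → HasDerivAt f' (f'' y) y) (x : Space3) :
    lap (fun y => f (axisSq y)) x = 4 * axisSq x * f'' (axisSq x) + 4 * f' (axisSq x) := by
  have e : ∀ i, (partialD i fun y => f (axisSq y)) =
      fun y => if i = 2 then 0 else f' (axisSq y) * (2 * y i) := fun i =>
    funext fun y => partialD_comp_axisSq (hf _ (axisSq_nonneg y)) i
  have h : ∀ i : Fin 3, i ≠ 2 → partialD i (partialD i fun y => f (axisSq y)) x =
      f' (axisSq x) * 2 + f'' (axisSq x) * (2 * x i) * (2 * x i) := by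
    intro i hi
    have d1 : DifferentiableAt ℝ (fun y => f' (axisSq y)) x :=
      (hf' _ (axisSq_nonneg x)).differentiableAt.comp x (differentiable_axisSq x)
    have d2 : DifferentiableAt ℝ (fun y : Space3 => y i) x := by fun_prop
    rw [e]
    simp only [hi, if_false]
    rw [partialD_mul i d1 (d2.const_mul 2), partialD_comp_axisSq (hf' _ (axisSq_nonneg x)),
      partialD_mul i (by fun_prop) d2, partialD_coord]
    simp [hi]
  have h2 : partialD 2 (partialD 2 fun y => f (axisSq y)) x = 0 := by
    rw [e]; simp
  have ha : axisSq x = x 0 ^ 2 + x 1 ^ 2 := rfl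
  simp only [lap, Fin.sum_univ_three, h 0 (by decide), h 1 (by decide), h2]
  linear_combination (-(4 * f'' (axisSq x))) * ha

/-- The regularized exponential `exp (-l √(a + δ))`, a function of the squared distance `a` to the
axis. -/
def expProfile (l δ a : ℝ) : ℝ := Real.exp (-(l * √(a + δ)))

section ExpProfile

variable {l δ : ℝ}

lemma expProfile_pos (a : ℝ) : 0 < expProfile l δ a := Real.exp_pos _

lemma expProfile_le_one (hl : 0 ≤ l) (a : ℝ) : expProfile l δ a ≤ 1 :=
  Real.exp_le_one_iff.2 (by have := Real.sqrt_nonneg (a + δ); nlinarith)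

lemma hasDerivAt_expProfile (hδ : 0 < δ) {a : ℝ} (ha : 0 ≤ a) :
    HasDerivAt (expProfile l δ) (-(l / (2 * √(a + δ))) * expProfile l δ a) a := by
  have h1 : HasDerivAt (fun a => √(a + δ)) (1 / (2 * √(a + δ))) a :=
    ((hasDerivAt_id a).add_const δ).sqrt (by simp; positivity)
  have h2 := ((h1.const_mul l).fun_neg).exp
  refine h2.congr_deriv ?_
  simp only [expProfile]; ring

lemma hasDerivAt_deriv_expProfile (hδ : 0 < δ) {a : ℝ} (ha : 0 ≤ a) :
    HasDerivAt (fun a => -(l / (2 * √(a + δ))) * expProfile l δ a)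
      ((l ^ 2 / (4 * (a + δ)) + l / (4 * (a + δ) * √(a + δ))) * expProfile l δ a) a := by
  have hpos : 0 < a + δ := by positivity
  have hs : 0 < √(a + δ) := Real.sqrt_pos.2 hpos
  have h1 : HasDerivAt (fun a => √(a + δ)) (1 / (2 * √(a + δ))) a :=
    ((hasDerivAt_id a).add_const δ).sqrt (by simp; positivity)
  have h2 := (((hasDerivAt_const a l).fun_div (h1.const_mul 2) (by positivity)).fun_neg).fun_mul
    (hasDerivAt_expProfile (l := l) hδ ha)
  refine h2.congr_deriv ?_
  have e : a + δ = √(a + δ) ^ 2 := (Real.sq_sqrt hpos.le).symm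
  generalize √(a + δ) = S at *
  rw [e]
  field_simp
  ring

/-- In the limit δ → 0 this weight vanishes on the axis, so the axis term discarded in the energy
inequality then carries no mass. Regularizing r by √(r² + δ) keeps the weight twice differentiable.
-/
lemma isWeight_one_sub_expProfile (hl : 0 ≤ l) (hδ : 0 < δ) :
    IsWeight (fun x => 1 - expProfile l δ (axisSq x))
      (fun x => 2 * (l / (2 * √(axisSq x + δ)) * expProfile l δ (axisSq x))) (1 + l) where
  contDiff := by
    refine contDiff_const.sub (Real.contDiff_exp.comp (contDiff_const.mul ?_).neg)
    exact (contDiff_axisSq.add contDiff_const).sqrt fun x =>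
      (add_pos_of_nonneg_of_pos (axisSq_nonneg x) hδ).ne'
  nonneg x := by linarith [expProfile_le_one (δ := δ) hl (axisSq x)]
  le x := by linarith [expProfile_pos (l := l) (δ := δ) (axisSq x)]
  partialD_le i x := by
    have ha := axisSq_nonneg x
    have hd := hasDerivAt_expProfile (l := l) hδ ha
    have hs : 0 < √(axisSq x + δ) := Real.sqrt_pos.2 (by positivity)
    have hd2 := partialD_comp_axisSq ((hasDerivAt_const _ (1 : ℝ)).fun_sub hd) i
    rw [hd2]
    split_ifs with hi
    · simp; positivity
    · have hx : |x i| ≤ √(axisSq x + δ) := by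
        rw [← Real.sqrt_sq_eq_abs]
        apply Real.sqrt_le_sqrt
        unfold axisSq
        fin_cases i
        · simp; nlinarith [sq_nonneg (x 1)]
        · simp; nlinarith [sq_nonneg (x 0)]
        · simp at hi
      have e : (0 - -(l / (2 * √(axisSq x + δ))) * expProfile l δ (axisSq x)) * (2 * x i) =
          l * (x i / √(axisSq x + δ)) * expProfile l δ (axisSq x) := by field_simp; ring
      rw [e, abs_mul, abs_mul, abs_div, abs_of_nonneg hl, abs_of_pos hs,
        abs_of_pos (expProfile_pos _)]
      have h1 : |x i| / √(axisSq x + δ) ≤ 1 := (div_le_one hs).2 hx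
      have h2 := expProfile_le_one (δ := δ) hl (axisSq x)
      have h3 := expProfile_pos (l := l) (δ := δ) (axisSq x)
      have h4 : 0 ≤ |x i| / √(axisSq x + δ) := by positivity
      calc l * (|x i| / √(axisSq x + δ)) * expProfile l δ (axisSq x) ≤ l * 1 * 1 := by gcongr
        _ ≤ 1 + l := by linarith
  cont_quot := by
    have := continuous_axisSq
    have h : ∀ x, 2 * √(axisSq x + δ) ≠ 0 := fun x => by
      have := axisSq_nonneg x
      have : 0 < √(axisSq x + δ) := Real.sqrt_pos.2 (by positivity)
      positivity
    unfold expProfile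
    exact continuous_const.mul ((continuous_const.div (by fun_prop) h).mul (by fun_prop))
  radial x := by
    have hd := hasDerivAt_expProfile (l := l) hδ (axisSq_nonneg x)
    have hd2 := partialD_comp_axisSq ((hasDerivAt_const _ (1 : ℝ)).fun_sub hd)
    rw [hd2, hd2, if_neg (by decide), if_neg (by decide)]
    have ha : axisSq x = x 0 ^ 2 + x 1 ^ 2 := rfl
    rw [show axisSq x * (2 * (l / (2 * √(axisSq x + δ)) * expProfile l δ (axisSq x))) =
      (x 0 ^ 2 + x 1 ^ 2) * (2 * (l / (2 * √(axisSq x + δ)) * expProfile l δ (axisSq x))) by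
        rw [← ha]]
    ring

/-- With a = r² and f the profile of the weight, the part 4f' of the Laplacian cancels exactly
against twice the radial quotient. Of the remaining 4 a f'', one piece is the gain -l² a/(a + δ)
times the exponential and the other is nonpositive; the drift costs at most Cv l for each of the two
horizontal components. -/
lemma flux_one_sub_expProfile_le (hl : 0 ≤ l) (hδ : 0 < δ) {Cv : ℝ} {w : Space3 → Space3}
    {x : Space3} (hw : ∀ i, |w x i| ≤ Cv) :
    advect w (fun x => 1 - expProfile l δ (axisSq x)) x +
        lap (fun x => 1 - expProfile l δ (axisSq x)) x -
        2 * (2 * (l / (2 * √(axisSq x + δ)) * expProfile l δ (axisSq x))) ≤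
      expProfile l δ (axisSq x) * (2 * Cv * l - l ^ 2 * (axisSq x / (axisSq x + δ))) := by
  have hCv : 0 ≤ Cv := (abs_nonneg _).trans (hw 0)
  have ha := axisSq_nonneg x
  have hs : 0 < √(axisSq x + δ) := Real.sqrt_pos.2 (by positivity)
  have hd : ∀ a, 0 ≤ a → HasDerivAt (fun a => 1 - expProfile l δ a)
      (l / (2 * √(a + δ)) * expProfile l δ a) a := fun a ha =>
    ((hasDerivAt_const _ (1 : ℝ)).fun_sub (hasDerivAt_expProfile (l := l) hδ ha)).congr_deriv
      (by ring)
  have hdd : ∀ a, 0 ≤ a → HasDerivAt (fun a => l / (2 * √(a + δ)) * expProfile l δ a)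
      (-((l ^ 2 / (4 * (a + δ)) + l / (4 * (a + δ) * √(a + δ))) * expProfile l δ a)) a :=
    fun a ha => by
      have := (hasDerivAt_deriv_expProfile (l := l) hδ ha).fun_neg
      simpa using this
  have hx : ∀ i : Fin 3, i ≠ 2 → |x i| ≤ √(axisSq x + δ) := fun i hi => by
    rw [← Real.sqrt_sq_eq_abs]
    apply Real.sqrt_le_sqrt
    unfold axisSq
    fin_cases i
    · simp; nlinarith [sq_nonneg (x 1)]
    · simp; nlinarith [sq_nonneg (x 0)]
    · simp at hi
  have e1 : advect w (fun x => 1 - expProfile l δ (axisSq x)) x =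
      (w x 0 * (x 0 / √(axisSq x + δ)) + w x 1 * (x 1 / √(axisSq x + δ))) * l *
        expProfile l δ (axisSq x) := by
    simp only [advect, Fin.sum_univ_three, partialD_comp_axisSq (hd _ ha)]
    rw [if_neg (by decide), if_neg (by decide), if_pos trivial]
    field_simp
    ring
  have b1 : ∀ i : Fin 3, i ≠ 2 → w x i * (x i / √(axisSq x + δ)) ≤ Cv := fun i hi => by
    refine (le_abs_self _).trans ?_
    rw [abs_mul, abs_div, abs_of_pos hs]
    have : |x i| / √(axisSq x + δ) ≤ 1 := (div_le_one hs).2 (hx i hi)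
    calc |w x i| * (|x i| / √(axisSq x + δ)) ≤ Cv * 1 := by
          gcongr
          exact hw i
      _ = Cv := mul_one _
  have hP := expProfile_pos (l := l) (δ := δ) (axisSq x)
  have b2 := mul_le_mul_of_nonneg_right (mul_le_mul_of_nonneg_right
    (add_le_add (b1 0 (by decide)) (b1 1 (by decide))) hl) hP.le
  rw [e1, lap_comp_axisSq hd hdd]
  have e2 : 4 * axisSq x * -((l ^ 2 / (4 * (axisSq x + δ)) +
      l / (4 * (axisSq x + δ) * √(axisSq x + δ))) * expProfile l δ (axisSq x)) =
      -(expProfile l δ (axisSq x) * (l ^ 2 * (axisSq x / (axisSq x + δ)))) -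
        axisSq x * (l / ((axisSq x + δ) * √(axisSq x + δ))) * expProfile l δ (axisSq x) := by
    have : axisSq x + δ ≠ 0 := by positivity
    field_simp
    ring
  rw [e2]
  have b3 : 0 ≤ axisSq x * (l / ((axisSq x + δ) * √(axisSq x + δ))) *
      expProfile l δ (axisSq x) := by positivity
  linarith

end ExpProfile

namespace IsSmoothGammaSolution

variable {T : ℝ} {q : ℝ≥0∞} {v : ℝ → Space3 → Space3} {Γ₀ : Space3 → ℝ} {Γ : ℝ → Space3 → ℝ}

/-- If the excess is conserved, then its moment with the weight `exp (-l r)` grows. -/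
lemma exp_moment_growth (hv : IsSmoothVelocity T v) (hΓ : IsSmoothGammaSolution T q v Γ₀ Γ)
    {k M s t Cv l : ℝ} (hs : 0 < s) (hst : s ≤ t) (ht : t < T) (hl : 0 ≤ l)
    (hCv : ∀ τ ∈ Icc s t, ∀ x, ‖v τ x‖ ≤ Cv)
    (hM : ∀ τ ∈ Icc s t, Integrable (fun x => max (Γ τ x - k) 0) ∧ excess Γ k τ ≤ M)
    (heq : excess Γ k t = excess Γ k s) :
    (∫ x, max (Γ s x - k) 0 * Real.exp (-(l * cylRadius x))) +
      (l ^ 2 - 2 * Cv * l) *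
        (∫ τ in s..t, ∫ x, max (Γ τ x - k) 0 * Real.exp (-(l * cylRadius x))) ≤
      ∫ x, max (Γ t x - k) 0 * Real.exp (-(l * cylRadius x)) := by
  have hS := hΓ.slabSmooth
  have hCv0 : 0 ≤ Cv := (norm_nonneg _).trans (hCv s ⟨le_rfl, hst⟩ 0)
  have hsub : uIcc s t ⊆ Ioo 0 T := by
    rw [uIcc_of_le hst]; exact fun τ hτ => ⟨hs.trans_le hτ.1, hτ.2.trans_lt ht⟩
  have hsub' : Icc s t ⊆ Ioo 0 T := by rwa [uIcc_of_le hst] at hsub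
  let δ : ℕ → ℝ := fun n => 1 / ((n : ℝ) + 1)
  have hδ : ∀ n, 0 < δ n := fun n => by positivity
  have hδlim : Tendsto δ atTop (𝓝 0) := tendsto_one_div_add_atTop_nhds_zero_nat
  let P : ℕ → Space3 → ℝ := fun n x => expProfile l (δ n) (axisSq x)
  let W : ℕ → Space3 → ℝ := fun n x =>
    P n x * (2 * Cv * l - l ^ 2 * (axisSq x / (axisSq x + δ n)))
  let Cb : ℝ := 2 * Cv * l + l ^ 2
  have hCb : 0 ≤ Cb := by positivity
  have hac := continuous_axisSq
  have hPc : ∀ n, Continuous (P n) := fun n => by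
    simp only [P]; unfold expProfile; fun_prop
  have hP0 : ∀ n x, 0 ≤ P n x := fun n x => (expProfile_pos _).le
  have hP1 : ∀ n x, P n x ≤ 1 := fun n x => expProfile_le_one hl _
  have hWc : ∀ n, Continuous (W n) := fun n => by
    refine (hPc n).mul (continuous_const.sub (continuous_const.mul (hac.div (by fun_prop) ?_)))
    intro x
    exact (add_pos_of_nonneg_of_pos (axisSq_nonneg x) (hδ n)).ne'
  have hWb : ∀ n x, |W n x| ≤ Cb := fun n x => by
    have h1 : axisSq x / (axisSq x + δ n) ≤ 1 :=
      (div_le_one (add_pos_of_nonneg_of_pos (axisSq_nonneg x) (hδ n))).2 (by linarith [hδ n])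
    have h0 : 0 ≤ axisSq x / (axisSq x + δ n) :=
      div_nonneg (axisSq_nonneg x) (add_pos_of_nonneg_of_pos (axisSq_nonneg x) (hδ n)).le
    simp only [W, Cb]
    rw [abs_mul, abs_of_nonneg (hP0 n x)]
    refine (mul_le_of_le_one_left (abs_nonneg _) (hP1 n x)).trans (abs_le.2 ⟨?_, ?_⟩)
    · have : l ^ 2 * (axisSq x / (axisSq x + δ n)) ≤ l ^ 2 * 1 := by gcongr
      have h3 : 0 ≤ 2 * Cv * l := by positivity
      linarith
    · have : 0 ≤ l ^ 2 * (axisSq x / (axisSq x + δ n)) := by positivity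
      nlinarith [sq_nonneg l]
  have hPlim : ∀ x, Tendsto (fun n => P n x) atTop (𝓝 (Real.exp (-(l * cylRadius x)))) := by
    intro x
    have h1 : Tendsto (fun n => axisSq x + δ n) atTop (𝓝 (axisSq x + 0)) :=
      tendsto_const_nhds.add hδlim
    rw [add_zero] at h1
    exact (Real.continuous_exp.tendsto _).comp
      ((((Real.continuous_sqrt.tendsto _).comp h1).const_mul l).neg)
  have hWlim : ∀ x, 0 < axisSq x → Tendsto (fun n => W n x) atTop
      (𝓝 (Real.exp (-(l * cylRadius x)) * (2 * Cv * l - l ^ 2))) := by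
    intro x hx
    have h1 : Tendsto (fun n => axisSq x + δ n) atTop (𝓝 (axisSq x + 0)) :=
      tendsto_const_nhds.add hδlim
    rw [add_zero] at h1
    have h2 := (tendsto_const_nhds (x := axisSq x)).div h1 hx.ne'
    rw [div_self hx.ne'] at h2
    have h3 := (hPlim x).mul ((tendsto_const_nhds (x := 2 * Cv * l)).sub (h2.const_mul (l ^ 2)))
    rw [mul_one] at h3
    exact h3
  have slice : ∀ τ ∈ Icc s t, Continuous (Γ τ) := fun τ hτ => hS.slabCont.slice (hsub' hτ)
  have lim : ∀ (G : ℕ → Space3 → ℝ) (G' : Space3 → ℝ) (C : ℝ), (∀ n, Continuous (G n)) →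
      (∀ n x, |G n x| ≤ C) →
      (∀ x, 0 < axisSq x → Tendsto (fun n => G n x) atTop (𝓝 (G' x))) → ∀ τ ∈ Icc s t,
      Tendsto (fun n : ℕ => ∫ x, max (Γ τ x - k) 0 * G n x) atTop
        (𝓝 (∫ x, max (Γ τ x - k) 0 * G' x)) := by
    intro G G' C hG hGb hGl τ hτ
    refine tendsto_integral_of_dominated_convergence (fun x => max (Γ τ x - k) 0 * C)
      (fun n => ?_) ((hM τ hτ).1.mul_const _) (fun n => Eventually.of_forall fun x => ?_) ?_
    · have := slice τ hτ
      have := hG n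
      exact (by fun_prop : Continuous fun x => max (Γ τ x - k) 0 * G n x).aestronglyMeasurable
    · rw [norm_mul, Real.norm_of_nonneg (le_max_right _ _)]
      exact mul_le_mul_of_nonneg_left (hGb n x) (le_max_right _ _)
    · filter_upwards [ae_axisSq_pos] with x hx using (hGl x hx).const_mul _
  -- Conservation of the excess cancels the contributions of the constant 1, turning the upper bound
  -- for the weight 1 - P into a lower bound for the growth of the moment of P.
  have key : ∀ n, (∫ x, max (Γ s x - k) 0 * P n x) ≤
      (∫ x, max (Γ t x - k) 0 * P n x) + ∫ τ in s..t, ∫ x, max (Γ τ x - k) 0 * W n x := by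
    intro n
    have h := hΓ.weighted_excess_le hv (isWeight_one_sub_expProfile hl (hδ n)) (hWc n) (hWb n)
      hs hst ht (fun τ hτ x => flux_one_sub_expProfile_le hl (hδ n) fun i =>
        (PiLp.norm_apply_le (v τ x) i).trans (hCv τ hτ x)) hM
    have split : ∀ τ ∈ Icc s t, ∫ x, max (Γ τ x - k) 0 * (1 - expProfile l (δ n) (axisSq x)) =
        excess Γ k τ - ∫ x, max (Γ τ x - k) 0 * P n x := by
      intro τ hτ
      have hi : Integrable fun x => max (Γ τ x - k) 0 * P n x := by
        refine (hM τ hτ).1.mono ?_ (Eventually.of_forall fun x => ?_)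
        · have := slice τ hτ
          have := hPc n
          exact (by fun_prop : Continuous fun x => max (Γ τ x - k) 0 * P n x).aestronglyMeasurable
        · rw [norm_mul, Real.norm_of_nonneg (hP0 n x)]
          exact mul_le_of_le_one_right (norm_nonneg _) (hP1 n x)
      rw [excess, ← integral_sub (hM τ hτ).1 hi]
      congr 1
      funext x
      simp only [P]; ring
    rw [split t ⟨hst, le_rfl⟩, split s ⟨le_rfl, hst⟩, heq] at h
    linarith
  have limT : Tendsto (fun n : ℕ => ∫ τ in s..t, ∫ x, max (Γ τ x - k) 0 * W n x) atTop
      (𝓝 (∫ τ in s..t, ∫ x, max (Γ τ x - k) 0 *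
        (Real.exp (-(l * cylRadius x)) * (2 * Cv * l - l ^ 2)))) := by
    refine intervalIntegral.tendsto_integral_filter_of_dominated_convergence (fun _ => M * Cb)
      (Eventually.of_forall fun n => ?_)
      (Eventually.of_forall fun n => Eventually.of_forall fun τ hτ => ?_) (by simp)
      (Eventually.of_forall fun τ hτ => ?_)
    -- Continuity in time is available only for integrals over compact sets, so measurability in τ
    -- is obtained from a limit of cut-off integrals.
    · have hlim : ∀ τ ∈ uIoc s t, Tendsto (fun m : ℕ => ∫ x, max (Γ τ x - k) 0 *
          (W n x * cut ((m : ℝ) + 1) x)) atTop (𝓝 (∫ x, max (Γ τ x - k) 0 * W n x)) := by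
        intro τ hτ
        rw [uIoc_of_le hst] at hτ
        refine lim (fun m x => W n x * cut ((m : ℝ) + 1) x) (W n) Cb
          (fun m => (hWc n).mul (contDiff_cut (n := 0)).continuous) (fun m x => ?_)
          (fun x _ => ?_) τ ⟨hτ.1.le, hτ.2⟩
        · rw [abs_mul, abs_of_nonneg (cut_nonneg x)]
          exact (mul_le_of_le_one_right (abs_nonneg _) (cut_le_one x)).trans (hWb n x)
        · simpa using (tendsto_cut x).const_mul (W n x)
      refine aestronglyMeasurable_of_tendsto_ae atTop
        (f := fun (m : ℕ) τ => ∫ x, max (Γ τ x - k) 0 * (W n x * cut ((m : ℝ) + 1) x))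
        (fun m => ?_) ((ae_restrict_iff' measurableSet_uIoc).2 (Eventually.of_forall hlim))
      have c : SlabCont T fun τ x => max (Γ τ x - k) 0 * (W n x * cut ((m : ℝ) + 1) x) :=
        (hS.slabCont.comp (η := fun y => max (y - k) 0) (by fun_prop)).mul
          (SlabCont.of_space ((hWc n).mul (contDiff_cut (n := 0)).continuous))
      have := ((c.continuousOn_integral (hasCompactSupport_cut (by positivity : (0:ℝ) < m + 1))
        fun τ _ x hx => by
          simp [image_eq_zero_of_notMem_tsupport hx]).mono hsub).mono uIoc_subset_uIcc
      exact this.aestronglyMeasurable measurableSet_uIoc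
    · rw [uIoc_of_le hst] at hτ
      have hτ' : τ ∈ Icc s t := ⟨hτ.1.le, hτ.2⟩
      calc _ ≤ ∫ x, max (Γ τ x - k) 0 * Cb := by
            refine norm_integral_le_of_norm_le ((hM τ hτ').1.mul_const _)
              (Eventually.of_forall fun x => ?_)
            rw [norm_mul, Real.norm_of_nonneg (le_max_right _ _)]
            exact mul_le_mul_of_nonneg_left (hWb n x) (le_max_right _ _)
        _ = excess Γ k τ * Cb := integral_mul_const _ _
        _ ≤ _ := by gcongr; exact (hM τ hτ').2
    · rw [uIoc_of_le hst] at hτ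
      exact lim W _ Cb hWc hWb hWlim τ ⟨hτ.1.le, hτ.2⟩
  have hPb : ∀ n x, |P n x| ≤ 1 := fun n x => by rw [abs_of_nonneg (hP0 n x)]; exact hP1 n x
  have fin := le_of_tendsto_of_tendsto' (lim P _ 1 hPc hPb (fun x _ => hPlim x) s ⟨le_rfl, hst⟩)
    ((lim P _ 1 hPc hPb (fun x _ => hPlim x) t ⟨hst, le_rfl⟩).add limT) key
  have e : (∫ τ in s..t, ∫ x, max (Γ τ x - k) 0 *
        (Real.exp (-(l * cylRadius x)) * (2 * Cv * l - l ^ 2))) =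
      (2 * Cv * l - l ^ 2) *
        ∫ τ in s..t, ∫ x, max (Γ τ x - k) 0 * Real.exp (-(l * cylRadius x)) := by
    rw [← intervalIntegral.integral_const_mul]
    congr 1
    funext τ
    rw [← integral_const_mul]
    congr 1
    funext x
    ring
  rw [e] at fin
  linarith

end IsSmoothGammaSolution

/-! ### Strict decrease of the excess. -/

namespace IsSmoothGammaSolution

variable {T : ℝ} {q : ℝ≥0∞} {v : ℝ → Space3 → Space3} {Γ₀ : Space3 → ℝ} {Γ : ℝ → Space3 → ℝ}

/-- The excess over a level that is exceeded somewhere is strictly decreasing. -/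
lemma excess_lt (hv : IsSmoothVelocity T v) (hΓ : IsSmoothGammaSolution T q v Γ₀ Γ)
    {k M s t : ℝ} (hs : 0 < s) (hst : s < t) (ht : t < T)
    (hM : ∀ τ ∈ Icc s t, Integrable (fun x => max (Γ τ x - k) 0) ∧ excess Γ k τ ≤ M)
    {x₀ : Space3} (hx₀ : k < Γ s x₀) : excess Γ k t < excess Γ k s := by
  have hle : ∀ σ τ, s ≤ σ → σ ≤ τ → τ ≤ t → excess Γ k τ ≤ excess Γ k σ := fun σ τ h1 h2 h3 =>
    hΓ.excess_le_of_integrable hv (hs.trans_le h1) h2 (h3.trans_lt ht)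
      fun ρ hρ => hM ρ ⟨h1.trans hρ.1, hρ.2.trans h3⟩
  refine lt_of_le_of_ne (hle s t le_rfl hst.le le_rfl) fun heq => ?_
  obtain ⟨Cv, hCv⟩ := hv.bounded s t hs ht
  have hCv0 : 0 ≤ Cv := (norm_nonneg _).trans (hCv s ⟨le_rfl, hst.le⟩ 0)
  -- A nonincreasing function with equal values at both ends is constant in between, so the moment
  -- inequality is available on every subinterval.
  have hconst : ∀ σ τ, s ≤ σ → σ ≤ τ → τ ≤ t → excess Γ k τ = excess Γ k σ := fun σ τ h1 h2 h3 =>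
    le_antisymm (hle σ τ h1 h2 h3)
      (((hle s σ le_rfl h1 (h2.trans h3)).trans heq.ge).trans (hle τ t (h1.trans h2) h3 le_rfl))
  have hsT : s ∈ Ioo 0 T := ⟨hs, hst.trans ht⟩
  let m : ℝ → ℝ → ℝ := fun l τ => ∫ x, max (Γ τ x - k) 0 * Real.exp (-(l * cylRadius x))
  have hm0 : ∀ l τ, 0 ≤ m l τ := fun l τ => integral_nonneg fun x =>
    mul_nonneg (le_max_right _ _) (Real.exp_pos _).le
  have hcont : Continuous cylRadius := by unfold cylRadius; fun_prop
  have hexp1 : ∀ l, 0 ≤ l → ∀ x, Real.exp (-(l * cylRadius x)) ≤ 1 := fun l hl x =>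
    Real.exp_le_one_iff.2 (by have : 0 ≤ cylRadius x := Real.sqrt_nonneg _; nlinarith)
  have hint : ∀ l, 0 ≤ l → ∀ τ ∈ Icc s t,
      Integrable fun x => max (Γ τ x - k) 0 * Real.exp (-(l * cylRadius x)) := by
    intro l hl τ hτ
    refine (hM τ hτ).1.mono ?_ (Eventually.of_forall fun x => ?_)
    · have : Continuous (Γ τ) := hΓ.slabSmooth.slabCont.slice
        ⟨hs.trans_le hτ.1, hτ.2.trans_lt ht⟩
      exact (by fun_prop : Continuous fun x =>
        max (Γ τ x - k) 0 * Real.exp (-(l * cylRadius x))).aestronglyMeasurable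
    · rw [norm_mul, Real.norm_of_nonneg (Real.exp_pos _).le]
      exact mul_le_of_le_one_right (norm_nonneg _) (hexp1 l hl x)
  -- For l ≥ 2 Cv the rate l² - 2 Cv l is nonnegative, so the moment is nondecreasing. This makes it
  -- integrable in time and bounds its integral below by the length of the interval times the
  -- initial value.
  have hgrow : ∀ l, 2 * Cv ≤ l → ∀ σ τ, s ≤ σ → σ ≤ τ → τ ≤ t →
      (1 + (l ^ 2 - 2 * Cv * l) * (τ - σ)) * m l σ ≤ m l τ := by
    intro l hl
    have hl0 : 0 ≤ l := by linarith
    have hc : 0 ≤ l ^ 2 - 2 * Cv * l := by nlinarith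
    have hbase : ∀ σ τ, s ≤ σ → σ ≤ τ → τ ≤ t →
        m l σ + (l ^ 2 - 2 * Cv * l) * (∫ ρ in σ..τ, m l ρ) ≤ m l τ := fun σ τ h1 h2 h3 =>
      hΓ.exp_moment_growth hv (hs.trans_le h1) h2 (h3.trans_lt ht) hl0
        (fun ρ hρ => hCv ρ ⟨h1.trans hρ.1, hρ.2.trans h3⟩)
        (fun ρ hρ => hM ρ ⟨h1.trans hρ.1, hρ.2.trans h3⟩) (hconst σ τ h1 h2 h3)
    have hmono : ∀ σ τ, s ≤ σ → σ ≤ τ → τ ≤ t → m l σ ≤ m l τ := fun σ τ h1 h2 h3 => by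
      have h := hbase σ τ h1 h2 h3
      have : 0 ≤ ∫ ρ in σ..τ, m l ρ := intervalIntegral.integral_nonneg h2 fun ρ _ => hm0 l ρ
      have := mul_nonneg hc this
      linarith
    intro σ τ h1 h2 h3
    have hI : IntervalIntegrable (m l) volume σ τ := by
      refine MonotoneOn.intervalIntegrable ?_
      rw [uIcc_of_le h2]
      exact fun a ha b hb hab => hmono a b (h1.trans ha.1) hab (hb.2.trans h3)
    have : (τ - σ) * m l σ ≤ ∫ ρ in σ..τ, m l ρ := by
      have h := intervalIntegral.integral_mono_on h2 (by simp) hI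
        (f := fun _ => m l σ) fun ρ hρ => hmono σ ρ h1 hρ.1 (hρ.2.trans h3)
      simpa using h
    have h4 := mul_le_mul_of_nonneg_left this hc
    have h5 := hbase σ τ h1 h2 h3
    linarith
  set r₁ : ℝ := cylRadius x₀ + 1 with hr₁
  -- On this cylinder exp(-l r) ≥ exp(-l r₁), while the part of the excess inside it is positive
  -- because it contains a neighbourhood of x₀ where Γ(s) > k.
  let O : Set Space3 := {x | cylRadius x < r₁}
  have hO : IsOpen O := isOpen_lt hcont continuous_const
  set μ₀ : ℝ := ∫ x, O.indicator (fun x => max (Γ s x - k) 0) x with hμ₀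
  have hss : s ∈ Icc s t := ⟨le_rfl, hst.le⟩
  have hμi : Integrable (O.indicator fun x => max (Γ s x - k) 0) :=
    (hM s hss).1.indicator hO.measurableSet
  have hslice : Continuous (Γ s) := hΓ.slabSmooth.slabCont.slice hsT
  have hμpos : 0 < μ₀ := by
    rw [hμ₀, integral_pos_iff_support_of_nonneg
      (fun x => indicator_nonneg (fun x _ => le_max_right _ _) x) hμi]
    have hopen : IsOpen (O ∩ {x | k < Γ s x}) := hO.inter (isOpen_lt continuous_const hslice)
    refine (hopen.measure_pos volume ⟨x₀, ?_, hx₀⟩).trans_le (measure_mono ?_)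
    · change cylRadius x₀ < cylRadius x₀ + 1
      linarith
    · rintro x ⟨h1, h2⟩
      have h2' : k < Γ s x := h2
      rw [Function.mem_support, indicator_of_mem h1]
      have := le_max_left (Γ s x - k) 0
      exact (by linarith : 0 < max (Γ s x - k) 0).ne'
  have hlow : ∀ l, 0 ≤ l → Real.exp (-(l * r₁)) * μ₀ ≤ m l s := by
    intro l hl
    rw [hμ₀, ← integral_const_mul]
    refine integral_mono (hμi.const_mul _) (hint l hl s hss) fun x => ?_
    by_cases hx : x ∈ O
    · simp only [indicator_of_mem hx]
      rw [mul_comm]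
      refine mul_le_mul_of_nonneg_left (Real.exp_le_exp.2 ?_) (le_max_right _ _)
      have : cylRadius x < r₁ := hx
      nlinarith
    · simp only [indicator_of_notMem hx, mul_zero]
      exact mul_nonneg (le_max_right _ _) (Real.exp_pos _).le
  have hup : ∀ l, 0 ≤ l → m l t ≤ excess Γ k t := fun l hl =>
    integral_mono (hint l hl t ⟨hst.le, le_rfl⟩) (hM t ⟨hst.le, le_rfl⟩).1 fun x =>
      mul_le_of_le_one_right (le_max_right _ _) (hexp1 l hl x)
  -- Take l = n and divide [s, t] into n equal steps. Each step multiplies the moment by 1 + (n - 2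
  -- Cv)(t - s), eventually at least 2 exp(r₁); after n steps this beats the initial factor exp(-n
  -- r₁) by 2^n, while the excess stays bounded.
  have hfinal : ∀ᶠ n : ℕ in atTop, (2 : ℝ) ^ n * μ₀ ≤ excess Γ k t := by
    have hD : 0 < t - s := by linarith
    have e1 : Tendsto (fun n : ℕ => 1 + ((n : ℝ) - 2 * Cv) * (t - s)) atTop atTop :=
      tendsto_atTop_add_const_left _ _ ((tendsto_atTop_add_const_right _ _
        tendsto_natCast_atTop_atTop).atTop_mul_const hD)
    filter_upwards [e1.eventually_ge_atTop (2 * Real.exp r₁),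
      tendsto_natCast_atTop_atTop.eventually_ge_atTop (2 * Cv), eventually_gt_atTop 0]
      with n hn1 hn2 hn0
    have hnR : (0 : ℝ) < n := by exact_mod_cast hn0
    set h : ℝ := (t - s) / n with hh
    have hh0 : 0 ≤ h := by positivity
    have hfac : 1 + ((n : ℝ) ^ 2 - 2 * Cv * n) * h = 1 + ((n : ℝ) - 2 * Cv) * (t - s) := by
      rw [hh]; field_simp
    have hiter : ∀ j : ℕ, j ≤ n → (2 * Real.exp r₁) ^ j * m n s ≤ m n (s + j * h) := by
      intro j
      induction j with
      | zero => intro _; simp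
      | succ j ih =>
        intro hj
        have hj' : ((j + 1 : ℕ) : ℝ) ≤ n := by exact_mod_cast hj
        have hend : s + ((j + 1 : ℕ) : ℝ) * h ≤ t := by
          have : ((j + 1 : ℕ) : ℝ) * h ≤ n * h := by gcongr
          have e : (n : ℝ) * h = t - s := by rw [hh]; field_simp
          linarith
        have hg := hgrow n hn2 (s + j * h) (s + ((j + 1 : ℕ) : ℝ) * h)
          (by have : 0 ≤ (j : ℝ) * h := by positivity
              linarith)
          (by push_cast; nlinarith) hend
        have e2 : s + ((j + 1 : ℕ) : ℝ) * h - (s + j * h) = h := by push_cast; ring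
        rw [e2, hfac] at hg
        calc (2 * Real.exp r₁) ^ (j + 1) * m n s =
              (2 * Real.exp r₁) * ((2 * Real.exp r₁) ^ j * m n s) := by ring
          _ ≤ (1 + ((n : ℝ) - 2 * Cv) * (t - s)) * m n (s + j * h) := by
              refine mul_le_mul hn1 (ih (by omega)) ?_ ?_
              · have := hm0 n s; positivity
              · exact (by positivity : (0 : ℝ) ≤ 2 * Real.exp r₁).trans hn1
          _ ≤ _ := hg
    have h1 := hiter n le_rfl
    have e3 : s + (n : ℝ) * h = t := by rw [hh]; field_simp; ring
    rw [e3] at h1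
    calc (2 : ℝ) ^ n * μ₀ = (2 * Real.exp r₁) ^ n * (Real.exp (-((n : ℝ) * r₁)) * μ₀) := by
          rw [mul_pow, ← Real.exp_nat_mul, mul_assoc, ← mul_assoc (Real.exp _), ← Real.exp_add]
          simp
      _ ≤ (2 * Real.exp r₁) ^ n * m n s := by gcongr; exact hlow n hnR.le
      _ ≤ m n t := h1
      _ ≤ _ := hup n hnR.le
  have htop : Tendsto (fun n : ℕ => (2 : ℝ) ^ n * μ₀) atTop atTop :=
    (tendsto_pow_atTop_atTop_of_one_lt one_lt_two).atTop_mul_const hμpos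
  obtain ⟨n, hn1, hn2⟩ := (hfinal.and (htop.eventually_gt_atTop (excess Γ k t))).exists
  exact absurd hn1 (not_le.2 hn2)

end IsSmoothGammaSolution

/-! ### Sobolev inequality and De Giorgi iteration. -/

lemma norm_fderiv_sq_le (f : Space3 → ℝ) (x : Space3) : ‖fderiv ℝ f x‖ ^ 2 ≤ gradSq f x := by
  have h : ‖fderiv ℝ f x‖ ≤ √(gradSq f x) := by
    refine ContinuousLinearMap.opNorm_le_bound _ (Real.sqrt_nonneg _) fun w => ?_
    rw [fderiv_eq_advect f (fun _ => w) x, advect, Real.norm_eq_abs]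
    refine abs_le_of_sq_le_sq ?_ (by positivity)
    rw [mul_pow, Real.sq_sqrt (gradSq_nonneg f x), EuclideanSpace.norm_sq_eq]
    have := Finset.sum_mul_sq_le_sq_mul_sq Finset.univ (fun i => w i) (fun i => partialD i f x)
    simp only [Real.norm_eq_abs, sq_abs]
    unfold gradSq
    linarith
  calc ‖fderiv ℝ f x‖ ^ 2 ≤ √(gradSq f x) ^ 2 := by gcongr
    _ = gradSq f x := Real.sq_sqrt (gradSq_nonneg f x)

lemma continuous_gradSq {f : Space3 → ℝ} (hf : ContDiff ℝ 1 f) : Continuous (gradSq f) := by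
  have : ∀ i, Continuous (partialD i f) := fun i => (hf.partialD (m := 0) (by simp) i).continuous
  unfold gradSq; fun_prop

lemma HasCompactSupport.gradSq {f : Space3 → ℝ} (hf : HasCompactSupport f) :
    HasCompactSupport (gradSq f) := by
  refine HasCompactSupport.intro hf fun x hx => ?_
  simp [_root_.gradSq, partialD_eq_zero_of_notMem hx]

/-- The Sobolev inequality combined with the Hölder inequality. -/
lemma exists_sobolev_holder : ∃ C : ℝ, 0 ≤ C ∧ ∀ g : Space3 → ℝ, ContDiff ℝ 1 g →
    HasCompactSupport g → ∀ U : Space3 → ℝ, (∀ x, 0 ≤ U x) → Integrable U →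
    ∫ x, g x ^ 2 * U x ^ (2 / 3 : ℝ) ≤ C * (∫ x, gradSq g x) * (∫ x, U x) ^ (2 / 3 : ℝ) := by
  set C := SNormLESNormFDerivOfEqConst ℝ (volume : Measure Space3) 2 with hC
  refine ⟨(C : ℝ) ^ 2, by positivity, fun g hg hgc U hU0 hU => ?_⟩
  have hgcont := hg.continuous
  have hsob : eLpNorm g 6 volume ≤ C * eLpNorm (fderiv ℝ g) 2 volume := by
    have := eLpNorm_le_eLpNorm_fderiv_of_eq (volume : Measure Space3) hg hgc (p := 2) (p' := 6)
      (by norm_num) (by simp) (by simp; norm_num)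
    exact_mod_cast this
  have hfc : Continuous (fderiv ℝ g) := hg.continuous_fderiv (by simp)
  have hm6 : MemLp g 6 volume := hgcont.memLp_of_hasCompactSupport hgc
  have hm2 : MemLp (fderiv ℝ g) 2 volume := hfc.memLp_of_hasCompactSupport (hgc.fderiv ℝ)
  rw [hm6.eLpNorm_eq_integral_rpow_norm (by simp) (by simp),
    hm2.eLpNorm_eq_integral_rpow_norm (by simp) (by simp),
    show (C : ℝ≥0∞) = ENNReal.ofReal (C : ℝ) by simp, ← ENNReal.ofReal_mul (by positivity),
    ENNReal.ofReal_le_ofReal_iff (by positivity)] at hsob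
  have e6 : (6 : ℝ≥0∞).toReal = 6 := by simp
  have e2 : (2 : ℝ≥0∞).toReal = 2 := by simp
  rw [e6, e2] at hsob
  set A : ℝ := ∫ x, ‖g x‖ ^ (6 : ℝ) with hA
  set D : ℝ := ∫ x, ‖fderiv ℝ g x‖ ^ (2 : ℝ) with hD
  have hA0 : 0 ≤ A := integral_nonneg fun x => by positivity
  have hD0 : 0 ≤ D := integral_nonneg fun x => by positivity
  have h3 : A ^ (1 / 3 : ℝ) ≤ (C : ℝ) ^ 2 * D := by
    have h := pow_le_pow_left₀ (by positivity) hsob 2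
    rw [mul_pow, ← Real.rpow_natCast, ← Real.rpow_mul hA0, ← Real.rpow_natCast (D ^ _),
      ← Real.rpow_mul hD0] at h
    norm_num at h ⊢
    exact h
  have hDle : D ≤ ∫ x, gradSq g x := by
    refine integral_mono_of_nonneg (Eventually.of_forall fun x => by positivity)
      ((continuous_gradSq hg).integrable_of_hasCompactSupport hgc.gradSq)
      (Eventually.of_forall fun x => ?_)
    simpa using norm_fderiv_sq_le g x
  -- Exponents 3 and 3/2: the Sobolev exponent of 2 in dimension three is 6, so g² is in L³, while
  -- U^(2/3) is in L^(3/2) because U is integrable.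
  have hholder := integral_mul_le_Lp_mul_Lq_of_nonneg (μ := (volume : Measure Space3))
    (p := 3) (q := 3 / 2) (by rw [Real.holderConjugate_iff]; norm_num)
    (f := fun x => g x ^ 2) (g := fun x => U x ^ (2 / 3 : ℝ))
    (Eventually.of_forall fun x => by positivity)
    (Eventually.of_forall fun x => by have := hU0 x; positivity)
    ((hgcont.pow 2).memLp_of_hasCompactSupport (by
      simp only [pow_two]; exact hgc.mul_left))
    (by
      have hmeas : AEStronglyMeasurable (fun x => U x ^ (2 / 3 : ℝ)) volume :=
        (hU.aemeasurable.pow_const _).aestronglyMeasurable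
      rw [← integrable_norm_rpow_iff hmeas (by simp) (by simp)]
      refine hU.congr (Eventually.of_forall fun x => ?_)
      have := hU0 x
      change U x = ‖U x ^ (2 / 3 : ℝ)‖ ^ (ENNReal.ofReal (3 / 2)).toReal
      rw [Real.norm_of_nonneg (by positivity), ← Real.rpow_mul this,
        ENNReal.toReal_ofReal (by norm_num)]
      norm_num)
  have ea : ∫ x, (g x ^ 2) ^ (3 : ℝ) = A := by
    rw [hA]
    congr 1
    funext x
    rw [show (6 : ℝ) = ((6 : ℕ) : ℝ) by norm_num, show (3 : ℝ) = ((3 : ℕ) : ℝ) by norm_num,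
      Real.rpow_natCast, Real.rpow_natCast, ← pow_mul, Real.norm_eq_abs,
      Even.pow_abs (by decide)]
  have eb : ∫ x, (U x ^ (2 / 3 : ℝ)) ^ (3 / 2 : ℝ) = ∫ x, U x := by
    congr 1
    funext x
    rw [← Real.rpow_mul (hU0 x)]; norm_num
  rw [ea, eb, show (1 : ℝ) / (3 / 2) = 2 / 3 by norm_num] at hholder
  refine hholder.trans ?_
  have : 0 ≤ ∫ x, U x := integral_nonneg hU0
  gcongr
  exact h3.trans (by gcongr)

/-- An abstract De Giorgi iteration. -/
lemma eq_zero_of_de_giorgi {Φ : ℝ → ℝ → ℝ} {C k h s t : ℝ} (hC : 0 < C) (hk : 0 < k)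
    (hh : 0 < h) (hs : 0 < s) (hst : s < t) (h0 : ∀ k t, 0 ≤ Φ k t)
    (hmono : ∀ k' τ, 0 < k' → k' ≤ k + h → 0 < τ → τ ≤ t → Φ (k + h) t ≤ Φ k' τ)
    (hrec : ∀ k' h' σ τ, 0 < k' → 0 < h' → 0 < σ → σ < τ → τ ≤ t →
      (τ - σ) * Φ (k' + h') τ ≤ C * h' ^ (-(2 / 3) : ℝ) * Φ k' σ ^ (5 / 3 : ℝ))
    (hsmall : 2 * C * (7 / 8 * h) ^ (-(2 / 3) : ℝ) / (t - s) * Φ k s ^ (2 / 3 : ℝ) ≤ 1 / 64) :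
    Φ (k + h) t = 0 := by
  set δ := t - s with hδ
  have hδ0 : 0 < δ := by simp [hδ, hst]
  -- Times approach t at the rate 2^(-j) and levels approach k + h at the rate 8^(-j). Level gaps
  -- cost 4^j through the power -2/3 and time gaps cost 2^j, while decay 64^(-j) becomes 1024^(-j)
  -- under the power 5/3. The net rate 8/1024 = 1/128 is better than the 1/64 to be propagated.
  let tt : ℕ → ℝ := fun j => t - δ * (1 / 2) ^ j
  let kk : ℕ → ℝ := fun j => k + h * (1 - (1 / 8) ^ j)
  set a0 := Φ k s with ha0
  have ha0n : 0 ≤ a0 := h0 _ _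
  have hp8 : ∀ j : ℕ, ((1 / 8 : ℝ)) ^ j ≤ 1 := fun j => pow_le_one₀ (by norm_num) (by norm_num)
  have hp2 : ∀ j : ℕ, ((1 / 2 : ℝ)) ^ j ≤ 1 := fun j => pow_le_one₀ (by norm_num) (by norm_num)
  have hkk : ∀ j, 0 < kk j := fun j => by
    have : 0 ≤ h * (1 - (1 / 8) ^ j) := mul_nonneg hh.le (by linarith [hp8 j])
    simp only [kk]; linarith
  have htt : ∀ j, 0 < tt j := fun j => by
    have : δ * (1 / 2) ^ j ≤ δ * 1 := by gcongr; exact hp2 j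
    simp only [tt]; linarith
  have decay : ∀ j : ℕ, Φ (kk j) (tt j) ≤ a0 * (1 / 64) ^ j := by
    intro j
    induction j with
    | zero => simp [kk, tt, hδ, ha0]
    | succ j ih =>
      have hj : 0 < 7 / 8 * h * (1 / 8) ^ j := by positivity
      have ek : kk j + 7 / 8 * h * (1 / 8) ^ j = kk (j + 1) := by simp only [kk]; ring
      have et : tt (j + 1) - tt j = δ / 2 * (1 / 2) ^ j := by simp only [tt]; ring
      have hlt : tt j < tt (j + 1) := by
        have : 0 < δ / 2 * (1 / 2) ^ j := by positivity
        linarith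
      have h1 := hrec (kk j) (7 / 8 * h * (1 / 8) ^ j) (tt j) (tt (j + 1)) (hkk j) hj (htt j) hlt
        (by have : 0 ≤ δ * (1 / 2) ^ (j + 1) := by positivity
            simp only [tt]; linarith)
      rw [ek, et] at h1
      have e8 : (7 / 8 * h * (1 / 8 : ℝ) ^ j) ^ (-(2 / 3) : ℝ) =
          (7 / 8 * h) ^ (-(2 / 3) : ℝ) * 4 ^ j := by
        rw [Real.mul_rpow (by positivity) (by positivity)]
        congr 1
        have : (1 / 8 : ℝ) = (1 / 2) ^ (3 : ℝ) := by norm_num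
        rw [this, ← Real.rpow_natCast, ← Real.rpow_mul (by positivity),
          ← Real.rpow_mul (by positivity), show (3 : ℝ) * (j * (-(2 / 3))) = (-2) * j by ring,
          Real.rpow_mul (by norm_num), Real.rpow_natCast]
        congr 1
        rw [Real.rpow_neg (by norm_num)]
        norm_num
      have e64 : (a0 * (1 / 64 : ℝ) ^ j) ^ (5 / 3 : ℝ) = a0 ^ (5 / 3 : ℝ) * (1 / 1024) ^ j := by
        rw [Real.mul_rpow ha0n (by positivity)]
        congr 1
        have : (1 / 64 : ℝ) = (1 / 4) ^ (3 : ℝ) := by norm_num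
        rw [this, ← Real.rpow_natCast, ← Real.rpow_mul (by positivity),
          ← Real.rpow_mul (by positivity), show (3 : ℝ) * (j * (5 / 3)) = 5 * j by ring,
          Real.rpow_mul (by norm_num), Real.rpow_natCast]
        congr 1
        norm_num
      have h2 : Φ (kk j) (tt j) ^ (5 / 3 : ℝ) ≤ a0 ^ (5 / 3 : ℝ) * (1 / 1024) ^ j := by
        rw [← e64]
        exact Real.rpow_le_rpow (h0 _ _) ih (by norm_num)
      rw [e8] at h1
      have ea : a0 ^ (5 / 3 : ℝ) = a0 ^ (2 / 3 : ℝ) * a0 := by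
        rcases ha0n.eq_or_lt with hz | hz
        · rw [← hz]; norm_num
        · rw [show (5 / 3 : ℝ) = 2 / 3 + 1 by norm_num, Real.rpow_add hz, Real.rpow_one]
      set Y := (7 / 8 * h) ^ (-(2 / 3) : ℝ) with hY
      have hY0 : 0 ≤ Y := by positivity
      have h3 : δ / 2 * (1 / 2) ^ j * Φ (kk (j + 1)) (tt (j + 1)) ≤
          C * (Y * 4 ^ j) * (a0 ^ (2 / 3 : ℝ) * a0 * (1 / 1024) ^ j) := by
        refine h1.trans ?_
        rw [← ea]
        gcongr
      have h4 : Φ (kk (j + 1)) (tt (j + 1)) ≤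
          (2 * C * Y / δ * a0 ^ (2 / 3 : ℝ)) * a0 * (1 / 128) ^ j := by
        have hpos : 0 < δ / 2 * (1 / 2 : ℝ) ^ j := by positivity
        rw [← mul_le_mul_iff_right₀ hpos]
        refine h3.trans (le_of_eq ?_)
        have : (1 / 2 : ℝ) ^ j * (1 / 128) ^ j = 4 ^ j * (1 / 1024) ^ j := by
          rw [← mul_pow, ← mul_pow]; norm_num
        field_simp
        linear_combination (-(Y * a0 ^ (2 / 3 : ℝ) * a0)) * this
      calc Φ (kk (j + 1)) (tt (j + 1)) ≤ _ := h4
        _ ≤ 1 / 64 * a0 * (1 / 128) ^ j := by gcongr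
        _ ≤ 1 / 64 * a0 * (1 / 64) ^ j := by gcongr; norm_num
        _ = _ := by ring
  have hle : ∀ j : ℕ, Φ (k + h) t ≤ a0 * (1 / 64) ^ j := fun j => by
    refine (hmono (kk j) (tt j) (hkk j) ?_ (htt j) ?_).trans (decay j)
    · have : 0 ≤ h * (1 / 8) ^ j := by positivity
      simp only [kk]; linarith
    · have : 0 ≤ δ * (1 / 2) ^ j := by positivity
      simp only [tt]; linarith
  have hlim : Tendsto (fun j : ℕ => a0 * (1 / 64 : ℝ) ^ j) atTop (𝓝 (a0 * 0)) :=
    (tendsto_pow_atTop_nhds_zero_of_lt_one (by norm_num) (by norm_num)).const_mul a0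
  rw [mul_zero] at hlim
  exact le_antisymm (ge_of_tendsto' hlim hle) (h0 _ _)

/-! ### The profile used in the smoothing estimate -/

/-- A profile growing like the cube root. -/
def rootProfile (y : ℝ) : ℝ := 3 * ((1 + max y 0 ^ 2) ^ (1 / 6 : ℝ) - 1)

/-- The derivative of the convex profile dominating `rootProfile`. -/
def slopeProfile (y : ℝ) : ℝ := 3 * (1 - (1 + max y 0 ^ 2) ^ (-(1 / 6) : ℝ))

lemma one_add_posPart_sq_pos (y : ℝ) : 0 < 1 + max y 0 ^ 2 := by positivity

lemma hasDerivAt_rootProfile (y : ℝ) :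
    HasDerivAt rootProfile (max y 0 * (1 + max y 0 ^ 2) ^ (-(5 / 6) : ℝ)) y := by
  have h := ((((hasDerivAt_posPart_sq y).const_add 1).rpow_const (p := (1 / 6 : ℝ))
    (Or.inl (one_add_posPart_sq_pos y).ne')).sub_const 1).const_mul 3
  refine h.congr_deriv ?_
  norm_num
  ring

lemma hasDerivAt_slopeProfile (y : ℝ) :
    HasDerivAt slopeProfile (max y 0 * (1 + max y 0 ^ 2) ^ (-(7 / 6) : ℝ)) y := by
  have h := ((((hasDerivAt_posPart_sq y).const_add 1).rpow_const (p := (-(1 / 6) : ℝ))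
    (Or.inl (one_add_posPart_sq_pos y).ne')).const_sub 1).const_mul 3
  refine h.congr_deriv ?_
  norm_num
  ring

lemma contDiff_rootProfile : ContDiff ℝ 1 rootProfile :=
  contDiff_one_of_hasDerivAt hasDerivAt_rootProfile
    ((by fun_prop : Continuous fun y : ℝ => max y 0).mul
      ((by fun_prop : Continuous fun y : ℝ => 1 + max y 0 ^ 2).rpow_const
        fun y => Or.inl (one_add_posPart_sq_pos y).ne'))

lemma contDiff_slopeProfile : ContDiff ℝ 1 slopeProfile :=
  contDiff_one_of_hasDerivAt hasDerivAt_slopeProfile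
    ((by fun_prop : Continuous fun y : ℝ => max y 0).mul
      ((by fun_prop : Continuous fun y : ℝ => 1 + max y 0 ^ 2).rpow_const
        fun y => Or.inl (one_add_posPart_sq_pos y).ne'))

lemma slopeProfile_nonneg (y : ℝ) : 0 ≤ slopeProfile y := by
  have : (1 + max y 0 ^ 2) ^ (-(1 / 6) : ℝ) ≤ 1 :=
    Real.rpow_le_one_of_one_le_of_nonpos (by nlinarith [sq_nonneg (max y 0)]) (by norm_num)
  unfold slopeProfile; linarith

lemma slopeProfile_le (y : ℝ) : slopeProfile y ≤ 3 := by
  have : 0 < (1 + max y 0 ^ 2) ^ (-(1 / 6) : ℝ) := by positivity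
  unfold slopeProfile; linarith

lemma slopeProfile_of_nonpos (y : ℝ) (hy : y ≤ 0) : slopeProfile y = 0 := by
  simp [slopeProfile, max_eq_right hy]

/-- The convex profile with derivative `slopeProfile` grows linearly, so its energy inequality
involves only the excess. Its second derivative dominates the square of the derivative of
`rootProfile`, so the dissipation controls the gradient of `rootProfile` composed with the solution.
-/
lemma sq_deriv_rootProfile_le (y : ℝ) : deriv rootProfile y ^ 2 ≤ deriv slopeProfile y := by
  rw [(hasDerivAt_rootProfile y).deriv, (hasDerivAt_slopeProfile y).deriv]
  set m := max y 0
  have hm : 0 ≤ m := le_max_right _ _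
  have hp : 0 < 1 + m ^ 2 := by positivity
  have e : ((1 + m ^ 2) ^ (-(5 / 6) : ℝ)) ^ 2 =
      (1 + m ^ 2) ^ (-(7 / 6) : ℝ) * (1 + m ^ 2) ^ (-(1 / 2) : ℝ) := by
    rw [← Real.rpow_natCast, ← Real.rpow_mul hp.le, ← Real.rpow_add hp]; norm_num
  have h1 : m * (1 + m ^ 2) ^ (-(1 / 2) : ℝ) ≤ 1 := by
    rw [Real.rpow_neg hp.le, ← Real.sqrt_eq_rpow, ← div_eq_mul_inv, div_le_one (by positivity)]
    exact Real.le_sqrt_of_sq_le (by linarith)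
  rw [mul_pow, e]
  have h2 : 0 ≤ m * (1 + m ^ 2) ^ (-(7 / 6) : ℝ) := by positivity
  nlinarith

/-- The square grows at most linearly, so the error from the gradient of the cutoff is again bounded
by the excess. -/
lemma rootProfile_sq_le (y : ℝ) : rootProfile y ^ 2 ≤ 9 * max y 0 := by
  unfold rootProfile
  set m := max y 0
  have hm : 0 ≤ m := le_max_right _ _
  have hp : 0 < 1 + m ^ 2 := by positivity
  set b := (1 + m ^ 2) ^ (1 / 6 : ℝ) with hb
  have hb1 : 1 ≤ b := Real.one_le_rpow (by nlinarith) (by norm_num)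
  have hb6 : b ^ 6 = 1 + m ^ 2 := by
    rw [hb, ← Real.rpow_natCast, ← Real.rpow_mul hp.le]; norm_num
  have h1 : ((b - 1) ^ 2) ^ 2 ≤ m ^ 2 := by
    -- With b = a + 1 the claim a⁴ ≤ b⁶ - 1 becomes the positivity of all coefficients of a
    -- polynomial in a ≥ 0.
    obtain ⟨a, ha, hba⟩ : ∃ a, 0 ≤ a ∧ b = a + 1 := ⟨b - 1, by linarith, by ring⟩
    rw [hba] at hb6 ⊢
    have : m ^ 2 = (a + 1) ^ 6 - 1 := by linarith
    rw [this]
    have e : (a + 1) ^ 6 - 1 - ((a + 1 - 1) ^ 2) ^ 2 =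
      a ^ 6 + 6 * a ^ 5 + 14 * a ^ 4 + 20 * a ^ 3 + 15 * a ^ 2 + 6 * a := by ring
    have : 0 ≤ a ^ 6 + 6 * a ^ 5 + 14 * a ^ 4 + 20 * a ^ 3 + 15 * a ^ 2 + 6 * a := by positivity
    linarith
  have h2 : (b - 1) ^ 2 ≤ m := le_of_sq_le_sq h1 hm
  nlinarith

/-- `rootProfile` grows like y^(1/3), so the right side grows like y^(4/3), which dominates y for y
≥ 1. The threshold y ≥ 1 corresponds to raising the level from k to k + h. -/
lemma exists_le_rootProfile : ∃ C : ℝ, 0 < C ∧ ∀ y, 1 ≤ y →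
    y ≤ C * (rootProfile y ^ 2 * max y 0 ^ (2 / 3 : ℝ)) := by
  set c : ℝ := 3 * (1 - 2 ^ (-(1 / 6) : ℝ)) with hc
  have hc0 : 0 < c := by
    have : (2 : ℝ) ^ (-(1 / 6) : ℝ) < 1 :=
      Real.rpow_lt_one_of_one_lt_of_neg (by norm_num) (by norm_num)
    rw [hc]; linarith
  refine ⟨(c ^ 2)⁻¹, by positivity, fun y hy => ?_⟩
  have hy0 : 0 < y := by linarith
  have h1 : c * y ^ (1 / 3 : ℝ) ≤ rootProfile y := by
    unfold rootProfile
    rw [max_eq_left hy0.le]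
    set b := (1 + y ^ 2) ^ (1 / 6 : ℝ) with hb
    have hb2 : (2 : ℝ) ^ (1 / 6 : ℝ) ≤ b := Real.rpow_le_rpow (by norm_num) (by nlinarith)
      (by norm_num)
    have hby : y ^ (1 / 3 : ℝ) ≤ b := by
      have : y ^ (1 / 3 : ℝ) = (y ^ 2) ^ (1 / 6 : ℝ) := by
        rw [← Real.rpow_natCast, ← Real.rpow_mul hy0.le]; norm_num
      rw [this]
      exact Real.rpow_le_rpow (by positivity) (by linarith) (by norm_num)
    have h22 : (2 : ℝ) ^ (-(1 / 6) : ℝ) * 2 ^ (1 / 6 : ℝ) = 1 := by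
      rw [← Real.rpow_add (by norm_num)]; norm_num
    have h3 : 1 ≤ (2 : ℝ) ^ (-(1 / 6) : ℝ) * b := by
      calc (1 : ℝ) = (2 : ℝ) ^ (-(1 / 6) : ℝ) * 2 ^ (1 / 6 : ℝ) := h22.symm
        _ ≤ _ := by gcongr
    have : c * y ^ (1 / 3 : ℝ) ≤ c * b := by gcongr
    rw [hc] at this ⊢
    linarith
  have h2 : (c * y ^ (1 / 3 : ℝ)) ^ 2 ≤ rootProfile y ^ 2 := by gcongr
  have e : (y ^ (1 / 3 : ℝ)) ^ 2 = y ^ (2 / 3 : ℝ) := by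
    rw [← Real.rpow_natCast, ← Real.rpow_mul hy0.le]; norm_num
  have h4 : y ≤ y ^ (2 / 3 : ℝ) * y ^ (2 / 3 : ℝ) := by
    rw [← Real.rpow_add hy0]
    calc y = y ^ (1 : ℝ) := (Real.rpow_one y).symm
      _ ≤ _ := Real.rpow_le_rpow_of_exponent_le hy (by norm_num)
  rw [mul_pow, e] at h2
  rw [max_eq_left hy0.le, inv_mul_eq_div, le_div_iff₀ (by positivity)]
  have h5 : 0 ≤ y ^ (2 / 3 : ℝ) := by positivity
  calc y * c ^ 2 ≤ (y ^ (2 / 3 : ℝ) * y ^ (2 / 3 : ℝ)) * c ^ 2 := by gcongr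
    _ = (c ^ 2 * y ^ (2 / 3 : ℝ)) * y ^ (2 / 3 : ℝ) := by ring
    _ ≤ _ := by gcongr

lemma gradSq_mul_le {f g : Space3 → ℝ} {x : Space3} (hf : DifferentiableAt ℝ f x)
    (hg : DifferentiableAt ℝ g x) :
    gradSq (fun y => f y * g y) x ≤ 2 * f x ^ 2 * gradSq g x + 2 * gradSq f x * g x ^ 2 := by
  simp only [gradSq, partialD_mul _ hf hg, Fin.sum_univ_three]
  nlinarith [sq_nonneg (f x * partialD 0 g x - partialD 0 f x * g x),
    sq_nonneg (f x * partialD 1 g x - partialD 1 f x * g x),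
    sq_nonneg (f x * partialD 2 g x - partialD 2 f x * g x)]

lemma gradSq_comp {f : Space3 → ℝ} {x : Space3} {η : ℝ → ℝ} {η' : ℝ}
    (hη : HasDerivAt η η' (f x)) (hf : DifferentiableAt ℝ f x) :
    gradSq (fun y => η (f y)) x = η' ^ 2 * gradSq f x := by
  simp only [gradSq, partialD_comp _ hη hf, Fin.sum_univ_three]
  ring

/-! ### The smoothing estimate. -/

namespace IsSmoothGammaSolution

variable {T : ℝ} {q : ℝ≥0∞} {v : ℝ → Space3 → Space3} {Γ₀ : Space3 → ℝ} {Γ : ℝ → Space3 → ℝ}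

/-- One level step of De Giorgi's method. The Sobolev-Hölder inequality is applied to g =
`rootProfile` of (Γ - k)/h times the cutoff and to U = (Γ - k)₊. The gradient of g is paid for by
the dissipation, at most 3 E_k(s) up to O(1/R), and U^(2/3) by the excess, whence the superlinear
power 5/3. -/
lemma integral_excess_cut_le (hv : IsSmoothVelocity T v) (hΓ : IsSmoothGammaSolution T q v Γ₀ Γ)
    (hq : 1 ≤ q) (hq' : q ≠ ⊤) {A k h s t : ℝ} (hA : 0 ≤ A) (hk : 0 < k) (hh : 0 < h) (hs : 0 < s)
    (hst : s ≤ t) (ht : t < T)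
    (hA1 : ∀ y : ℝ, 1 ≤ y → y ≤ A * (rootProfile y ^ 2 * max y 0 ^ (2 / 3 : ℝ)))
    (hA2 : ∀ g : Space3 → ℝ, ContDiff ℝ 1 g → HasCompactSupport g → ∀ U : Space3 → ℝ,
      (∀ x, 0 ≤ U x) → Integrable U →
      ∫ x, g x ^ 2 * U x ^ (2 / 3 : ℝ) ≤ A * (∫ x, gradSq g x) * (∫ x, U x) ^ (2 / 3 : ℝ)) :
    ∃ E : ℝ, ∀ R : ℝ, 1 ≤ R →
      ∫ τ in s..t, ∫ x, max (Γ τ x - (k + h)) 0 * cut R x ^ 2 ≤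
        6 * A ^ 2 * h ^ (-(2 / 3) : ℝ) * excess Γ k s ^ (5 / 3 : ℝ) + E / R := by
  have hS := hΓ.slabSmooth
  have hsub : Icc s t ⊆ Ioo 0 T := fun τ hτ => ⟨hs.trans_le hτ.1, hτ.2.trans_lt ht⟩
  set F := excess Γ k s with hF
  have hF0 : 0 ≤ F := excess_nonneg _ _ _
  have hFτ : ∀ τ ∈ Icc s t, excess Γ k τ ≤ F := fun τ hτ =>
    hΓ.excess_antitone hv hq hq' hk hs.le hτ.1 (hτ.2.trans_lt ht)
  have hint : ∀ τ ∈ Icc s t, Integrable fun x => max (Γ τ x - k) 0 := fun τ hτ =>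
    hΓ.integrable_excess hq hq' hk (Ioo_subset_Ico_self (hsub hτ))
  -- the convex function in the energy inequality
  set φ : ℝ → ℝ := fun σ => slopeProfile (σ / h) with hφ
  have hφ1 : ContDiff ℝ 1 φ := contDiff_slopeProfile.comp (contDiff_id.div_const h)
  set η := shiftPrim φ k with hη
  have hη2 : ContDiff ℝ 2 η := contDiff_shiftPrim hφ1
  have hφneg : ∀ y ≤ 0, φ y = 0 := fun y hy =>
    slopeProfile_of_nonpos _ (div_nonpos_of_nonpos_of_nonneg hy hh.le)
  have hη0 : ∀ y, 0 ≤ η y := shiftPrim_nonneg (fun y => slopeProfile_nonneg _) hφneg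
  have hηle : ∀ y, η y ≤ 3 * max (y - k) 0 :=
    shiftPrim_le hφ1.continuous (fun y => slopeProfile_le _) hφneg
  have hη'' : ∀ y, deriv (deriv η) y = deriv slopeProfile ((y - k) / h) / h := by
    intro y
    rw [hη, deriv_shiftPrim hφ1.continuous]
    have h1 : HasDerivAt (fun y => (y - k) / h) (1 / h) y :=
      ((hasDerivAt_id y).sub_const k).div_const h
    have h2 := (hasDerivAt_slopeProfile ((y - k) / h)).comp y h1
    have : (fun y => φ (y - k)) = slopeProfile ∘ fun y => (y - k) / h := rfl
    rw [this, h2.deriv, (hasDerivAt_slopeProfile _).deriv]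
    ring
  obtain ⟨E, hE0, hE⟩ := hΓ.energy_le_cut hv isWeight_one (W := fun _ => 0) continuous_const hs hst
    ht (fun τ _ x => by simp [advect, lap_const])
  obtain ⟨C, hC0, hC⟩ := exists_bound_cut
  have hintη : ∀ τ ∈ Icc s t, Integrable (fun x => η (Γ τ x)) ∧ ∫ x, η (Γ τ x) ≤ 3 * F := by
    intro τ hτ
    have hi : Integrable fun x => η (Γ τ x) :=
      ((hint τ hτ).const_mul 3).mono'
        (hη2.continuous.comp (hS.slabCont.slice (hsub hτ))).aestronglyMeasurable
        (Eventually.of_forall fun x => by rw [Real.norm_of_nonneg (hη0 _)]; exact hηle _)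
    refine ⟨hi, (integral_mono hi ((hint τ hτ).const_mul 3) fun x => hηle _).trans ?_⟩
    rw [integral_const_mul]
    have := hFτ τ hτ
    unfold excess at this
    linarith
  -- The prefactor after Sobolev-Hölder. Multiplied by 2/h from the gradient bound and by 3F from
  -- the energy, it yields 6 A² h^(1/3 - 1) F^(5/3).
  set P := A * h ^ (1 / 3 : ℝ) * (A * F ^ (2 / 3 : ℝ)) with hP
  have hP0 : 0 ≤ P := by positivity
  refine ⟨P * (2 / h) * (3 * E * F) + (t - s) * P * (54 * C ^ 2 / h * F), fun R hR => ?_⟩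
  have hR0 : 0 < R := by linarith
  have hKc : IsCompact (tsupport (cut R)) := hasCompactSupport_cut hR0
  set D : ℝ → Space3 → ℝ := fun τ x => deriv (deriv η) (Γ τ x) * gradSq (Γ τ) x * (1 * cut R x)
    with hD
  have hηc : Continuous (deriv (deriv η)) := by
    have := hη2.continuous_iteratedDeriv 2 le_rfl
    rwa [iteratedDeriv_succ, iteratedDeriv_one] at this
  have cD : SlabCont T D := ((hS.slabCont.comp hηc).mul hS.slabCont_gradSq).mul
    (SlabCont.of_space (continuous_const.mul (contDiff_cut (n := 0)).continuous))
  have zD : ∀ τ ∈ Ioo 0 T, ∀ x ∉ tsupport (cut R), D τ x = 0 := fun τ _ x hx => by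
    simp [hD, image_eq_zero_of_notMem_tsupport hx]
  have cL : SlabCont T fun τ x => max (Γ τ x - (k + h)) 0 * cut R x ^ 2 :=
    (hS.slabCont.comp (by fun_prop : Continuous fun y : ℝ => max (y - (k + h)) 0)).mul
      (SlabCont.of_space ((contDiff_cut (n := 0)).continuous.pow 2))
  have zL : ∀ τ ∈ Ioo 0 T, ∀ x ∉ tsupport (cut R),
      max (Γ τ x - (k + h)) 0 * cut R x ^ 2 = 0 := fun τ _ x hx => by
    simp [image_eq_zero_of_notMem_tsupport hx]
  have hsub' : uIcc s t ⊆ Ioo 0 T := by rwa [uIcc_of_le hst]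
  have iD : IntervalIntegrable _ volume s t :=
    ((cD.continuousOn_integral hKc zD).mono hsub').intervalIntegrable
  have iL : IntervalIntegrable _ volume s t :=
    ((cL.continuousOn_integral hKc zL).mono hsub').intervalIntegrable
  have henergy : ∫ τ in s..t, ∫ x, D τ x ≤ 3 * F + 3 * E * F / R := by
    have h1 := hE R hR η hη2 hη0 (3 * F) hintη
    have h2 : 0 ≤ ∫ x, η (Γ t x) * (1 * cut R x) :=
      integral_nonneg fun x => mul_nonneg (hη0 _) (mul_nonneg zero_le_one (cut_nonneg x))
    have hsI : s ∈ Icc s t := ⟨le_rfl, hst⟩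
    have h3 : ∫ x, η (Γ s x) * (1 * cut R x) ≤ 3 * F := by
      refine le_trans (integral_mono_of_nonneg (Eventually.of_forall fun x =>
        mul_nonneg (hη0 _) (mul_nonneg zero_le_one (cut_nonneg x))) (hintη s hsI).1
        (Eventually.of_forall fun x => ?_)) (hintη s hsI).2
      have := mul_le_mul_of_nonneg_left (cut_le_one (R := R) x) (hη0 (Γ s x))
      dsimp only
      linarith
    simp only [zero_mul, mul_zero, integral_zero, intervalIntegral.integral_zero, add_zero] at h1
    have e : E * (3 * F) / R = 3 * E * F / R := by ring
    linarith
  have hslice : ∀ τ ∈ Icc s t, ∫ x, max (Γ τ x - (k + h)) 0 * cut R x ^ 2 ≤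
      P * (2 / h) * (∫ x, D τ x) + P * (54 * C ^ 2 / h * F / R) := by
    intro τ hτ
    have hτ' := hsub hτ
    have hΓd : Differentiable ℝ (Γ τ) := hS.differentiable_slice hτ'
    have hΓ1 : ContDiff ℝ 1 (Γ τ) := (hS.slice hτ').of_le (by exact_mod_cast le_top)
    set f : Space3 → ℝ := fun x => rootProfile ((Γ τ x - k) / h) with hf
    have hf1 : ContDiff ℝ 1 f := contDiff_rootProfile.comp ((hΓ1.sub contDiff_const).div_const h)
    set g : Space3 → ℝ := fun x => f x * cut R x with hg
    have hg1 : ContDiff ℝ 1 g := hf1.mul contDiff_cut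
    have hgc : HasCompactSupport g := (hasCompactSupport_cut hR0).mul_left
    have hU0 : ∀ x, 0 ≤ max (Γ τ x - k) 0 := fun x => le_max_right _ _
    have hsob := hA2 g hg1 hgc _ hU0 (hint τ hτ)
    have hgradf : ∀ x, gradSq f x ≤ deriv (deriv η) (Γ τ x) / h * gradSq (Γ τ) x := by
      intro x
      have h1 : HasDerivAt (fun y => rootProfile ((y - k) / h))
          (deriv rootProfile ((Γ τ x - k) / h) * (1 / h)) (Γ τ x) := by
        rw [(hasDerivAt_rootProfile _).deriv]
        exact (hasDerivAt_rootProfile _).comp (Γ τ x)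
          (((hasDerivAt_id (Γ τ x)).sub_const k).div_const h)
      rw [hf, gradSq_comp h1 (hΓd x), hη'']
      gcongr
      · exact gradSq_nonneg _ _
      · rw [show ∀ a : ℝ, (a * (1 / h)) ^ 2 = a ^ 2 / h / h by intro a; ring]
        gcongr
        exact sq_deriv_rootProfile_le _
    have hf2 : ∀ x, f x ^ 2 ≤ 9 / h * max (Γ τ x - k) 0 := by
      intro x
      have e : max ((Γ τ x - k) / h) 0 = max (Γ τ x - k) 0 / h := by
        rw [← max_div_div_right hh.le, zero_div]
      refine (rootProfile_sq_le _).trans (le_of_eq ?_)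
      rw [e]; ring
    have hgrad : ∀ x, gradSq g x ≤ 2 / h * D τ x + 54 * C ^ 2 / h / R * max (Γ τ x - k) 0 := by
      intro x
      refine (gradSq_mul_le (hf1.differentiable (by simp) x) (differentiable_cut x)).trans ?_
      have b1 : gradSq (cut R) x ≤ 3 * (C ^ 2 / R) := by
        have h1 : ∀ i, partialD i (cut R) x ^ 2 ≤ C ^ 2 / R := fun i => by
          have h2 := (hC R hR x).2.1 i
          calc partialD i (cut R) x ^ 2 = |partialD i (cut R) x| ^ 2 := (sq_abs _).symm
            _ ≤ (C / R) ^ 2 := by gcongr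
            _ = C ^ 2 / (R * R) := by rw [div_pow, pow_two R]
            _ ≤ C ^ 2 / R := by
              gcongr
              nlinarith
        simp only [gradSq, Fin.sum_univ_three]
        linarith [h1 0, h1 1, h1 2]
      have b2 : 2 * f x ^ 2 * gradSq (cut R) x ≤
          2 * (9 / h * max (Γ τ x - k) 0) * (3 * (C ^ 2 / R)) := by
        gcongr
        · exact gradSq_nonneg _ _
        · exact hf2 x
      have hc0 := cut_nonneg (R := R) x
      have hc2 : cut R x ^ 2 ≤ cut R x := by
        have := cut_le_one (R := R) x
        nlinarith
      have hg0 : 0 ≤ deriv (deriv η) (Γ τ x) / h * gradSq (Γ τ) x :=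
        (gradSq_nonneg f x).trans (hgradf x)
      have b3 : 2 * gradSq f x * cut R x ^ 2 ≤
          2 * (deriv (deriv η) (Γ τ x) / h * gradSq (Γ τ) x) * cut R x := by
        gcongr
        exact hgradf x
      have e1 : 2 * (deriv (deriv η) (Γ τ x) / h * gradSq (Γ τ) x) * cut R x = 2 / h * D τ x := by
        simp only [hD]; ring
      have e2 : 2 * (9 / h * max (Γ τ x - k) 0) * (3 * (C ^ 2 / R)) =
          54 * C ^ 2 / h / R * max (Γ τ x - k) 0 := by ring
      linarith
    have iDτ : Integrable (D τ) := cD.integrable_slice hKc hτ' (zD τ hτ')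
    have hgradint : ∫ x, gradSq g x ≤ 2 / h * (∫ x, D τ x) + 54 * C ^ 2 / h / R * F := by
      calc ∫ x, gradSq g x ≤ ∫ x, (2 / h * D τ x + 54 * C ^ 2 / h / R * max (Γ τ x - k) 0) := by
            refine integral_mono ((continuous_gradSq hg1).integrable_of_hasCompactSupport hgc.gradSq)
              ((iDτ.const_mul _).add ((hint τ hτ).const_mul _)) hgrad
        _ = 2 / h * (∫ x, D τ x) + 54 * C ^ 2 / h / R * excess Γ k τ := by
            rw [integral_add (iDτ.const_mul _) ((hint τ hτ).const_mul _), integral_const_mul,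
              integral_const_mul, excess]
        _ ≤ _ := by gcongr; exact hFτ τ hτ
    -- Where Γ > k + h the variable (Γ - k)/h exceeds 1, so the lower growth bound of `rootProfile`
    -- applies; rescaling by h leaves h / h^(2/3) = h^(1/3). Elsewhere the left side is zero.
    have hlow : ∀ x, max (Γ τ x - (k + h)) 0 * cut R x ^ 2 ≤
        A * h ^ (1 / 3 : ℝ) * (g x ^ 2 * max (Γ τ x - k) 0 ^ (2 / 3 : ℝ)) := by
      intro x
      rcases le_or_gt (Γ τ x) (k + h) with hx | hx
      · rw [max_eq_right (by linarith)]
        have : 0 ≤ A * h ^ (1 / 3 : ℝ) * (g x ^ 2 * max (Γ τ x - k) 0 ^ (2 / 3 : ℝ)) := by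
          have := hU0 x
          positivity
        simpa using this
      · have hy : 1 ≤ (Γ τ x - k) / h := by rw [le_div_iff₀ hh]; linarith
        have hpos : 0 < Γ τ x - k := by linarith
        have h1 := hA1 _ hy
        rw [max_eq_left (by positivity), Real.div_rpow hpos.le hh.le, div_le_iff₀ hh] at h1
        rw [max_eq_left (by linarith), max_eq_left hpos.le]
        have e : h / h ^ (2 / 3 : ℝ) = h ^ (1 / 3 : ℝ) := by
          nth_rewrite 1 [← Real.rpow_one h]
          rw [← Real.rpow_sub hh]; norm_num
        calc (Γ τ x - (k + h)) * cut R x ^ 2 ≤ (Γ τ x - k) * cut R x ^ 2 := by gcongr; linarith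
          _ ≤ A * (f x ^ 2 * ((Γ τ x - k) ^ (2 / 3 : ℝ) / h ^ (2 / 3 : ℝ))) * h * cut R x ^ 2 := by
              gcongr
          _ = A * (h / h ^ (2 / 3 : ℝ)) * ((f x * cut R x) ^ 2 * (Γ τ x - k) ^ (2 / 3 : ℝ)) := by
              ring
          _ = _ := by rw [e]
    have cU : Continuous fun x => g x ^ 2 * max (Γ τ x - k) 0 ^ (2 / 3 : ℝ) :=
      (hg1.continuous.pow 2).mul (((hΓ1.continuous.sub continuous_const).max
        continuous_const).rpow_const fun x => Or.inr (by norm_num))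
    have iU : Integrable fun x => g x ^ 2 * max (Γ τ x - k) 0 ^ (2 / 3 : ℝ) := by
      refine cU.integrable_of_hasCompactSupport ?_
      simp only [pow_two]
      exact (hgc.mul_left (f := g)).mul_right
    calc ∫ x, max (Γ τ x - (k + h)) 0 * cut R x ^ 2
        ≤ ∫ x, A * h ^ (1 / 3 : ℝ) * (g x ^ 2 * max (Γ τ x - k) 0 ^ (2 / 3 : ℝ)) :=
          integral_mono (cL.integrable_slice hKc hτ' (zL τ hτ')) (iU.const_mul _) hlow
      _ = A * h ^ (1 / 3 : ℝ) * ∫ x, g x ^ 2 * max (Γ τ x - k) 0 ^ (2 / 3 : ℝ) :=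
          integral_const_mul _ _
      _ ≤ A * h ^ (1 / 3 : ℝ) * (A * (2 / h * (∫ x, D τ x) + 54 * C ^ 2 / h / R * F) *
            F ^ (2 / 3 : ℝ)) := by
          gcongr
          refine hsob.trans ?_
          have hg0 : 0 ≤ ∫ x, gradSq g x := integral_nonneg fun x => gradSq_nonneg g x
          have h1 : (∫ x, max (Γ τ x - k) 0) ^ (2 / 3 : ℝ) ≤ F ^ (2 / 3 : ℝ) :=
            Real.rpow_le_rpow (integral_nonneg hU0) (hFτ τ hτ) (by norm_num)
          have h2 : 0 ≤ (∫ x, max (Γ τ x - k) 0) ^ (2 / 3 : ℝ) :=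
            Real.rpow_nonneg (integral_nonneg hU0) _
          exact mul_le_mul (mul_le_mul_of_nonneg_left hgradint hA) h1 h2
            (mul_nonneg hA (hg0.trans hgradint))
      _ = _ := by rw [hP]; ring
  have hh3 : h ^ (1 / 3 : ℝ) / h = h ^ (-(2 / 3) : ℝ) := by
    nth_rewrite 2 [← Real.rpow_one h]
    rw [← Real.rpow_sub hh]; norm_num
  have hF53 : F ^ (5 / 3 : ℝ) = F ^ (2 / 3 : ℝ) * F := by
    rcases hF0.eq_or_lt with hz | hz
    · rw [← hz]; norm_num
    · rw [show (5 / 3 : ℝ) = 2 / 3 + 1 by norm_num, Real.rpow_add hz, Real.rpow_one]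
  calc ∫ τ in s..t, ∫ x, max (Γ τ x - (k + h)) 0 * cut R x ^ 2
      ≤ ∫ τ in s..t, (P * (2 / h) * (∫ x, D τ x) + P * (54 * C ^ 2 / h * F / R)) :=
        intervalIntegral.integral_mono_on hst iL ((iD.const_mul _).add (by simp)) hslice
    _ = P * (2 / h) * (∫ τ in s..t, ∫ x, D τ x) + (t - s) * (P * (54 * C ^ 2 / h * F / R)) := by
        rw [intervalIntegral.integral_add (iD.const_mul _) (by simp),
          intervalIntegral.integral_const_mul, intervalIntegral.integral_const, smul_eq_mul]
    _ ≤ P * (2 / h) * (3 * F + 3 * E * F / R) + (t - s) * (P * (54 * C ^ 2 / h * F / R)) := by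
        gcongr
    _ = _ := by
        rw [hF53, ← hh3, hP]
        ring

/-- The cutoff radius tends to infinity. Since the excess is nonincreasing, its time integral is at
least t - s times its final value. -/
lemma level_step (hv : IsSmoothVelocity T v) (hΓ : IsSmoothGammaSolution T q v Γ₀ Γ)
    (hq : 1 ≤ q) (hq' : q ≠ ⊤) {A k h s t : ℝ} (hA : 0 ≤ A) (hk : 0 < k) (hh : 0 < h) (hs : 0 < s)
    (hst : s ≤ t) (ht : t < T)
    (hA1 : ∀ y : ℝ, 1 ≤ y → y ≤ A * (rootProfile y ^ 2 * max y 0 ^ (2 / 3 : ℝ)))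
    (hA2 : ∀ g : Space3 → ℝ, ContDiff ℝ 1 g → HasCompactSupport g → ∀ U : Space3 → ℝ,
      (∀ x, 0 ≤ U x) → Integrable U →
      ∫ x, g x ^ 2 * U x ^ (2 / 3 : ℝ) ≤ A * (∫ x, gradSq g x) * (∫ x, U x) ^ (2 / 3 : ℝ)) :
    (t - s) * excess Γ (k + h) t ≤
      6 * A ^ 2 * h ^ (-(2 / 3) : ℝ) * excess Γ k s ^ (5 / 3 : ℝ) := by
  obtain ⟨E, hE⟩ := hΓ.integral_excess_cut_le hv hq hq' hA hk hh hs hst ht hA1 hA2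
  have hS := hΓ.slabSmooth
  have hsub : Icc s t ⊆ Ioo 0 T := fun τ hτ => ⟨hs.trans_le hτ.1, hτ.2.trans_lt ht⟩
  have hsub' : uIcc s t ⊆ Ioo 0 T := by rwa [uIcc_of_le hst]
  have hkh : 0 < k + h := by linarith
  have hint : ∀ τ ∈ Icc s t, Integrable fun x => max (Γ τ x - (k + h)) 0 := fun τ hτ =>
    hΓ.integrable_excess hq hq' hkh (Ioo_subset_Ico_self (hsub hτ))
  have hbd : ∀ (n : ℕ) τ x, ‖max (Γ τ x - (k + h)) 0 * cut ((n : ℝ) + 1) x ^ 2‖ ≤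
      max (Γ τ x - (k + h)) 0 := by
    intro n τ x
    have h0 : 0 ≤ max (Γ τ x - (k + h)) 0 := le_max_right _ _
    rw [Real.norm_of_nonneg (by positivity)]
    exact mul_le_of_le_one_right h0 (pow_le_one₀ (cut_nonneg x) (cut_le_one x))
  have cL : ∀ n : ℕ, SlabCont T fun τ x => max (Γ τ x - (k + h)) 0 * cut ((n : ℝ) + 1) x ^ 2 :=
    fun n => (hS.slabCont.comp (by fun_prop : Continuous fun y : ℝ => max (y - (k + h)) 0)).mul
      (SlabCont.of_space ((contDiff_cut (n := 0)).continuous.pow 2))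
  have hmono : AntitoneOn (fun τ => excess Γ (k + h) τ) (uIcc s t) := by
    rw [uIcc_of_le hst]
    intro a ha b hb hab
    exact hΓ.excess_antitone hv hq hq' hkh (hs.le.trans ha.1) hab (hb.2.trans_lt ht)
  have hlim : Tendsto (fun n : ℕ => ∫ τ in s..t, ∫ x, max (Γ τ x - (k + h)) 0 *
      cut ((n : ℝ) + 1) x ^ 2) atTop (𝓝 (∫ τ in s..t, excess Γ (k + h) τ)) := by
    refine intervalIntegral.tendsto_integral_filter_of_dominated_convergence
      (fun _ => excess Γ (k + h) s) (Eventually.of_forall fun n => ?_)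
      (Eventually.of_forall fun n => ?_) (by simp) ?_
    · have hKc : IsCompact (tsupport (cut ((n : ℝ) + 1))) := hasCompactSupport_cut (by positivity)
      rw [uIoc_of_le hst]
      refine (((cL n).continuousOn_integral hKc fun τ _ x hx => ?_).mono
        hsub').intervalIntegrable.1.aestronglyMeasurable
      simp [image_eq_zero_of_notMem_tsupport hx]
    · refine Eventually.of_forall fun τ hτ => ?_
      have hτ' : τ ∈ Icc s t := by rw [uIoc_of_le hst] at hτ; exact Ioc_subset_Icc_self hτ
      refine (norm_integral_le_of_norm_le (hint τ hτ') (Eventually.of_forall (hbd n τ))).trans ?_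
      exact hmono left_mem_uIcc (by rwa [uIcc_of_le hst]) hτ'.1
    · refine Eventually.of_forall fun τ hτ => ?_
      have hτ' : τ ∈ Icc s t := by rw [uIoc_of_le hst] at hτ; exact Ioc_subset_Icc_self hτ
      refine tendsto_integral_of_dominated_convergence (fun x => max (Γ τ x - (k + h)) 0)
        (fun n => ((cL n).slice (hsub hτ')).aestronglyMeasurable) (hint τ hτ')
        (fun n => Eventually.of_forall (hbd n τ)) (Eventually.of_forall fun x => ?_)
      have := ((tendsto_cut x).pow 2).const_mul (max (Γ τ x - (k + h)) 0)
      simpa using this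
  have hlim2 : Tendsto (fun n : ℕ => 6 * A ^ 2 * h ^ (-(2 / 3) : ℝ) *
      excess Γ k s ^ (5 / 3 : ℝ) + E / ((n : ℝ) + 1)) atTop
      (𝓝 (6 * A ^ 2 * h ^ (-(2 / 3) : ℝ) * excess Γ k s ^ (5 / 3 : ℝ) + 0)) := by
    refine tendsto_const_nhds.add ?_
    have := (tendsto_one_div_add_atTop_nhds_zero_nat (𝕜 := ℝ)).const_mul E
    simpa [div_eq_mul_inv] using this
  have hfin := le_of_tendsto_of_tendsto' hlim hlim2 fun n =>
    hE ((n : ℝ) + 1) (by linarith [(Nat.cast_nonneg n : (0 : ℝ) ≤ n)])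
  rw [add_zero] at hfin
  refine le_trans ?_ hfin
  have := intervalIntegral.integral_mono_on (f := fun _ => excess Γ (k + h) t) (μ := volume) hst
    (by simp) hmono.intervalIntegrable fun τ hτ =>
      hmono (by rwa [uIcc_of_le hst]) right_mem_uIcc hτ.2
  simpa using this

/-- Instantaneous smoothing: the supremum at a later time is controlled by the excess. -/
lemma exists_smoothing {s t : ℝ} (hs : 0 < s) (hst : s < t) : ∃ c : ℝ, 0 < c ∧
    ∀ {T : ℝ} {q : ℝ≥0∞} {v : ℝ → Space3 → Space3} {Γ₀ : Space3 → ℝ} {Γ : ℝ → Space3 → ℝ},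
    IsSmoothVelocity T v → IsSmoothGammaSolution T q v Γ₀ Γ → 1 ≤ q → q ≠ ⊤ → t < T →
    ∀ k h : ℝ, 0 < k → 0 < h → excess Γ k s ≤ c * h → ∀ x, Γ t x ≤ k + h := by
  obtain ⟨A₁, hA₁0, hA₁⟩ := exists_le_rootProfile
  obtain ⟨A₂, hA₂0, hA₂⟩ := exists_sobolev_holder
  set A := A₁ + A₂ with hA
  have hA0 : 0 < A := by linarith
  have hA1 : ∀ y : ℝ, 1 ≤ y → y ≤ A * (rootProfile y ^ 2 * max y 0 ^ (2 / 3 : ℝ)) :=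
    fun y hy => (hA₁ y hy).trans (by gcongr; linarith)
  have hA2 : ∀ g : Space3 → ℝ, ContDiff ℝ 1 g → HasCompactSupport g → ∀ U : Space3 → ℝ,
      (∀ x, 0 ≤ U x) → Integrable U →
      ∫ x, g x ^ 2 * U x ^ (2 / 3 : ℝ) ≤ A * (∫ x, gradSq g x) * (∫ x, U x) ^ (2 / 3 : ℝ) := by
    intro g hg hgc U hU hUi
    refine (hA₂ g hg hgc U hU hUi).trans ?_
    have h1 : 0 ≤ ∫ x, gradSq g x := integral_nonneg fun x => gradSq_nonneg g x
    have h2 : 0 ≤ ∫ x, U x := integral_nonneg hU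
    gcongr
    linarith
  set B : ℝ := 2 * (6 * A ^ 2) * (7 / 8 : ℝ) ^ (-(2 / 3) : ℝ) / (t - s) with hB
  have hts : 0 < t - s := by linarith
  have hB0 : 0 < B := by positivity
  -- Chosen so that E_k(s) ≤ c h gives B h^(-2/3) E_k(s)^(2/3) ≤ 1/64, the smallness condition of
  -- the iteration.
  refine ⟨(1 / (64 * B)) ^ (3 / 2 : ℝ), by positivity, ?_⟩
  intro T q v Γ₀ Γ hv hΓ hq hq' ht k h hk hh hsmall
  have hS := hΓ.slabSmooth
  have htI : t ∈ Ioo 0 T := ⟨hs.trans hst, ht⟩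
  have hzero : excess Γ (k + h) t = 0 := by
    refine eq_zero_of_de_giorgi (Φ := fun k t => excess Γ k t) (C := 6 * A ^ 2) (s := s)
      (by positivity) hk hh hs hst (fun k t => excess_nonneg Γ k t) ?_ ?_ ?_
    · intro k' τ hk' hkk hτ hτt
      refine (hΓ.excess_antitone hv hq hq' (by linarith) hτ.le hτt ht).trans ?_
      have hτ' : τ ∈ Ico 0 T := ⟨hτ.le, hτt.trans_lt ht⟩
      exact integral_mono (hΓ.integrable_excess hq hq' (by linarith) hτ')
        (hΓ.integrable_excess hq hq' hk' hτ') fun x => max_le_max (by linarith) le_rfl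
    · intro k' h' σ τ hk' hh' hσ hστ hτ
      exact hΓ.level_step hv hq hq' hA0.le hk' hh' hσ hστ.le (hτ.trans_lt ht) hA1 hA2
    · have h1 : excess Γ k s ^ (2 / 3 : ℝ) ≤ (1 / (64 * B)) * h ^ (2 / 3 : ℝ) := by
        refine (Real.rpow_le_rpow (excess_nonneg _ _ _) hsmall (by norm_num)).trans (le_of_eq ?_)
        rw [Real.mul_rpow (by positivity) hh.le, ← Real.rpow_mul (by positivity)]
        norm_num
      have h2 : h ^ (-(2 / 3) : ℝ) * h ^ (2 / 3 : ℝ) = 1 := by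
        rw [← Real.rpow_add hh]; norm_num
      calc _ = B * h ^ (-(2 / 3) : ℝ) * excess Γ k s ^ (2 / 3 : ℝ) := by
            rw [Real.mul_rpow (by norm_num) hh.le, hB]; ring
        _ ≤ B * h ^ (-(2 / 3) : ℝ) * ((1 / (64 * B)) * h ^ (2 / 3 : ℝ)) := by gcongr
        _ = (B * (1 / (64 * B))) * (h ^ (-(2 / 3) : ℝ) * h ^ (2 / 3 : ℝ)) := by ring
        _ = 1 / 64 := by rw [h2]; field_simp
        _ ≤ _ := le_rfl
  intro x
  -- The excess vanishes, so the bound holds almost everywhere, and by continuity everywhere.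
  have hc : Continuous fun x => max (Γ t x - (k + h)) 0 :=
    ((hS.slabCont.slice htI).sub continuous_const).max continuous_const
  have hae := (integral_eq_zero_iff_of_nonneg (fun x => le_max_right (Γ t x - (k + h)) 0)
    (hΓ.integrable_excess hq hq' (by linarith) (Ioo_subset_Ico_self htI))).1 hzero
  have h0 : max (Γ t x - (k + h)) 0 = 0 :=
    congrFun (hc.ae_eq_iff_eq volume continuous_const |>.1 hae) x
  linarith [le_max_left (Γ t x - (k + h)) 0]

end IsSmoothGammaSolution

/-! ### The strong maximum principle off the axis. -/

lemma partialD_comp_sub (i : Fin 3) (f : Space3 → ℝ) (c x : Space3) :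
    partialD i (fun y => f (y - c)) x = partialD i f (x - c) := by
  unfold partialD
  rw [fderiv_comp_sub]

lemma lap_comp_sub (f : Space3 → ℝ) (c x : Space3) :
    lap (fun y => f (y - c)) x = lap f (x - c) := by
  have h : ∀ i, (partialD i fun y => f (y - c)) = fun y => partialD i f (y - c) := fun i =>
    funext fun y => partialD_comp_sub i f c y
  simp only [lap, h]
  exact Finset.sum_congr rfl fun i _ => partialD_comp_sub i (partialD i f) c x

lemma lap_add {f g : Space3 → ℝ} (hf : ContDiff ℝ 2 f) (hg : ContDiff ℝ 2 g) (x : Space3) :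
    lap (fun y => f y + g y) x = lap f x + lap g x := by
  have hfd : Differentiable ℝ f := hf.differentiable (by simp)
  have hgd : Differentiable ℝ g := hg.differentiable (by simp)
  have h : ∀ i, (partialD i fun y => f y + g y) = fun y => partialD i f y + partialD i g y :=
    fun i => funext fun y => partialD_add i (hfd y) (hgd y)
  simp only [lap, h, ← Finset.sum_add_distrib]
  refine Finset.sum_congr rfl fun i _ => partialD_add i ?_ ?_
  · exact (hf.partialD (m := 1) (by norm_num) i).differentiable (by simp) x
  · exact (hg.partialD (m := 1) (by norm_num) i).differentiable (by simp) x

lemma hasDerivAt_line {f : Space3 → ℝ} (hf : Differentiable ℝ f) (i : Fin 3) (x : Space3) (h : ℝ) :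
    HasDerivAt (fun h : ℝ => f (x + h • EuclideanSpace.single i (1 : ℝ)))
      (partialD i f (x + h • EuclideanSpace.single i (1 : ℝ))) h := by
  have h1 : HasDerivAt (fun h : ℝ => x + h • EuclideanSpace.single i (1 : ℝ))
      (EuclideanSpace.single i (1 : ℝ)) h := by
    simpa using ((hasDerivAt_id h).smul_const (EuclideanSpace.single i (1 : ℝ))).const_add x
  exact (hf _).hasFDerivAt.comp_hasDerivAt h h1

/-- A positive second derivative would make the point a local minimum as well, so the function would
be locally constant and its second derivative zero. -/
lemma deriv_deriv_nonpos_of_isLocalMax {g : ℝ → ℝ} {a : ℝ} (hg : ContinuousAt g a)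
    (h : IsLocalMax g a) : deriv (deriv g) a ≤ 0 := by
  by_contra! hpos
  have hmin := isLocalMin_of_deriv_deriv_pos hpos h.deriv_eq_zero hg
  have heq : g =ᶠ[𝓝 a] fun _ => g a := by
    filter_upwards [h, hmin] with y h1 h2 using le_antisymm h1 h2
  have h0 : deriv (deriv g) a = 0 := by
    rw [(heq.deriv).deriv_eq]; simp
  exact hpos.ne' h0

lemma partialD_eq_zero_of_isLocalMax {f : Space3 → ℝ} {x : Space3} (h : IsLocalMax f x)
    (i : Fin 3) : partialD i f x = 0 := by
  simp [partialD, h.fderiv_eq_zero]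

lemma lap_nonpos_of_isLocalMax {f : Space3 → ℝ} (hf : ContDiff ℝ 2 f) {x : Space3}
    (h : IsLocalMax f x) : lap f x ≤ 0 := by
  refine Finset.sum_nonpos fun i _ => ?_
  have hd : Differentiable ℝ f := hf.differentiable (by simp)
  have hd1 : Differentiable ℝ (partialD i f) :=
    (hf.partialD (m := 1) (by norm_num) i).differentiable (by simp)
  set g : ℝ → ℝ := fun h => f (x + h • EuclideanSpace.single i (1 : ℝ)) with hg
  have hdg : deriv g = fun h => partialD i f (x + h • EuclideanSpace.single i (1 : ℝ)) :=
    funext fun h => (hasDerivAt_line hd i x h).deriv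
  have hddg : deriv (deriv g) 0 = partialD i (partialD i f) x := by
    rw [hdg, (hasDerivAt_line hd1 i x 0).deriv]; simp
  rw [← hddg]
  refine deriv_deriv_nonpos_of_isLocalMax (hasDerivAt_line hd i x 0).continuousAt ?_
  have hc : ContinuousAt (fun h : ℝ => x + h • EuclideanSpace.single i (1 : ℝ)) 0 := by fun_prop
  have h' : IsLocalMax f (x + (0 : ℝ) • EuclideanSpace.single i (1 : ℝ)) := by simpa using h
  exact IsLocalMax.comp_continuous (g := fun h : ℝ => x + h • EuclideanSpace.single i (1 : ℝ))
    (b := 0) h' hc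

lemma nonneg_of_hasDerivAt_of_le_left {g : ℝ → ℝ} {g' a : ℝ} (hg : HasDerivAt g g' a)
    (h : ∀ᶠ x in 𝓝[<] a, g x ≤ g a) : 0 ≤ g' := by
  have ht := (hasDerivWithinAt_iff_tendsto_slope' (s := Iio a) (self_notMem_Iio)).1
    (hg.hasDerivWithinAt (s := Iio a))
  refine ge_of_tendsto ht ?_
  filter_upwards [h, self_mem_nhdsWithin] with x hx hxa
  rw [slope_def_field]
  have : x < a := hxa
  exact div_nonneg_of_nonpos (by linarith) (by linarith)

lemma abs_sum_mul_le (a b : Space3) : |∑ i, a i * b i| ≤ 3 * (‖a‖ * ‖b‖) := by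
  have : ∀ i, |a i * b i| ≤ ‖a‖ * ‖b‖ := fun i => by
    rw [abs_mul]
    gcongr
    · exact PiLp.norm_apply_le a i
    · exact PiLp.norm_apply_le b i
  refine (Finset.abs_sum_le_sum_abs _ _).trans ?_
  rw [Fin.sum_univ_three]
  linarith [this 0, this 1, this 2]

lemma le_axisSq_add {m : ℝ} {p z : Space3} (hp : 4 * m ≤ axisSq p) (hz : axisSq z ≤ m) :
    m ≤ axisSq (p + z) := by
  have h4 : axisSq (p + z) = (p 0 + z 0) ^ 2 + (p 1 + z 1) ^ 2 := by simp [axisSq]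
  have h5 : axisSq p = p 0 ^ 2 + p 1 ^ 2 := rfl
  have h6 : axisSq z = z 0 ^ 2 + z 1 ^ 2 := rfl
  nlinarith [sq_nonneg (p 0 + 2 * z 0), sq_nonneg (p 1 + 2 * z 1)]

lemma radial_quot_le_one {m : ℝ} {x z : Space3} (hm : 0 < m) (hx : m ≤ axisSq x)
    (hz : axisSq z ≤ m) : (x 0 * z 0 + x 1 * z 1) / axisSq x ≤ 1 := by
  rw [div_le_one (hm.trans_le hx)]
  have h5 : axisSq x = x 0 ^ 2 + x 1 ^ 2 := rfl
  have h6 : axisSq z = z 0 ^ 2 + z 1 ^ 2 := rfl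
  nlinarith [sq_nonneg (x 0 - z 0), sq_nonneg (x 1 - z 1)]

/-- The arithmetic showing that the barrier is a strict subsolution. -/
lemma barrier_arith {A S K Λ ρ N Q1 Q2 Q3 : ℝ} (hA : 0 < A) (hS : 0 < S) (hρ : 0 < ρ)
    (hN : N = ρ ^ 2 - S) (hK : 6 * Q1 - 6 * Q2 + 12 * Q3 + 18 ≤ K - 24)
    (hΛ : 96 * ρ ^ 2 * Λ = K ^ 2 + 1)
    (h : 0 ≤ 2 * (6 * A * S ^ 2 * Q3) - 6 * A * S ^ 2 * Q2 +
      (18 * A * S ^ 2 - 24 * A * S * N) + (-Λ * A * S ^ 3 + 6 * A * S ^ 2 * Q1)) : False := by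
  have hineq : 0 ≤ A * S * (-Λ * S ^ 2 + S * (6 * Q1 - 6 * Q2 + 12 * Q3 + 18) - 24 * N) := by
    linarith
  have hineq2 := nonneg_of_mul_nonneg_right hineq (mul_pos hA hS)
  have h1 : S * (6 * Q1 - 6 * Q2 + 12 * Q3 + 18) ≤ S * (K - 24) := by gcongr
  have h2 : 0 ≤ -Λ * S ^ 2 + K * S - 24 * ρ ^ 2 := by rw [hN] at hineq2; linarith
  have h3 : 0 ≤ 96 * ρ ^ 2 * (-Λ * S ^ 2 + K * S - 24 * ρ ^ 2) := by positivity
  -- The relation 96 ρ² Λ = K² + 1 gives the quadratic -Λ S² + K S - 24 ρ² discriminant -1;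
  -- completing the square shows that it is negative.
  have h4 : 96 * ρ ^ 2 * (-Λ * S ^ 2 + K * S - 24 * ρ ^ 2) =
      -(K * S - 48 * ρ ^ 2) ^ 2 - S ^ 2 := by linear_combination (-S ^ 2) * hΛ
  nlinarith [sq_nonneg (K * S - 48 * ρ ^ 2), pow_pos hS 2]

namespace IsSmoothGammaSolution

variable {T : ℝ} {q : ℝ≥0∞} {v : ℝ → Space3 → Space3} {Γ₀ : Space3 → ℝ} {Γ : ℝ → Space3 → ℝ}

lemma residual_eq_of_pos (hΓ : IsSmoothGammaSolution T q v Γ₀ Γ) {t : ℝ} (ht : t ∈ Ioo 0 T)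
    {x : Space3} (hx : 0 < axisSq x) :
    deriv (fun s => Γ s x) t + advect (v t) (Γ t) x - lap (Γ t) x =
      2 * ((x 0 * partialD 0 (Γ t) x + x 1 * partialD 1 (Γ t) x) / axisSq x) := by
  have := hΓ.radial_eq ht x
  rw [axisResidual] at this
  rw [this]
  field_simp

set_option maxHeartbeats 800000 in
/-- Strict inequality propagates along segments that stay away from the axis. -/
lemma lt_of_lt_segment (hv : IsSmoothVelocity T v) (hΓ : IsSmoothGammaSolution T q v Γ₀ Γ)
    {M m s t : ℝ} (hs : 0 < s) (hst : s < t) (ht : t < T)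
    (hM : ∀ τ ∈ Icc s t, ∀ x, Γ τ x ≤ M) {y e : Space3} (hm : 0 < m)
    (hline : ∀ σ ∈ Icc (0 : ℝ) 1, 4 * m ≤ axisSq (y + σ • e)) (hy : Γ s y < M) :
    Γ t (y + e) < M := by
  have hS := hΓ.slabSmooth
  have hsub : Icc s t ⊆ Ioo 0 T := fun τ hτ => ⟨hs.trans_le hτ.1, hτ.2.trans_lt ht⟩
  have hsI : s ∈ Icc s t := ⟨le_rfl, hst.le⟩
  have htI : t ∈ Icc s t := ⟨hst.le, le_rfl⟩
  -- a small ball around `y` on which `Γ s` stays below `M`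
  obtain ⟨ε₀, hε₀, ρ, hρ, hρm, hball⟩ : ∃ ε₀ : ℝ, 0 < ε₀ ∧ ∃ ρ : ℝ, 0 < ρ ∧ ρ ^ 2 ≤ m ∧
      ∀ z : Space3, ‖z‖ ≤ ρ → Γ s (y + z) ≤ M - ε₀ := by
    refine ⟨(M - Γ s y) / 2, by linarith, ?_⟩
    have hc : Continuous (Γ s) := hS.slabCont.slice (hsub hsI)
    have hev : ∀ᶠ x in 𝓝 y, Γ s x < M - (M - Γ s y) / 2 :=
      hc.continuousAt.eventually (gt_mem_nhds (by linarith))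
    obtain ⟨r, hr, hb⟩ := Metric.eventually_nhds_iff.1 hev
    -- Half of r turns the open ball into a closed one, and √m keeps the moving ball at positive
    -- distance from the axis.
    refine ⟨min (r / 2) (√m), lt_min (by linarith) (Real.sqrt_pos.2 hm), ?_, fun z hz => ?_⟩
    · calc min (r / 2) (√m) ^ 2 ≤ √m ^ 2 := by
            have : 0 ≤ min (r / 2) (√m) := le_min (by linarith) (Real.sqrt_nonneg m)
            gcongr; exact min_le_right _ _
        _ = m := Real.sq_sqrt hm.le
    · have : ‖z‖ ≤ r / 2 := hz.trans (min_le_left _ _)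
      exact (hb (by rw [dist_eq_norm]; simp; linarith)).le
  obtain ⟨Cv, hCv⟩ := hv.bounded s t hs ht
  have hCv0 : 0 ≤ Cv := (norm_nonneg _).trans (hCv s hsI 0)
  set L := t - s with hL
  have hL0 : 0 < L := by simp [hL, hst]
  -- The terms come from the motion of the centre, from v, and from 18 + 12 + 24 = 54: the Laplacian
  -- of the barrier, the singular drift, and the 24 S created by writing |z|² = ρ² - S.
  set K : ℝ := 18 * ρ * (‖e‖ / L) + 18 * ρ * Cv + 54 with hK
  set Λ : ℝ := (K ^ 2 + 1) / (96 * ρ ^ 2) with hΛ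
  -- At the initial time the barrier is at most ε ρ⁶ = ε₀, the available gap below M.
  set ε : ℝ := ε₀ / ρ ^ 6 with hε
  have hε0 : 0 < ε := by positivity
  set c : ℝ → Space3 := fun τ => y + ((τ - s) / L) • e with hc
  have hcc : Continuous c := by fun_prop
  set A : ℝ → ℝ := fun τ => ε * Real.exp (-Λ * (τ - s)) with hA
  have hA0 : ∀ τ, 0 < A τ := fun τ => by positivity
  -- The barrier sits on a ball whose centre moves uniformly from y to y + e. With S = ρ² - |z|²,
  -- near the sphere the Laplacian of its cube contributes a positive term of order S while the
  -- other terms are of order S²; near the centre the decay in time, of order Λ S³, dominates.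
  set G : ℝ → Space3 → ℝ := fun τ x => Γ τ x + A τ * (ρ ^ 2 - normSq3 (x - c τ)) ^ 3 with hG
  suffices hmain : ∀ τ ∈ Icc s t, ∀ z : Space3, ‖z‖ ≤ ρ → G τ (c τ + z) ≤ M by
    have h := hmain t htI 0 (by simpa using hρ.le)
    have e1 : c t + 0 = y + e := by
      simp only [hc, add_zero]; rw [show (t - s) / L = 1 by rw [← hL]; field_simp, one_smul]
    rw [e1] at h
    have e2 : G t (y + e) = Γ t (y + e) + A t * (ρ ^ 2) ^ 3 := by
      simp only [hG]
      rw [← e1]; simp [normSq3]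
    have := hA0 t
    have : 0 < A t * (ρ ^ 2) ^ 3 := by positivity
    linarith
  have hcompact : IsCompact (Icc s t ×ˢ Metric.closedBall (0 : Space3) ρ) :=
    isCompact_Icc.prod (isCompact_closedBall _ _)
  have hcont : ContinuousOn (fun p : ℝ × Space3 => G p.1 (c p.1 + p.2))
      (Icc s t ×ˢ Metric.closedBall (0 : Space3) ρ) := by
    have h1 : ContinuousOn (fun p : ℝ × Space3 => Γ p.1 (c p.1 + p.2))
        (Icc s t ×ˢ Metric.closedBall (0 : Space3) ρ) := by
      have hm : ContinuousOn (fun p : ℝ × Space3 => (p.1, c p.1 + p.2))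
        (Icc s t ×ˢ Metric.closedBall (0 : Space3) ρ) := by fun_prop
      exact ContinuousOn.comp hS.slabCont hm fun p hp => ⟨hsub hp.1, mem_univ _⟩
    refine h1.add (Continuous.continuousOn ?_)
    have : Continuous normSq3 := (contDiff_normSq3 (n := 0)).continuous
    simp only [hA]
    fun_prop
  obtain ⟨⟨τ₀, z₀⟩, ⟨hτ₀, hz₀⟩, hmax⟩ := hcompact.exists_isMaxOn
    ⟨(s, 0), hsI, by simpa using hρ.le⟩ hcont
  simp only at hτ₀ hz₀
  have hz₀' : ‖z₀‖ ≤ ρ := by simpa using hz₀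
  by_contra! hcontra
  obtain ⟨τ₁, hτ₁, z₁, hz₁, hbig⟩ := hcontra
  set x₀ := c τ₀ + z₀ with hx₀
  have hmax' : ∀ τ ∈ Icc s t, ∀ x, ‖x - c τ‖ ≤ ρ → G τ x ≤ G τ₀ x₀ := by
    intro τ hτ x hx
    have := hmax (show (τ, x - c τ) ∈ _ from ⟨hτ, by simpa using hx⟩)
    simpa using this
  have hGM : M < G τ₀ x₀ := hbig.trans_le (hmax' τ₁ hτ₁ _ (by simpa using hz₁))
  have ez : x₀ - c τ₀ = z₀ := by simp [hx₀]
  have hGx₀ : G τ₀ x₀ = Γ τ₀ x₀ + A τ₀ * (ρ ^ 2 - normSq3 z₀) ^ 3 := by simp only [hG, ez]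
  set S := ρ ^ 2 - normSq3 z₀ with hSdef
  -- On the boundary sphere the barrier vanishes and Γ ≤ M, so a maximum exceeding M is interior.
  have hS0 : 0 < S := by
    rw [hSdef, normSq3_eq]
    by_contra! hle
    have hzle : ‖z₀‖ ^ 2 ≤ ρ ^ 2 := by gcongr
    have : ρ ^ 2 - ‖z₀‖ ^ 2 = 0 := by linarith
    rw [hGx₀, hSdef, normSq3_eq, this] at hGM
    have := hM τ₀ hτ₀ x₀
    norm_num at hGM
    linarith
  have hzρ : ‖z₀‖ < ρ := by
    rw [hSdef, normSq3_eq] at hS0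
    exact lt_of_pow_lt_pow_left₀ 2 hρ.le (by linarith)
  -- At the initial time the barrier just fills the gap ε₀, so a maximum exceeding M occurs later
  -- and one-sided time differentiation applies.
  have hne : s < τ₀ := by
    refine lt_of_le_of_ne hτ₀.1 fun heq => ?_
    have hAs : A s = ε := by simp [hA]
    have hcs : c s = y := by simp [hc]
    rw [hGx₀, hx₀, ← heq, hcs, hAs] at hGM
    have h1 := hball z₀ hz₀'
    have h2 : ε * S ^ 3 ≤ ε * (ρ ^ 2) ^ 3 := by
      gcongr
      have := normSq3_nonneg z₀
      linarith
    have h3 : ε * (ρ ^ 2) ^ 3 = ε₀ := by rw [hε]; field_simp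
    linarith
  have hτ₀' := hsub hτ₀
  -- spatial conditions at the maximum
  have hΓ2 : ContDiff ℝ 2 (Γ τ₀) := (hS.slice hτ₀').of_le two_le_infty
  set f : ℝ → ℝ := fun a => A τ₀ * (ρ ^ 2 - a) ^ 3 with hf
  have hf1 : ∀ a, HasDerivAt f (-3 * A τ₀ * (ρ ^ 2 - a) ^ 2) a := fun a => by
    refine ((((hasDerivAt_id a).const_sub (ρ ^ 2)).pow 3).const_mul (A τ₀)).congr_deriv ?_
    simp; ring
  have hf2 : ∀ a, HasDerivAt (fun a => -3 * A τ₀ * (ρ ^ 2 - a) ^ 2)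
      (6 * A τ₀ * (ρ ^ 2 - a)) a := fun a => by
    refine ((((hasDerivAt_id a).const_sub (ρ ^ 2)).pow 2).const_mul (-3 * A τ₀)).congr_deriv ?_
    simp; ring
  have hfc : ContDiff ℝ 2 f := by simp only [hf]; fun_prop
  set w : Space3 → ℝ := fun x => f (normSq3 (x - c τ₀)) with hw
  have hw2 : ContDiff ℝ 2 w := by
    have : ContDiff ℝ 2 normSq3 := contDiff_normSq3
    exact hfc.comp (this.comp (contDiff_id.sub contDiff_const))
  have hGw : G τ₀ = fun x => Γ τ₀ x + w x := rfl
  have hloc : IsLocalMax (G τ₀) x₀ := by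
    have : ∀ᶠ x in 𝓝 x₀, ‖x - c τ₀‖ < ρ :=
      (by fun_prop : Continuous fun x => ‖x - c τ₀‖).continuousAt.eventually
        (gt_mem_nhds (by dsimp only; rwa [ez]))
    filter_upwards [this] with x hx using hmax' τ₀ hτ₀ x hx.le
  have hpw : ∀ i, partialD i w x₀ = -6 * A τ₀ * S ^ 2 * z₀ i := fun i => by
    rw [hw, partialD_comp_sub i (fun x => f (normSq3 x)), ez, partialD_comp_normSq3 hf1]
    ring
  have hlw : lap w x₀ = 24 * A τ₀ * S * normSq3 z₀ - 18 * A τ₀ * S ^ 2 := by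
    rw [hw, lap_comp_sub (fun x => f (normSq3 x)), ez, lap_comp_normSq3 hf1 hf2]
    ring
  have hd : ∀ i, partialD i (Γ τ₀) x₀ = 6 * A τ₀ * S ^ 2 * z₀ i := fun i => by
    have h := partialD_eq_zero_of_isLocalMax hloc i
    rw [hGw, partialD_add i (hΓ2.differentiable (by simp) x₀) (hw2.differentiable (by simp) x₀),
      hpw] at h
    linarith
  have hl : lap (Γ τ₀) x₀ ≤ 18 * A τ₀ * S ^ 2 - 24 * A τ₀ * S * normSq3 z₀ := by
    have h := lap_nonpos_of_isLocalMax (by rw [hGw]; exact hΓ2.add hw2) hloc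
    rw [hGw, lap_add hΓ2 hw2, hlw] at h
    linarith
  -- the time derivative
  have hderc : ∀ i, HasDerivAt (fun τ => (x₀ - c τ) i) (-(e i / L)) τ₀ := fun i => by
    have : (fun τ => (x₀ - c τ) i) = fun τ => x₀ i - (y i + (τ - s) / L * e i) := by
      funext τ; simp [hc]
    rw [this]
    refine ((((((hasDerivAt_id τ₀).sub_const s).div_const L).mul_const (e i)).const_add
      (y i)).const_sub (x₀ i)).congr_deriv ?_
    ring
  have hdN : HasDerivAt (fun τ => normSq3 (x₀ - c τ)) (-2 * (∑ i, z₀ i * (e i / L))) τ₀ := by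
    have h := (((hderc 0).pow 2).add ((hderc 1).pow 2)).add ((hderc 2).pow 2)
    rw [ez] at h
    refine h.congr_deriv ?_
    simp [Fin.sum_univ_three]; ring
  have hdA : HasDerivAt A (-Λ * A τ₀) τ₀ := by
    have h := ((((hasDerivAt_id τ₀).sub_const s).const_mul (-Λ)).exp).const_mul ε
    refine h.congr_deriv ?_
    simp [hA]; ring
  have hdw : HasDerivAt (fun τ => A τ * (ρ ^ 2 - normSq3 (x₀ - c τ)) ^ 3)
      (-Λ * A τ₀ * S ^ 3 + 6 * A τ₀ * S ^ 2 * ∑ i, z₀ i * (e i / L)) τ₀ := by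
    have h := hdA.fun_mul ((hdN.const_sub (ρ ^ 2)).fun_pow 3)
    rw [ez, ← hSdef] at h
    refine h.congr_deriv ?_
    norm_num; ring
  have hdt : 0 ≤ deriv (fun τ => Γ τ x₀) τ₀ +
      (-Λ * A τ₀ * S ^ 3 + 6 * A τ₀ * S ^ 2 * ∑ i, z₀ i * (e i / L)) := by
    refine nonneg_of_hasDerivAt_of_le_left (g := fun τ => G τ x₀) (a := τ₀)
      ((hS.hasDerivAt hτ₀' x₀).add hdw) ?_
    have h1 : ∀ᶠ τ in 𝓝[<] τ₀, ‖x₀ - c τ‖ < ρ :=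
      nhdsWithin_le_nhds ((by fun_prop : Continuous fun τ => ‖x₀ - c τ‖).continuousAt.eventually
        (gt_mem_nhds (by dsimp only; rwa [ez])))
    filter_upwards [h1, Ioo_mem_nhdsLT hne] with τ hτ hτ'
    exact hmax' τ ⟨hτ'.1.le, hτ'.2.le.trans hτ₀.2⟩ x₀ hτ.le
  have hz₀m : axisSq z₀ ≤ m := (axisSq_le_normSq3 z₀).trans (by linarith)
  have hax : m ≤ axisSq x₀ := le_axisSq_add (hline ((τ₀ - s) / L) ⟨div_nonneg (by linarith) hL0.le,
    (div_le_one hL0).2 (by linarith [hτ₀.2])⟩) hz₀m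
  have heq := hΓ.residual_eq_of_pos hτ₀' (hm.trans_le hax)
  have hadv : advect (v τ₀) (Γ τ₀) x₀ = 6 * A τ₀ * S ^ 2 * ∑ i, v τ₀ x₀ i * z₀ i := by
    simp only [advect, hd, Fin.sum_univ_three]; ring
  have hrad : (x₀ 0 * partialD 0 (Γ τ₀) x₀ + x₀ 1 * partialD 1 (Γ τ₀) x₀) / axisSq x₀ =
      6 * A τ₀ * S ^ 2 * ((x₀ 0 * z₀ 0 + x₀ 1 * z₀ 1) / axisSq x₀) := by
    rw [hd, hd]; ring
  rw [hadv, hrad] at heq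
  have hQ1 : ∑ i, z₀ i * (e i / L) ≤ 3 * (ρ * (‖e‖ / L)) := by
    have h1 : ∑ i, z₀ i * (e i / L) = (∑ i, z₀ i * e i) / L := by
      rw [Finset.sum_div]; exact Finset.sum_congr rfl fun i _ => by ring
    have h2 : ‖z₀‖ * ‖e‖ ≤ ρ * ‖e‖ := by gcongr
    rw [h1, ← mul_div_assoc, ← mul_div_assoc]
    gcongr
    linarith [(abs_le.1 (abs_sum_mul_le z₀ e)).2]
  have hQ2 : -(3 * (Cv * ρ)) ≤ ∑ i, v τ₀ x₀ i * z₀ i := by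
    have h2 : ‖v τ₀ x₀‖ * ‖z₀‖ ≤ Cv * ρ := by
      gcongr
      exact hCv τ₀ hτ₀ x₀
    linarith [(abs_le.1 (abs_sum_mul_le (v τ₀ x₀) z₀)).1]
  -- The conditions on gradient, Laplacian and time derivative at the maximum contradict the
  -- equation at that point.
  refine barrier_arith (hA0 τ₀) hS0 hρ (N := normSq3 z₀) (K := K) (Λ := Λ)
    (Q1 := ∑ i, z₀ i * (e i / L)) (Q2 := ∑ i, v τ₀ x₀ i * z₀ i)
    (Q3 := (x₀ 0 * z₀ 0 + x₀ 1 * z₀ 1) / axisSq x₀) (by rw [hSdef]; ring) ?_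
    (by rw [hΛ]; field_simp) (by linarith)
  have := radial_quot_le_one hm hax hz₀m
  rw [hK]
  linarith

/-- The strong maximum principle off the axis. -/
lemma lt_of_exists_lt (hv : IsSmoothVelocity T v) (hΓ : IsSmoothGammaSolution T q v Γ₀ Γ)
    {M s t : ℝ} (hs : 0 < s) (hst : s < t) (ht : t < T)
    (hM : ∀ τ ∈ Icc s t, ∀ x, Γ τ x ≤ M) {x y : Space3} (hx : 0 < axisSq x) (hy : 0 < axisSq y)
    (hlt : Γ s y < M) : Γ t x < M := by
  set μ : ℝ := √(axisSq y / axisSq x) with hμ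
  have hμ0 : 0 < μ := Real.sqrt_pos.2 (by positivity)
  have hμ2 : μ ^ 2 = axisSq y / axisSq x := Real.sq_sqrt (by positivity)
  -- The rotation of y about the axis into the half-plane of x. Axisymmetry gives Γ(s) the same
  -- value there, and along the segment from y' to x the distance to the axis interpolates linearly
  -- between two positive numbers.
  set y' : Space3 := !₂[μ * x 0, μ * x 1, y 2] with hy'
  have h0 : y' 0 = μ * x 0 := rfl
  have h1 : y' 1 = μ * x 1 := rfl
  have h2 : y' 2 = y 2 := rfl
  have hsT : s ∈ Ioo 0 T := ⟨hs, hst.trans ht⟩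
  have hlt' : Γ s y' < M := by
    rw [hΓ.axisymmetric s hsT y' y ?_ h2]
    · exact hlt
    · have : axisSq y' = axisSq y := by
        have : axisSq y' = μ ^ 2 * axisSq x := by simp only [axisSq, h0, h1]; ring
        rw [this, hμ2]; field_simp
      exact congrArg Real.sqrt this
  have hmin : 0 < min μ 1 := lt_min hμ0 one_pos
  have h := hΓ.lt_of_lt_segment hv hs hst ht hM (y := y') (e := x - y')
    (m := min μ 1 ^ 2 * axisSq x / 4) (by positivity) (fun σ hσ => ?_) hlt'
  · simpa using h
  · have e : axisSq (y' + σ • (x - y')) = (μ + σ * (1 - μ)) ^ 2 * axisSq x := by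
      simp only [axisSq, PiLp.add_apply, PiLp.smul_apply, PiLp.sub_apply, h0, h1, smul_eq_mul]
      ring
    rw [e]
    have : min μ 1 ≤ μ + σ * (1 - μ) := by
      have a1 := min_le_left μ 1
      have a2 := min_le_right μ 1
      nlinarith [hσ.1, hσ.2]
    have h3 : min μ 1 ^ 2 ≤ (μ + σ * (1 - μ)) ^ 2 := by gcongr
    nlinarith

end IsSmoothGammaSolution

/-! ### A Carleman estimate for weighted parabolic operators. -/

/-- The weighted Laplacian `∑ ∂ᵢ (ρ ∂ᵢ f)`. -/
def divGrad (ρ f : Space3 → ℝ) (x : Space3) : ℝ :=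
  ∑ i, partialD i (fun y => ρ y * partialD i f y) x

lemma continuous_divGrad {ρ f : Space3 → ℝ} (hρ : ContDiff ℝ 1 ρ) (hf : ContDiff ℝ 2 f) :
    Continuous (divGrad ρ f) := by
  have h : ∀ i, Continuous (partialD i fun y => ρ y * partialD i f y) := fun i =>
    ((hρ.mul (hf.partialD (m := 1) (by norm_num) i)).partialD (m := 0) (by simp) i).continuous
  unfold divGrad
  exact continuous_finsetSum _ fun i _ => h i

lemma divGrad_eq_zero_of_notMem {ρ f : Space3 → ℝ} {x : Space3} (hx : x ∉ tsupport f) :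
    divGrad ρ f x = 0 :=
  Finset.sum_eq_zero fun i _ => partialD_eq_zero_of_notMem (fun h => hx
    (tsupport_partialD_subset f i (closure_mono (Function.support_mul_subset_right _ _) h))) i

lemma integral_divGrad {ρ f h : Space3 → ℝ} (hρ : ContDiff ℝ 1 ρ) (hh : ContDiff ℝ 1 h)
    (hf : ContDiff ℝ 2 f) (hc : HasCompactSupport f) :
    ∫ x, (ρ x * (∑ i, partialD i h x * partialD i f x) + h x * divGrad ρ f x) = 0 := by
  have hfi : ∀ i, ContDiff ℝ 1 (partialD i f) := fun i => hf.partialD (m := 1) (by norm_num) i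
  have hF : ∀ i, ContDiff ℝ 1 fun y => h y * (ρ y * partialD i f y) := fun i =>
    hh.mul (hρ.mul (hfi i))
  have hFc : ∀ i, HasCompactSupport fun y => h y * (ρ y * partialD i f y) := fun i =>
    ((hc.partialD i).mul_left (f := ρ)).mul_left (f := h)
  have e : ∀ x, ρ x * (∑ i, partialD i h x * partialD i f x) + h x * divGrad ρ f x =
      ∑ i, partialD i (fun y => h y * (ρ y * partialD i f y)) x := by
    intro x
    have h1 : ∀ i, partialD i (fun y => h y * (ρ y * partialD i f y)) x =
        h x * partialD i (fun y => ρ y * partialD i f y) x +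
          partialD i h x * (ρ x * partialD i f x) := fun i =>
      partialD_mul i (hh.differentiable (by simp) x)
        ((hρ.mul (hfi i)).differentiable (by simp) x)
    simp only [h1, divGrad, Fin.sum_univ_three]
    ring
  simp only [e]
  rw [integral_finsetSum _ fun i _ => (((hF i).partialD (m := 0) (by simp)
    i).continuous).integrable_of_hasCompactSupport ((hFc i).partialD i)]
  exact Finset.sum_eq_zero fun i _ => integral_partialD_eq_zero (hF i) (hFc i) i

/-- The pointwise inequality behind the Carleman estimate: w is the spatial weight, a = ∂ₜf, p the
weighted Laplacian of f, β the drift term, g the source, G = |∇f|² and S = ∇∂ₜf·∇f. The two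
subtracted brackets integrate to zero. Inserting the equation for p cancels all products f a; the
remainder follows from 2a(β + g) - 2a² ≤ β² + g² and Young's inequality, the gradient terms
balancing exactly. -/
lemma carleman_arith {w a p f φ₁ φ₂ β g B G S H : ℝ} (hw : 0 ≤ w)
    (heq : w * a = w * φ₁ * f + p + w * (β + g)) (hβ : β ^ 2 ≤ B ^ 2 * G) (hG : 0 ≤ G)
    (hg : w * g ^ 2 ≤ H) (hφ : B ^ 2 * (2 * φ₁ + B ^ 2 + 1) + 1 ≤ φ₂) :
    (w * (2 * S) + ((B ^ 2 - φ₁) * (w * (2 * f * a)) - φ₂ * (w * f ^ 2))) -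
      2 * (w * S + a * p) - 2 * B ^ 2 * (w * G + f * p) ≤ (1 + B ^ 2) * H - w * f ^ 2 := by
  have hp : p = w * a - w * φ₁ * f - w * (β + g) := by linarith only [heq]
  have h1 : 2 * f * β ≤ B ^ 2 * f ^ 2 + G := by
    refine (le_abs_self _).trans (abs_le_of_sq_le_sq ?_ (by positivity))
    nlinarith [sq_nonneg (B ^ 2 * f ^ 2 - G), mul_le_mul_of_nonneg_left hβ (sq_nonneg f)]
  have h2 : 2 * f * g ≤ f ^ 2 + g ^ 2 := by nlinarith [sq_nonneg (f - g)]
  have h3 : 2 * a * (β + g) - 2 * a ^ 2 ≤ B ^ 2 * G + g ^ 2 := by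
    nlinarith [sq_nonneg (2 * a - (β + g)), sq_nonneg (β - g)]
  have h4 : B ^ 2 * (2 * f * β + 2 * f * g) ≤ B ^ 2 * (B ^ 2 * f ^ 2 + G + (f ^ 2 + g ^ 2)) := by
    gcongr
  have h5 : (B ^ 2 * (2 * φ₁ + B ^ 2 + 1) + 1) * f ^ 2 ≤ φ₂ * f ^ 2 := by gcongr
  have h6 : 2 * a * (β + g) - 2 * a ^ 2 + 2 * B ^ 2 * φ₁ * f ^ 2 +
      B ^ 2 * (2 * f * β + 2 * f * g) - 2 * B ^ 2 * G - φ₂ * f ^ 2 ≤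
      (1 + B ^ 2) * g ^ 2 - f ^ 2 := by linarith
  have h7 := mul_le_mul_of_nonneg_left h6 hw
  have h8 : (1 + B ^ 2) * (w * g ^ 2) ≤ (1 + B ^ 2) * H := by gcongr
  rw [hp]
  linarith

lemma SlabCont.of_time {T : ℝ} {c : ℝ → ℝ} (hc : Continuous c) : SlabCont T fun t _ => c t :=
  (hc.comp continuous_fst).continuousOn

/-- The `L²` Carleman estimate in integrated form. -/
lemma carleman_estimate {T B s t : ℝ} {ρ : Space3 → ℝ} {f H : ℝ → Space3 → ℝ} {φ₁ φ₂ : ℝ → ℝ}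
    (hρ : ContDiff ℝ 1 ρ) (hρ0 : ∀ x, 0 ≤ ρ x) (hf : SlabSmooth T f) (hH : SlabCont T H)
    {K : Set Space3} (hK : IsCompact K) (hfK : ∀ τ ∈ Ioo 0 T, ∀ x ∉ K, f τ x = 0)
    (hHK : ∀ τ ∈ Ioo 0 T, ∀ x ∉ K, H τ x = 0) (hφ : ∀ τ, HasDerivAt φ₁ (φ₂ τ) τ)
    (hφ₂ : Continuous φ₂) (hs : 0 < s) (hst : s ≤ t) (ht : t < T) (hfs : ∀ x, f s x = 0)
    (hft : ∀ x, f t x = 0)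
    (hconv : ∀ τ ∈ Icc s t, B ^ 2 * (2 * φ₁ τ + B ^ 2 + 1) + 1 ≤ φ₂ τ)
    (heq : ∀ τ ∈ Icc s t, ∀ x, ∃ β g : ℝ, ρ x * deriv (fun σ => f σ x) τ =
      ρ x * φ₁ τ * f τ x + divGrad ρ (f τ) x + ρ x * (β + g) ∧
      β ^ 2 ≤ B ^ 2 * gradSq (f τ) x ∧ ρ x * g ^ 2 ≤ H τ x) :
    ∫ τ in s..t, ∫ x, ρ x * f τ x ^ 2 ≤ (1 + B ^ 2) * ∫ τ in s..t, ∫ x, H τ x := by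
  have hsub : Icc s t ⊆ Ioo 0 T := fun τ hτ => ⟨hs.trans_le hτ.1, hτ.2.trans_lt ht⟩
  have hsub' : uIcc s t ⊆ Ioo 0 T := by rwa [uIcc_of_le hst]
  have hφ₁ : Continuous φ₁ := continuous_iff_continuousAt.2 fun τ => (hφ τ).continuousAt
  have hsupp : ∀ τ ∈ Ioo 0 T, tsupport (f τ) ⊆ K := fun τ hτ =>
    closure_minimal (fun x hx => by
      by_contra h
      exact hx (hfK τ hτ x h)) hK.isClosed
  have hcs : ∀ τ ∈ Ioo 0 T, HasCompactSupport (f τ) := fun τ hτ =>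
    hK.of_isClosed_subset (isClosed_tsupport _) (hsupp τ hτ)
  set ft : ℝ → Space3 → ℝ := fun τ x => deriv (fun σ => f σ x) τ with hft'
  have hftS : SlabSmooth T ft := hf.timeDeriv
  -- The coefficient B² - φ₁ is the one for which the products f ∂ₜf cancel in the time derivative.
  -- G vanishes at both end times with f.
  set G : ℝ → Space3 → ℝ := fun τ x =>
    ρ x * gradSq (f τ) x + (B ^ 2 - φ₁ τ) * (ρ x * f τ x ^ 2) with hG
  set G' : ℝ → Space3 → ℝ := fun τ x =>
    ρ x * (2 * ∑ i, partialD i (ft τ) x * partialD i (f τ) x) +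
      ((B ^ 2 - φ₁ τ) * (ρ x * (2 * f τ x * ft τ x)) - φ₂ τ * (ρ x * f τ x ^ 2)) with hG'
  have cρ : SlabCont T fun _ x => ρ x := SlabCont.of_space hρ.continuous
  have cf2 : SlabCont T fun τ x => ρ x * f τ x ^ 2 :=
    cρ.mul (hf.slabCont.comp (by fun_prop : Continuous fun y : ℝ => y ^ 2))
  have cφ : SlabCont T fun τ _ => B ^ 2 - φ₁ τ := SlabCont.of_time (by fun_prop)
  have cG : SlabCont T G := (cρ.mul hf.slabCont_gradSq).add (cφ.mul cf2)
  have cG' : SlabCont T G' := by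
    refine (cρ.mul ?_).add ((cφ.mul (cρ.mul ?_)).sub ((SlabCont.of_time hφ₂).mul cf2))
    · exact (SlabCont.of_time continuous_const).mul
        (SlabCont.sum fun i => (hftS.partialD i).slabCont.mul (hf.partialD i).slabCont)
    · exact ((SlabCont.of_time continuous_const).mul hf.slabCont).mul hftS.slabCont
  have hgrad0 : ∀ τ ∈ Ioo 0 T, ∀ x ∉ K, ∀ i, partialD i (f τ) x = 0 := fun τ hτ x hx i =>
    partialD_eq_zero_of_notMem (fun h => hx (hsupp τ hτ h)) i
  have zG : ∀ τ ∈ Ioo 0 T, ∀ x ∉ K, G τ x = 0 := fun τ hτ x hx => by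
    simp [hG, gradSq, hgrad0 τ hτ x hx, hfK τ hτ x hx]
  have zG' : ∀ τ ∈ Ioo 0 T, ∀ x ∉ K, G' τ x = 0 := fun τ hτ x hx => by
    simp [hG', hgrad0 τ hτ x hx, hfK τ hτ x hx]
  have dG : ∀ τ ∈ Ioo 0 T, ∀ x, HasDerivAt (fun σ => G σ x) (G' τ x) τ := by
    intro τ hτ x
    have h1 : ∀ i, HasDerivAt (fun σ => partialD i (f σ) x ^ 2)
        (2 * (partialD i (ft τ) x * partialD i (f τ) x)) τ := fun i => by
      have h := ((hf.partialD i).hasDerivAt hτ x).fun_pow 2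
      rw [hf.deriv_partialD hτ x i] at h
      refine h.congr_deriv ?_
      norm_num [hft']; ring
    have h2 : HasDerivAt (fun σ => gradSq (f σ) x)
        (2 * ∑ i, partialD i (ft τ) x * partialD i (f τ) x) τ := by
      have h := HasDerivAt.fun_sum (u := Finset.univ) fun i _ => h1 i
      rw [← Finset.mul_sum] at h
      exact h
    have h3 : HasDerivAt (fun σ => f σ x) (ft τ x) τ := hf.hasDerivAt hτ x
    have h4 := (h2.const_mul (ρ x)).fun_add
      (((hφ τ).const_sub (B ^ 2)).fun_mul ((h3.fun_pow 2).const_mul (ρ x)))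
    refine h4.congr_deriv ?_
    simp only [hG']
    norm_num; ring
  have hftc := cG.integral_sub_eq cG' dG hK zG hs hst ht
  have hzero : ∀ τ, (∀ x, f τ x = 0) → ∫ x, G τ x = 0 := fun τ h0 => by
    have : f τ = fun _ => 0 := funext h0
    simp [hG, this, gradSq]
  rw [hzero t hft, hzero s hfs, sub_zero] at hftc
  have zf2 : ∀ τ ∈ Ioo 0 T, ∀ x ∉ K, ρ x * f τ x ^ 2 = 0 := fun τ hτ x hx => by
    simp [hfK τ hτ x hx]
  have slice_le : ∀ τ ∈ Icc s t, ∫ x, G' τ x ≤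
      (1 + B ^ 2) * (∫ x, H τ x) - ∫ x, ρ x * f τ x ^ 2 := by
    intro τ hτ
    have hτ' := hsub hτ
    have hf2 : ContDiff ℝ 2 (f τ) := (hf.slice hτ').of_le two_le_infty
    have hft1 : ContDiff ℝ 1 (ft τ) := (hftS.slice hτ').of_le (by exact_mod_cast le_top)
    have I1 := integral_divGrad hρ hft1 hf2 (hcs τ hτ')
    have I2 := integral_divGrad hρ (hf2.of_le (by norm_num)) hf2 (hcs τ hτ')
    have hdc := continuous_divGrad hρ hf2
    have hpc : ∀ i, Continuous (partialD i (f τ)) := fun i =>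
      (hf2.partialD (m := 1) (by norm_num) i).continuous
    have hpt : ∀ i, Continuous (partialD i (ft τ)) := fun i =>
      (hft1.partialD (m := 0) (by simp) i).continuous
    have hρc := hρ.continuous
    have int_of : ∀ {F : Space3 → ℝ}, Continuous F → (∀ x ∉ K, F x = 0) → Integrable F :=
      fun hF h0 => hF.integrable_of_hasCompactSupport (HasCompactSupport.intro hK h0)
    have hd0 : ∀ x ∉ K, divGrad ρ (f τ) x = 0 := fun x hx =>
      divGrad_eq_zero_of_notMem fun h => hx (hsupp τ hτ' h)
    have J1 : Integrable fun x => ρ x * (∑ i, partialD i (ft τ) x * partialD i (f τ) x) +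
        ft τ x * divGrad ρ (f τ) x := by
      have := hft1.continuous
      refine int_of (by fun_prop) fun x hx => ?_
      simp [hgrad0 τ hτ' x hx, hd0 x hx]
    have J2 : Integrable fun x => ρ x * (∑ i, partialD i (f τ) x * partialD i (f τ) x) +
        f τ x * divGrad ρ (f τ) x := by
      have := hf2.continuous
      refine int_of (by fun_prop) fun x hx => ?_
      simp [hgrad0 τ hτ' x hx, hd0 x hx]
    have JG := cG'.integrable_slice hK hτ' (zG' τ hτ')
    have JH := hH.integrable_slice hK hτ' (hHK τ hτ')
    have Jf := cf2.integrable_slice hK hτ' (zf2 τ hτ')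
    -- Two integrals that vanish by integration by parts are subtracted, so that the comparison
    -- becomes pointwise.
    have e1 : ∫ x, G' τ x = ∫ x, (G' τ x -
        2 * (ρ x * (∑ i, partialD i (ft τ) x * partialD i (f τ) x) +
          ft τ x * divGrad ρ (f τ) x) -
        2 * B ^ 2 * (ρ x * (∑ i, partialD i (f τ) x * partialD i (f τ) x) +
          f τ x * divGrad ρ (f τ) x)) := by
      have K1 : Integrable fun x => G' τ x -
          2 * (ρ x * (∑ i, partialD i (ft τ) x * partialD i (f τ) x) +
            ft τ x * divGrad ρ (f τ) x) := JG.sub (J1.const_mul _)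
      rw [integral_sub K1 (J2.const_mul _), integral_sub JG (J1.const_mul _), integral_const_mul,
        integral_const_mul, I1, I2]
      ring
    have e2 : (1 + B ^ 2) * (∫ x, H τ x) - ∫ x, ρ x * f τ x ^ 2 =
        ∫ x, ((1 + B ^ 2) * H τ x - ρ x * f τ x ^ 2) := by
      rw [integral_sub (JH.const_mul _) Jf, integral_const_mul]
    rw [e1, e2]
    refine integral_mono ((JG.sub (J1.const_mul _)).sub (J2.const_mul _))
      ((JH.const_mul _).sub Jf) fun x => ?_
    obtain ⟨β, g, h1, h2, h3⟩ := heq τ hτ x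
    have hgs : (∑ i, partialD i (f τ) x * partialD i (f τ) x) = gradSq (f τ) x := by
      simp [gradSq, pow_two]
    dsimp only
    rw [hgs]
    exact carleman_arith (hρ0 x) h1 h2 (gradSq_nonneg _ _) h3 (hconv τ hτ)
  have iG : IntervalIntegrable _ volume s t :=
    ((cG'.continuousOn_integral hK zG').mono hsub').intervalIntegrable
  have iH : IntervalIntegrable _ volume s t :=
    ((hH.continuousOn_integral hK hHK).mono hsub').intervalIntegrable
  have if2 : IntervalIntegrable _ volume s t :=
    ((cf2.continuousOn_integral hK zf2).mono hsub').intervalIntegrable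
  have := intervalIntegral.integral_mono_on hst iG ((iH.const_mul _).sub if2) slice_le
  rw [hftc, intervalIntegral.integral_sub (iH.const_mul _) if2,
    intervalIntegral.integral_const_mul] at this
  linarith

/-! ### The weight -/

/-- The weight `r² (1 + |x|²)⁻³`. -/
def axisWeight (x : Space3) : ℝ := axisSq x * (1 + normSq3 x)⁻¹ ^ 3

lemma one_add_normSq3_pos (x : Space3) : 0 < 1 + normSq3 x := by
  have := normSq3_nonneg x; linarith

lemma axisWeight_nonneg (x : Space3) : 0 ≤ axisWeight x := by
  have := axisSq_nonneg x
  have := one_add_normSq3_pos x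
  unfold axisWeight; positivity

lemma axisWeight_le (x : Space3) : axisWeight x ≤ (1 + normSq3 x)⁻¹ ^ 2 := by
  have h0 := one_add_normSq3_pos x
  have h1 : axisSq x ≤ 1 + normSq3 x := by linarith [axisSq_le_normSq3 x]
  calc axisWeight x ≤ (1 + normSq3 x) * (1 + normSq3 x)⁻¹ ^ 3 := by unfold axisWeight; gcongr
    _ = _ := by field_simp

lemma contDiff_axisWeight {n : WithTop ℕ∞} : ContDiff ℝ n axisWeight := by
  have h1 : ContDiff ℝ n normSq3 := contDiff_normSq3
  have h2 : ContDiff ℝ n axisSq := contDiff_axisSq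
  exact h2.mul (((contDiff_const.add h1).inv fun x => (one_add_normSq3_pos x).ne').pow 3)

/-- The weight decays like |x|^(-4), which is integrable in dimension three. Finiteness of its total
mass lets merely bounded solutions enter the Carleman estimate. -/
lemma integrable_axisWeight : Integrable axisWeight := by
  have h := integrable_rpow_neg_one_add_norm_sq (E := Space3) (μ := volume) (r := 4) (by simp; norm_num)
  refine h.mono' (contDiff_axisWeight (n := 0)).continuous.aestronglyMeasurable
    (Eventually.of_forall fun x => ?_)
  rw [Real.norm_of_nonneg (axisWeight_nonneg x)]
  refine (axisWeight_le x).trans (le_of_eq ?_)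
  rw [normSq3_eq, show (-4 / 2 : ℝ) = -((2 : ℕ) : ℝ) by norm_num, Real.rpow_neg (by positivity),
    Real.rpow_natCast, inv_pow]

lemma partialD_axisWeight (i : Fin 3) (x : Space3) :
    partialD i axisWeight x = partialD i axisSq x * (1 + normSq3 x)⁻¹ ^ 3 -
      6 * axisWeight x * (1 + normSq3 x)⁻¹ * x i := by
  have hp := one_add_normSq3_pos x
  have h1 : HasDerivAt (fun y : ℝ => (1 + y)⁻¹ ^ 3) (-3 * (1 + normSq3 x)⁻¹ ^ 4) (normSq3 x) := by
    refine ((((hasDerivAt_id (normSq3 x)).const_add 1).fun_inv hp.ne').fun_pow 3).congr_deriv ?_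
    simp only [id]
    norm_num
    field_simp
  have h2 := partialD_comp i h1 (differentiable_normSq3 x)
  have h3 : DifferentiableAt ℝ (fun y => (1 + normSq3 y)⁻¹ ^ 3) x :=
    h1.differentiableAt.comp x (differentiable_normSq3 x)
  have := partialD_mul i (differentiable_axisSq x) h3
  change partialD i (fun y => axisSq y * (1 + normSq3 y)⁻¹ ^ 3) x = _
  rw [this, h2, partialD_normSq3, axisWeight]
  ring

/-- The factor r² in the weight produces the drift (2/r)∂_r, so that Δ + (2/r)∂_r takes divergence
form; the factor (1 + |x|²)⁻³ adds only the bounded drift 6 (1 + |x|²)⁻¹ x. -/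
lemma divGrad_axisWeight {f : Space3 → ℝ} (hf : ContDiff ℝ 2 f) (x : Space3) :
    divGrad axisWeight f x = axisWeight x * lap f x +
      2 * (1 + normSq3 x)⁻¹ ^ 3 * (x 0 * partialD 0 f x + x 1 * partialD 1 f x) -
      6 * axisWeight x * (1 + normSq3 x)⁻¹ * advect id f x := by
  have h1 : ∀ i, partialD i (fun y => axisWeight y * partialD i f y) x =
      axisWeight x * partialD i (partialD i f) x + partialD i axisWeight x * partialD i f x :=
    fun i => partialD_mul i ((contDiff_axisWeight (n := 1)).differentiable (by simp) x)
      ((hf.partialD (m := 1) (by norm_num) i).differentiable (by simp) x)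
  have p0 : partialD 0 axisSq x = 2 * x 0 := by rw [partialD_axisSq]; simp
  have p1 : partialD 1 axisSq x = 2 * x 1 := by rw [partialD_axisSq]; simp
  have p2 : partialD 2 axisSq x = 0 := by rw [partialD_axisSq]; simp
  simp only [divGrad, h1, partialD_axisWeight, lap, advect, Fin.sum_univ_three, id, p0, p1, p2]
  ring

lemma sq_advect_le (w : Space3 → Space3) (f : Space3 → ℝ) (x : Space3) :
    advect w f x ^ 2 ≤ ‖w x‖ ^ 2 * gradSq f x := by
  rw [EuclideanSpace.norm_sq_eq]
  have := Finset.sum_mul_sq_le_sq_mul_sq Finset.univ (fun i => w x i) (fun i => partialD i f x)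
  simp only [Real.norm_eq_abs, sq_abs]
  exact this

lemma sq_sum_partialD_mul_le (f g : Space3 → ℝ) (x : Space3) :
    (∑ i, partialD i f x * partialD i g x) ^ 2 ≤ gradSq f x * gradSq g x :=
  Finset.sum_mul_sq_le_sq_mul_sq Finset.univ (fun i => partialD i f x) (fun i => partialD i g x)

lemma cut_deriv_eq_zero_of_lt {R : ℝ} (hR : 0 < R) {x : Space3} (hx : 2 * R ^ 2 < normSq3 x) :
    cutQuot R x = 0 ∧ (∀ i, partialD i (cut R) x = 0) ∧ lap (cut R) x = 0 := by
  have h : 2 < normSq3 x / R ^ 2 := by rwa [lt_div_iff₀ (by positivity)]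
  have h1 : cutQuot R x = 0 := by simp [cutQuot, deriv_cutProfile_eq_zero (Or.inr h)]
  refine ⟨h1, fun i => by rw [partialD_cut, h1, zero_mul], ?_⟩
  rw [lap_cut, h1, (deriv_cutProfile_eq_zero (Or.inr h)).2]; ring

lemma cut_eq_zero {R : ℝ} (hR : 0 < R) {x : Space3} (hx : 2 * R ^ 2 < normSq3 x) :
    cut R x = 0 :=
  cutProfile_eq_zero (by rw [le_div_iff₀ (by positivity)]; exact hx.le)

lemma isTestFn_cut {R : ℝ} (hR : 0 < R) : IsTestFn (cut R) (cutQuot R) := by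
  simpa using isWeight_one.isTestFn hR

lemma integral_cut {R : ℝ} (hR : 0 < R) : ∫ x, cut R x = R ^ 3 * ∫ x, cut 1 x := by
  have h : (fun x => cut R x) = fun x => cut 1 (R⁻¹ • x) := by
    funext x
    have : normSq3 (R⁻¹ • x) = normSq3 x / R ^ 2 := by
      simp only [normSq3, PiLp.smul_apply, smul_eq_mul]; field_simp
    simp [cut, this]
  rw [h, Measure.integral_comp_inv_smul]
  simp [abs_of_pos hR]

/-- The vector field in the weighted form of the equation. -/
def weightedDrift (w : Space3 → Space3) (x : Space3) : Space3 :=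
  w x - (6 * (1 + normSq3 x)⁻¹) • x

lemma advect_weightedDrift (w : Space3 → Space3) (f : Space3 → ℝ) (x : Space3) :
    advect (weightedDrift w) f x = advect w f x - 6 * (1 + normSq3 x)⁻¹ * advect id f x := by
  simp only [advect, weightedDrift, Fin.sum_univ_three, PiLp.sub_apply, PiLp.smul_apply,
    smul_eq_mul, id]
  ring

lemma norm_le_one_add_normSq3 (x : Space3) : ‖x‖ ≤ 1 + normSq3 x := by
  rw [normSq3_eq]; nlinarith [sq_nonneg (‖x‖ - 1)]

lemma norm_weightedDrift_le {w : Space3 → Space3} {x : Space3} {C : ℝ} (h : ‖w x‖ ≤ C) :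
    ‖weightedDrift w x‖ ≤ C + 6 := by
  have hp := one_add_normSq3_pos x
  refine (norm_sub_le _ _).trans (add_le_add h ?_)
  rw [norm_smul, Real.norm_of_nonneg (by positivity), mul_assoc, inv_mul_eq_div]
  have := (div_le_one hp).2 (norm_le_one_add_normSq3 x)
  linarith

/-- The zeroth order coefficient produced by the cutoff. -/
def cutPotential (R : ℝ) (x : Space3) : ℝ :=
  lap (cut R) x + 2 * cutQuot R x - 6 * (1 + normSq3 x)⁻¹ * advect id (cut R) x

/-- The error produced by the cutoff in the weighted equation. -/
def cutError (R : ℝ) (w : Space3 → Space3) (u : Space3 → ℝ) (x : Space3) : ℝ :=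
  u x * advect w (cut R) x - 2 * (∑ i, partialD i (cut R) x * partialD i u x) -
    u x * cutPotential R x

/-- The error lives where R² ≤ |x|² ≤ 2R². There the weight is at most R^(-4) and the squared
derivatives of the cutoff are O(R^(-2)), while the cutoff at scale 2R equals 1. -/
lemma exists_cutError_le (B : ℝ) : ∃ C : ℝ, 0 ≤ C ∧ ∀ R : ℝ, 1 ≤ R →
    ∀ (w : Space3 → Space3) (u : Space3 → ℝ) (x : Space3), ‖w x‖ ≤ B →
    axisWeight x * cutError R w u x ^ 2 ≤
      C / R ^ 6 * ((u x ^ 2 + gradSq u x) * cut (2 * R) x) := by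
  obtain ⟨C, hC0, hC⟩ := exists_bound_cut
  refine ⟨C ^ 2 * (9 * B ^ 2 + 711), by positivity, fun R hR w u x hw => ?_⟩
  have hR0 : 0 < R := by linarith
  have hgu := gradSq_nonneg u x
  have hcut := cut_nonneg (R := 2 * R) x
  have hrhs : 0 ≤ C ^ 2 * (9 * B ^ 2 + 711) / R ^ 6 *
      ((u x ^ 2 + gradSq u x) * cut (2 * R) x) := by positivity
  have hzero : (cutQuot R x = 0 ∧ (∀ i, partialD i (cut R) x = 0) ∧ lap (cut R) x = 0) →
      axisWeight x * cutError R w u x ^ 2 ≤ C ^ 2 * (9 * B ^ 2 + 711) / R ^ 6 *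
      ((u x ^ 2 + gradSq u x) * cut (2 * R) x) := by
    rintro ⟨h1, h2, h3⟩
    have : cutError R w u x = 0 := by simp [cutError, cutPotential, advect, h1, h2, h3]
    rw [this]; simpa using hrhs
  rcases lt_or_ge (normSq3 x) (R ^ 2) with h1 | h1
  · exact hzero (cut_deriv_eq_zero hR0 h1)
  rcases lt_or_ge (2 * R ^ 2) (normSq3 x) with h2 | h2
  · exact hzero (cut_deriv_eq_zero_of_lt hR0 h2)
  rw [cut_eq_one (by linarith) (by nlinarith : normSq3 x ≤ (2 * R) ^ 2), mul_one]
  obtain ⟨hq, hp, hl⟩ := hC R hR x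
  set D := C / R with hD
  have hD0 : 0 ≤ D := by positivity
  have hg : gradSq (cut R) x ≤ 3 * D ^ 2 := by
    have : ∀ i, partialD i (cut R) x ^ 2 ≤ D ^ 2 := fun i => sq_le_sq' (abs_le.1 (hp i)).1
      (abs_le.1 (hp i)).2
    simp only [gradSq, Fin.sum_univ_three]
    linarith [this 0, this 1, this 2]
  have hg0 := gradSq_nonneg (cut R) x
  have b1 : advect w (cut R) x ^ 2 ≤ B ^ 2 * (3 * D ^ 2) := by
    refine (sq_advect_le w (cut R) x).trans ?_
    gcongr
  have b2 : (∑ i, partialD i (cut R) x * partialD i u x) ^ 2 ≤ 3 * D ^ 2 * gradSq u x :=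
    (sq_sum_partialD_mul_le _ _ _).trans (by gcongr)
  have hpos := one_add_normSq3_pos x
  have b3 : |(1 + normSq3 x)⁻¹ * advect id (cut R) x| ≤ 2 * D := by
    refine abs_le_of_sq_le_sq ?_ (by positivity)
    have h3 : (1 + normSq3 x)⁻¹ * ‖x‖ ≤ 1 := by
      rw [inv_mul_eq_div]; exact (div_le_one hpos).2 (norm_le_one_add_normSq3 x)
    calc ((1 + normSq3 x)⁻¹ * advect id (cut R) x) ^ 2
        = (1 + normSq3 x)⁻¹ ^ 2 * advect id (cut R) x ^ 2 := by ring
      _ ≤ (1 + normSq3 x)⁻¹ ^ 2 * (‖x‖ ^ 2 * (3 * D ^ 2)) := by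
          gcongr
          exact (sq_advect_le id (cut R) x).trans (by simp only [id]; gcongr)
      _ = ((1 + normSq3 x)⁻¹ * ‖x‖) ^ 2 * (3 * D ^ 2) := by ring
      _ ≤ 1 ^ 2 * (3 * D ^ 2) := by gcongr
      _ ≤ (2 * D) ^ 2 := by nlinarith [sq_nonneg D]
  have b4 : cutPotential R x ^ 2 ≤ 225 * D ^ 2 := by
    have e1 := abs_le.1 hl
    have e2 := abs_le.1 hq
    have e3 := abs_le.1 b3
    have : cutPotential R x = lap (cut R) x + 2 * cutQuot R x -
      6 * ((1 + normSq3 x)⁻¹ * advect id (cut R) x) := by rw [cutPotential]; ring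
    have h3 : |cutPotential R x| ≤ 15 * D := by
      rw [this]
      exact abs_le.2 ⟨by linarith [e1.1, e2.1, e3.2], by linarith [e1.2, e2.2, e3.1]⟩
    nlinarith [abs_le.1 h3]
  have b5 : cutError R w u x ^ 2 ≤ D ^ 2 * (9 * B ^ 2 + 711) * (u x ^ 2 + gradSq u x) := by
    set P := advect w (cut R) x
    set Q := ∑ i, partialD i (cut R) x * partialD i u x
    set L := cutPotential R x
    have e : cutError R w u x = u x * P - 2 * Q - u x * L := rfl
    have e1 : (u x * P - 2 * Q - u x * L) ^ 2 ≤
        3 * (u x ^ 2 * P ^ 2 + 4 * Q ^ 2 + u x ^ 2 * L ^ 2) := by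
      nlinarith [sq_nonneg (u x * P + 2 * Q), sq_nonneg (u x * P + u x * L),
        sq_nonneg (2 * Q - u x * L)]
    have e2 : u x ^ 2 * P ^ 2 ≤ u x ^ 2 * (B ^ 2 * (3 * D ^ 2)) := by gcongr
    have e3 : u x ^ 2 * L ^ 2 ≤ u x ^ 2 * (225 * D ^ 2) := by gcongr
    have e4 : 0 ≤ D ^ 2 * (9 * B ^ 2 + 675) * gradSq u x := by positivity
    have e5 : 0 ≤ D ^ 2 * 36 * u x ^ 2 := by positivity
    rw [e]
    linarith
  have hw4 : axisWeight x ≤ 1 / R ^ 4 := by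
    refine (axisWeight_le x).trans ?_
    have : (1 + normSq3 x)⁻¹ ≤ (R ^ 2)⁻¹ := inv_anti₀ (by positivity) (by linarith)
    calc (1 + normSq3 x)⁻¹ ^ 2 ≤ ((R ^ 2)⁻¹) ^ 2 := by gcongr
      _ = 1 / R ^ 4 := by rw [inv_pow, ← pow_mul, one_div]
  calc axisWeight x * cutError R w u x ^ 2
      ≤ 1 / R ^ 4 * (D ^ 2 * (9 * B ^ 2 + 711) * (u x ^ 2 + gradSq u x)) := by
        gcongr
    _ = _ := by rw [hD]; field_simp

/-! ### The localized equation and backward uniqueness. -/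

lemma SlabSmooth.cutoff {T R : ℝ} {u : ℝ → Space3 → ℝ} (hu : SlabSmooth T u) {c : ℝ → ℝ}
    (hc : ContDiff ℝ ∞ c) : SlabSmooth T fun t x => c t * (cut R x * u t x) := by
  have h1 : ContDiff ℝ ∞ fun y : ℝ × Space3 => c y.1 := hc.comp contDiff_fst
  have h2 : ContDiff ℝ ∞ fun y : ℝ × Space3 => cut R y.2 := contDiff_cut.comp contDiff_snd
  exact h1.contDiffOn.mul (h2.contDiffOn.mul hu)

namespace IsSmoothGammaSolution

variable {T : ℝ} {q : ℝ≥0∞} {v : ℝ → Space3 → Space3} {Γ₀ : Space3 → ℝ} {Γ : ℝ → Space3 → ℝ}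

/-- The weighted equation satisfied by the localized solution. -/
lemma cutoff_equation (hΓ : IsSmoothGammaSolution T q v Γ₀ Γ) {τ : ℝ} (hτ : τ ∈ Ioo 0 T)
    {c : ℝ → ℝ} {φ₁ d : ℝ} (hc : HasDerivAt c (φ₁ * c τ + d) τ) (R : ℝ) (x : Space3) :
    axisWeight x * deriv (fun σ => c σ * (cut R x * Γ σ x)) τ =
      axisWeight x * φ₁ * (c τ * (cut R x * Γ τ x)) +
        divGrad axisWeight (fun y => c τ * (cut R y * Γ τ y)) x +
        axisWeight x * (-advect (weightedDrift (v τ)) (fun y => c τ * (cut R y * Γ τ y)) x +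
          (d * (cut R x * Γ τ x) + c τ * cutError R (weightedDrift (v τ)) (Γ τ) x)) := by
  have hS := hΓ.slabSmooth
  have hu : ContDiff ℝ 2 (Γ τ) := (hS.slice hτ).of_le two_le_infty
  have hψ : ContDiff ℝ 2 (cut R) := contDiff_cut (n := 2)
  have hud : DifferentiableAt ℝ (Γ τ) x := hu.differentiable (by simp) x
  have hψd : DifferentiableAt ℝ (cut R) x := differentiable_cut x
  have ht : deriv (fun σ => c σ * (cut R x * Γ σ x)) τ =
      (φ₁ * c τ + d) * (cut R x * Γ τ x) + c τ * (cut R x * deriv (fun s => Γ s x) τ) :=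
    (hc.fun_mul ((hS.hasDerivAt hτ x).const_mul (cut R x))).deriv
  have hp : ∀ i, partialD i (fun y => c τ * (cut R y * Γ τ y)) x =
      c τ * (cut R x * partialD i (Γ τ) x + partialD i (cut R) x * Γ τ x) := fun i => by
    rw [partialD_mul i (differentiableAt_const _) (hψd.fun_mul hud), partialD_mul i hψd hud]
    simp
  have hl : lap (fun y => c τ * (cut R y * Γ τ y)) x = c τ * (cut R x * lap (Γ τ) x +
      2 * (∑ i, partialD i (cut R) x * partialD i (Γ τ) x) + lap (cut R) x * Γ τ x) := by
    rw [lap_mul (f := fun _ => c τ) contDiff_const (hψ.mul hu), lap_mul hψ hu]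
    simp [lap_const]
  have hr := hΓ.radial_eq hτ x
  have hrc := radial_cut (R := R) x
  rw [divGrad_axisWeight (contDiff_const.mul (hψ.mul hu)), ht, hl]
  simp only [advect_weightedDrift, cutError, cutPotential]
  rw [axisResidual] at hr
  simp only [advect, hp, Fin.sum_univ_three, id, axisWeight] at hr ⊢
  set J := (1 + normSq3 x)⁻¹
  -- The weight being r² J³, the terms 2 J³ x_h·∇_h in the weighted Laplacian are the residual of
  -- the equation, and the radial quotient of the cutoff, multiplied by the weight.
  linear_combination (-(2 * J ^ 3 * c τ * cut R x)) * hr - (2 * J ^ 3 * c τ * Γ τ x) * hrc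

/-- A Caccioppoli estimate: the energy inequality with the convex function y². The solution is
bounded, so both the initial energy and the flux are controlled by the volume of a ball of radius
comparable to R. -/
lemma exists_local_energy_le (hv : IsSmoothVelocity T v) (hΓ : IsSmoothGammaSolution T q v Γ₀ Γ)
    {s t M : ℝ} (hs : 0 < s) (hst : s ≤ t) (ht : t < T) (hM : ∀ τ ∈ Icc s t, ∀ x, |Γ τ x| ≤ M) :
    ∃ C : ℝ, 0 ≤ C ∧ ∀ R : ℝ, 1 ≤ R →
      ∫ τ in s..t, ∫ x, (Γ τ x ^ 2 + gradSq (Γ τ) x) * cut R x ≤ C * R ^ 3 := by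
  have hS := hΓ.slabSmooth
  have hsub : Icc s t ⊆ Ioo 0 T := fun τ hτ => ⟨hs.trans_le hτ.1, hτ.2.trans_lt ht⟩
  have hsub' : uIcc s t ⊆ Ioo 0 T := by rwa [uIcc_of_le hst]
  obtain ⟨Cv, hCv⟩ := hv.bounded s t hs ht
  obtain ⟨E, hE0, hE⟩ := isWeight_one.flux_le Cv
  set V := ∫ x, cut 1 x with hV
  have hV0 : 0 ≤ V := integral_nonneg fun x => cut_nonneg x
  have hts : 0 ≤ t - s := by linarith
  refine ⟨M ^ 2 * V * (1 + (t - s) * (1 + 8 * E)), by positivity, fun R hR => ?_⟩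
  have hR0 : 0 < R := by linarith
  have hsq : ∀ τ ∈ Icc s t, ∀ x, Γ τ x ^ 2 ≤ M ^ 2 := fun τ hτ x =>
    sq_le_sq' (abs_le.1 (hM τ hτ x)).1 (abs_le.1 (hM τ hτ x)).2
  have hK := hasCompactSupport_cut hR0
  have hK2 := hasCompactSupport_cut (show 0 < 2 * R by linarith)
  have hcutint : ∀ {R : ℝ}, 0 < R → Integrable (cut R) := fun hR =>
    (contDiff_cut (n := 0)).continuous.integrable_of_hasCompactSupport (hasCompactSupport_cut hR)
  have hflux : ∀ τ ∈ Icc s t, ∀ x,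
      advect (v τ) (cut R) x + lap (cut R) x - 2 * cutQuot R x ≤ E * cut (2 * R) x := by
    intro τ hτ x
    rcases lt_or_ge (2 * R ^ 2) (normSq3 x) with h2 | h2
    · obtain ⟨e1, e2, e3⟩ := cut_deriv_eq_zero_of_lt hR0 h2
      have := cut_nonneg (R := 2 * R) x
      simp only [advect, e1, e2, e3, mul_zero, Finset.sum_const_zero]
      simp only [add_zero, sub_zero]
      positivity
    · rw [cut_eq_one (by linarith) (by nlinarith : normSq3 x ≤ (2 * R) ^ 2), mul_one]
      have h := hE R hR (v τ) x 0 (fun i => (PiLp.norm_apply_le (v τ x) i).trans (hCv τ hτ x))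
        (by simp [advect, lap_const])
      have hER : E / R ≤ E := div_le_self hE0 hR
      simp only [one_mul, zero_mul, add_zero, zero_add] at h
      linarith
  have henergy := hΓ.energy_le hv (η := fun y => y ^ 2) (by fun_prop) (fun y => sq_nonneg y)
    (isTestFn_cut hR0) hs hst ht
  have hdd : deriv (deriv fun y : ℝ => y ^ 2) = fun _ => 2 := by
    have : deriv (fun y : ℝ => y ^ 2) = fun y => 2 * y := by funext y; simp
    rw [this]; funext y; simp
  simp only [hdd] at henergy
  have cu : SlabCont T fun τ x => Γ τ x ^ 2 := hS.slabCont.comp (η := fun y => y ^ 2) (by fun_prop)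
  have ccut : SlabCont T fun _ x => cut R x :=
    SlabCont.of_space (contDiff_cut (n := 0)).continuous
  have c1 := cu.mul ccut
  have c2 : SlabCont T fun τ x => 2 * gradSq (Γ τ) x * cut R x :=
    ((SlabCont.of_time continuous_const).mul hS.slabCont_gradSq).mul ccut
  have c3 : SlabCont T fun τ x => (Γ τ x ^ 2 + gradSq (Γ τ) x) * cut R x :=
    (cu.add hS.slabCont_gradSq).mul ccut
  have zc : ∀ x ∉ tsupport (cut R), cut R x = 0 := fun x hx => image_eq_zero_of_notMem_tsupport hx
  have i1 : IntervalIntegrable _ volume s t := ((c1.continuousOn_integral hK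
    fun τ _ x hx => by simp [zc x hx]).mono hsub').intervalIntegrable
  have i2 : IntervalIntegrable _ volume s t := ((c2.continuousOn_integral hK
    fun τ _ x hx => by simp [zc x hx]).mono hsub').intervalIntegrable
  have i3 : IntervalIntegrable _ volume s t := ((c3.continuousOn_integral hK
    fun τ _ x hx => by simp [zc x hx]).mono hsub').intervalIntegrable
  have hu_le : ∀ τ ∈ Icc s t, ∫ x, Γ τ x ^ 2 * cut R x ≤ M ^ 2 * (R ^ 3 * V) := by
    intro τ hτ
    rw [← integral_cut hR0, ← integral_const_mul]
    refine integral_mono (c1.integrable_slice hK (hsub hτ) fun x hx => by simp [zc x hx])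
      ((hcutint hR0).const_mul _) fun x => ?_
    exact mul_le_mul_of_nonneg_right (hsq τ hτ x) (cut_nonneg x)
  have hfl_le : ∫ τ in s..t, ∫ x, Γ τ x ^ 2 *
      (advect (v τ) (cut R) x + lap (cut R) x - 2 * cutQuot R x) ≤
      (t - s) * (M ^ 2 * E * (8 * R ^ 3 * V)) := by
    have c4 := cu.mul (hv.slabCont_flux (contDiff_cut (R := R) (n := 2)) (continuous_cutQuot (R := R)))
    have zq : ∀ x ∉ tsupport (cut R) ∪ tsupport (cutQuot R),
        ∀ τ, Γ τ x ^ 2 * (advect (v τ) (cut R) x + lap (cut R) x - 2 * cutQuot R x) = 0 := by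
      intro x hx τ
      rw [mem_union, not_or] at hx
      rw [advect_eq_zero_of_notMem hx.1, lap_eq_zero_of_notMem hx.1,
        image_eq_zero_of_notMem_tsupport hx.2]
      ring
    have hKK : IsCompact (tsupport (cut R) ∪ tsupport (cutQuot R)) :=
      IsCompact.union hK (hasCompactSupport_cutQuot hR0)
    have i4 : IntervalIntegrable _ volume s t := ((c4.continuousOn_integral hKK
      fun τ _ x hx => zq x hx τ).mono hsub').intervalIntegrable
    calc _ ≤ ∫ τ in s..t, M ^ 2 * E * (8 * R ^ 3 * V) := by
          refine intervalIntegral.integral_mono_on hst i4 (by simp) fun τ hτ => ?_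
          have e8 : (8 : ℝ) * R ^ 3 * V = (2 * R) ^ 3 * V := by ring
          rw [e8, ← integral_cut (by linarith), ← integral_const_mul]
          refine integral_mono (c4.integrable_slice hKK (hsub hτ) fun x hx => zq x hx τ)
            ((hcutint (by linarith)).const_mul _) fun x => ?_
          have h1 := mul_le_mul_of_nonneg_left (hflux τ hτ x) (sq_nonneg (Γ τ x))
          have h2 := mul_le_mul_of_nonneg_right (hsq τ hτ x)
            (mul_nonneg hE0 (cut_nonneg (R := 2 * R) x))
          dsimp only
          linarith
      _ = _ := by rw [intervalIntegral.integral_const, smul_eq_mul]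
  have hgrad_le : ∫ τ in s..t, ∫ x, 2 * gradSq (Γ τ) x * cut R x ≤
      M ^ 2 * (R ^ 3 * V) + (t - s) * (M ^ 2 * E * (8 * R ^ 3 * V)) := by
    have h1 : 0 ≤ ∫ x, Γ t x ^ 2 * cut R x :=
      integral_nonneg fun x => mul_nonneg (sq_nonneg _) (cut_nonneg x)
    have h2 := hu_le s ⟨le_rfl, hst⟩
    linarith
  have hu2 : ∫ τ in s..t, ∫ x, Γ τ x ^ 2 * cut R x ≤ (t - s) * (M ^ 2 * (R ^ 3 * V)) := by
    refine (intervalIntegral.integral_mono_on hst i1 (by simp) hu_le).trans (le_of_eq ?_)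
    rw [intervalIntegral.integral_const, smul_eq_mul]
  calc _ ≤ ∫ τ in s..t, ((∫ x, Γ τ x ^ 2 * cut R x) + ∫ x, 2 * gradSq (Γ τ) x * cut R x) := by
        refine intervalIntegral.integral_mono_on hst i3 (i1.add i2) fun τ hτ => ?_
        have j1 := c1.integrable_slice hK (hsub hτ) fun x hx => by simp [zc x hx]
        have j2 := c2.integrable_slice hK (hsub hτ) fun x hx => by simp [zc x hx]
        rw [← integral_add j1 j2]
        refine integral_mono (c3.integrable_slice hK (hsub hτ) fun x hx => by simp [zc x hx])
          (j1.add j2) fun x => ?_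
        have := mul_nonneg (gradSq_nonneg (Γ τ) x) (cut_nonneg (R := R) x)
        dsimp only
        linarith
    _ = (∫ τ in s..t, ∫ x, Γ τ x ^ 2 * cut R x) +
          ∫ τ in s..t, ∫ x, 2 * gradSq (Γ τ) x * cut R x := intervalIntegral.integral_add i1 i2
    _ ≤ _ := by linarith

end IsSmoothGammaSolution

lemma sq_add_le_two (a b : ℝ) : (a + b) ^ 2 ≤ 2 * a ^ 2 + 2 * b ^ 2 := by
  nlinarith [sq_nonneg (a - b)]

lemma cut_le_sq_cut {R R' : ℝ} (hR : 0 < R) (h : 2 * R ≤ R') (x : Space3) :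
    cut R x ≤ cut R' x ^ 2 := by
  rcases le_or_gt (normSq3 x) (R' ^ 2) with h1 | h1
  · rw [cut_eq_one (by linarith) h1]; simpa using cut_le_one x
  · rw [cut_eq_zero hR (by nlinarith)]; positivity

namespace IsSmoothGammaSolution

variable {T : ℝ} {q : ℝ≥0∞} {v : ℝ → Space3 → Space3} {Γ₀ : Space3 → ℝ} {Γ : ℝ → Space3 → ℝ}

set_option maxHeartbeats 800000 in
/-- The Carleman estimate for a solution that vanishes at the final time. -/
lemma exists_carleman_bound (hv : IsSmoothVelocity T v) (hΓ : IsSmoothGammaSolution T q v Γ₀ Γ)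
    {a b s t M : ℝ} (ha : 0 < a) (hab : a < b) (hbs : b < s) (hst : s < t) (ht : t < T)
    (hM : ∀ τ ∈ Icc a t, ∀ x, |Γ τ x| ≤ M) (hzero : ∀ x, Γ t x = 0) :
    ∃ K Y : ℝ, 0 < K ∧ ∀ R₀ : ℝ, 1 ≤ R₀ → ∀ Λ : ℝ, 1 ≤ Λ →
      Real.exp (Λ * Real.exp (K * s)) ^ 2 *
        (∫ τ in s..t, ∫ x, axisWeight x * (cut R₀ x * Γ τ x ^ 2)) ≤
      Y * Real.exp (Λ * Real.exp (K * b)) ^ 2 := by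
  have hS := hΓ.slabSmooth
  have hat : a < t := hab.trans (hbs.trans hst)
  have hsub : Icc a t ⊆ Ioo 0 T := fun τ hτ => ⟨ha.trans_le hτ.1, hτ.2.trans_lt ht⟩
  obtain ⟨Cv, hCv⟩ := hv.bounded a t ha ht
  have hCv0 : 0 ≤ Cv := (norm_nonneg _).trans (hCv a ⟨le_rfl, hat.le⟩ 0)
  set B := Cv + 6 with hB
  have hB0 : 0 ≤ B := by linarith
  have hdrift : ∀ τ ∈ Icc a t, ∀ x, ‖weightedDrift (v τ) x‖ ≤ B := fun τ hτ x =>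
    norm_weightedDrift_le (hCv τ hτ x)
  obtain ⟨C₁, hC₁0, hC₁⟩ := exists_cutError_le B
  obtain ⟨C₂, hC₂0, hC₂⟩ := hΓ.exists_local_energy_le hv ha hat.le ht hM
  -- With φ₂ = K φ₁ and φ₁ ≥ 1 this is what the convexity condition of the Carleman estimate
  -- requires, for every Λ ≥ 1 at once.
  set K : ℝ := 2 * B ^ 2 + B ^ 2 * (B ^ 2 + 1) + 1 with hK
  have hK1 : 1 ≤ K := by
    have : 0 ≤ 2 * B ^ 2 + B ^ 2 * (B ^ 2 + 1) := by positivity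
    linarith
  have hK0 : 0 < K := by linarith
  -- the cutoff in time
  set θ : ℝ → ℝ := fun τ => Real.smoothTransition ((τ - a) / (b - a)) with hθ
  have hba : 0 < b - a := by linarith
  have hθs : ContDiff ℝ ∞ θ :=
    Real.smoothTransition.contDiff.comp ((contDiff_id.sub contDiff_const).div_const _)
  have hθa : θ a = 0 := by simp [hθ]
  have hθ1 : ∀ τ, b ≤ τ → θ τ = 1 := fun τ hτ =>
    Real.smoothTransition.one_of_one_le (by rw [le_div_iff₀ hba]; linarith)
  have hθ0 : ∀ τ, 0 ≤ θ τ := fun τ => Real.smoothTransition.nonneg _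
  have hθle : ∀ τ, θ τ ≤ 1 := fun τ => Real.smoothTransition.le_one _
  have hθd : ∀ τ, HasDerivAt θ (deriv θ τ) τ := fun τ =>
    ((hθs.differentiable (by simp)) τ).hasDerivAt
  have hθ' : ∀ τ, b < τ → deriv θ τ = 0 := fun τ hτ => by
    have e : θ =ᶠ[𝓝 τ] fun _ => 1 := by
      filter_upwards [isOpen_Ioi.mem_nhds hτ] with w hw using hθ1 w (le_of_lt hw)
    rw [e.deriv_eq]; simp
  obtain ⟨Θ, hΘ⟩ := (isCompact_Icc (a := a) (b := t)).exists_bound_of_continuousOn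
    ((hθs.continuous_deriv (by simp)).continuousOn)
  have hΘ0 : 0 ≤ Θ := (norm_nonneg _).trans (hΘ a ⟨le_rfl, hat.le⟩)
  set I := ∫ x, axisWeight x with hI
  have hI0 : 0 ≤ I := integral_nonneg axisWeight_nonneg
  -- The constant depends neither on Λ nor on R₀; this independence makes the final comparison work.
  refine ⟨K, (1 + B ^ 2) * ((t - a) * (2 * Θ ^ 2 * M ^ 2 * I)), hK0, fun R₀ hR₀ Λ hΛ => ?_⟩
  have hR₀0 : 0 < R₀ := by linarith
  set eΛ : ℝ → ℝ := fun τ => Real.exp (Λ * Real.exp (K * τ)) with heΛ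
  have heΛ0 : ∀ τ, 0 < eΛ τ := fun τ => Real.exp_pos _
  have heΛm : ∀ σ τ, σ ≤ τ → eΛ σ ≤ eΛ τ := fun σ τ h => by
    simp only [heΛ]; gcongr
  set φ₁ : ℝ → ℝ := fun τ => Λ * (K * Real.exp (K * τ)) with hφ₁
  set φ₂ : ℝ → ℝ := fun τ => Λ * (K * (K * Real.exp (K * τ))) with hφ₂
  have hexp : ∀ τ, HasDerivAt (fun τ => Real.exp (K * τ)) (K * Real.exp (K * τ)) τ := fun τ => by
    have := ((hasDerivAt_id τ).const_mul K).exp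
    refine this.congr_deriv ?_
    simp; ring
  have hφd : ∀ τ, HasDerivAt φ₁ (φ₂ τ) τ := fun τ => ((hexp τ).const_mul K).const_mul Λ
  have heΛd : ∀ τ, HasDerivAt eΛ (φ₁ τ * eΛ τ) τ := fun τ => by
    have := ((hexp τ).const_mul Λ).exp
    refine this.congr_deriv ?_
    simp only [hφ₁, heΛ]; ring
  set c : ℝ → ℝ := fun τ => eΛ τ * θ τ with hc
  set d : ℝ → ℝ := fun τ => eΛ τ * deriv θ τ with hd
  have hcd : ∀ τ, HasDerivAt c (φ₁ τ * c τ + d τ) τ := fun τ => by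
    refine ((heΛd τ).fun_mul (hθd τ)).congr_deriv ?_
    simp only [hc, hd]; ring
  have hcs : ContDiff ℝ ∞ c := by
    refine ContDiff.mul ?_ hθs
    simp only [heΛ]; fun_prop
  -- The derivative of the time cutoff vanishes after b, so this source sees the increasing weight
  -- at b at most.
  have hdle : ∀ τ ∈ Icc a t, |d τ| ≤ eΛ b * Θ := by
    intro τ hτ
    rw [hd, abs_mul, abs_of_pos (heΛ0 τ)]
    rcases le_or_gt τ b with h | h
    · have := hΘ τ hτ
      rw [Real.norm_eq_abs] at this
      have := heΛm τ b h
      have := heΛ0 b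
      gcongr
    · rw [hθ' τ h]
      have := heΛ0 b
      simp; positivity
  have hcle : ∀ τ ∈ Icc a t, c τ ^ 2 ≤ eΛ t ^ 2 := by
    intro τ hτ
    have h1 : c τ ≤ eΛ t * 1 := by
      have := heΛ0 t
      exact mul_le_mul (heΛm τ t hτ.2) (hθle τ) (hθ0 τ) this.le
    have h0 : 0 ≤ c τ := mul_nonneg (heΛ0 τ).le (hθ0 τ)
    rw [mul_one] at h1
    gcongr
  have hsq : ∀ τ ∈ Icc a t, ∀ x, Γ τ x ^ 2 ≤ M ^ 2 := fun τ hτ x =>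
    sq_le_sq' (abs_le.1 (hM τ hτ x)).1 (abs_le.1 (hM τ hτ x)).2
  have hwc : Continuous axisWeight := (contDiff_axisWeight (n := 0)).continuous
  set J := ∫ τ in s..t, ∫ x, axisWeight x * (cut R₀ x * Γ τ x ^ 2) with hJ
  -- The spatial cutoff contributes R^(-6) from the weighted error times (2R)³ from the local
  -- energy, hence O(R^(-3)) for fixed Λ, and disappears as R tends to infinity.
  have key : ∀ R : ℝ, 2 * R₀ ≤ R → eΛ s ^ 2 * J ≤
      (1 + B ^ 2) * ((t - a) * (2 * Θ ^ 2 * M ^ 2 * I)) * eΛ b ^ 2 +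
        (1 + B ^ 2) * (2 * eΛ t ^ 2 * C₁ * (C₂ * 8)) / R ^ 3 := by
    intro R hR
    have hR1 : 1 ≤ R := by linarith
    have hR0 : 0 < R := by linarith
    have h2R0 : 0 < 2 * R := by linarith
    set f : ℝ → Space3 → ℝ := fun τ x => c τ * (cut R x * Γ τ x) with hf
    have hfS : SlabSmooth T f := hS.cutoff hcs
    set P : ℝ := 2 * (eΛ b * Θ) ^ 2 * M ^ 2 with hP
    set Q : ℝ := 2 * eΛ t ^ 2 * (C₁ / R ^ 6) with hQ
    have hP0 : 0 ≤ P := by positivity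
    have hQ0 : 0 ≤ Q := by have := heΛ0 t; positivity
    set H₁ : Space3 → ℝ := fun x => P * (axisWeight x * cut R x ^ 2) with hH₁
    set H₂ : ℝ → Space3 → ℝ := fun τ x => (Γ τ x ^ 2 + gradSq (Γ τ) x) * cut (2 * R) x with hH₂
    set H : ℝ → Space3 → ℝ := fun τ x => H₁ x + Q * H₂ τ x with hH
    have hcutc : ∀ r : ℝ, Continuous (cut r) := fun r => (contDiff_cut (n := 0)).continuous
    have hH₁c : Continuous H₁ := by
      have := hcutc R
      simp only [hH₁]; fun_prop
    have cH₂ : SlabCont T H₂ := ((hS.slabCont.comp (η := fun y => y ^ 2) (by fun_prop)).add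
      hS.slabCont_gradSq).mul (SlabCont.of_space (hcutc (2 * R)))
    have cH : SlabCont T H := (SlabCont.of_space hH₁c).add
      ((SlabCont.of_time continuous_const).mul cH₂)
    have hK1c : IsCompact (tsupport (cut R)) := hasCompactSupport_cut hR0
    have hK2c : IsCompact (tsupport (cut (2 * R))) := hasCompactSupport_cut h2R0
    set KK := tsupport (cut R) ∪ tsupport (cut (2 * R)) with hKK
    have hKKc : IsCompact KK := hK1c.union hK2c
    have hz1 : ∀ x ∉ KK, cut R x = 0 := fun x hx =>
      image_eq_zero_of_notMem_tsupport fun h => hx (Or.inl h)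
    have hz2 : ∀ x ∉ KK, cut (2 * R) x = 0 := fun x hx =>
      image_eq_zero_of_notMem_tsupport fun h => hx (Or.inr h)
    have hmain := carleman_estimate (T := T) (B := B) (ρ := axisWeight) (f := f) (H := H)
      (φ₁ := φ₁) (φ₂ := φ₂) (s := a) (t := t) contDiff_axisWeight axisWeight_nonneg hfS cH hKKc
      (fun τ _ x hx => by simp [hf, hz1 x hx])
      (fun τ _ x hx => by simp [hH, hH₁, hH₂, hz1 x hx, hz2 x hx]) hφd
      (by simp only [hφ₂]; fun_prop) ha hat.le ht (fun x => by simp [hf, hc, hθa])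
      (fun x => by simp [hf, hzero x])
      (fun τ hτ => by
        have h1 : 1 ≤ φ₁ τ := by
          have e1 : 1 ≤ Real.exp (K * τ) := Real.one_le_exp (by
            have : 0 < τ := ha.trans_le hτ.1
            positivity)
          calc (1 : ℝ) = 1 * (1 * 1) := by norm_num
            _ ≤ φ₁ τ := by simp only [hφ₁]; gcongr
        have h2 : φ₂ τ = K * φ₁ τ := by simp only [hφ₁, hφ₂]; ring
        rw [h2, hK]
        have h3 : 0 ≤ B ^ 2 * (B ^ 2 + 1) + 1 := by positivity
        nlinarith)
      (fun τ hτ x => by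
        refine ⟨_, _, hΓ.cutoff_equation (hsub hτ) (hcd τ) R x, ?_, ?_⟩
        · rw [neg_sq]
          refine (sq_advect_le _ _ x).trans ?_
          have := gradSq_nonneg (f τ) x
          have := hdrift τ hτ x
          gcongr
        · have hw0 := axisWeight_nonneg x
          have e1 := hC₁ R hR1 (weightedDrift (v τ)) (Γ τ) x (hdrift τ hτ x)
          have e2 : d τ ^ 2 ≤ (eΛ b * Θ) ^ 2 :=
            sq_le_sq' (abs_le.1 (hdle τ hτ)).1 (abs_le.1 (hdle τ hτ)).2
          calc axisWeight x * (d τ * (cut R x * Γ τ x) +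
                c τ * cutError R (weightedDrift (v τ)) (Γ τ) x) ^ 2
              ≤ axisWeight x * (2 * (d τ * (cut R x * Γ τ x)) ^ 2 +
                2 * (c τ * cutError R (weightedDrift (v τ)) (Γ τ) x) ^ 2) := by
                gcongr; exact sq_add_le_two _ _
            _ = 2 * (d τ ^ 2 * Γ τ x ^ 2) * (axisWeight x * cut R x ^ 2) + 2 * c τ ^ 2 *
                (axisWeight x * cutError R (weightedDrift (v τ)) (Γ τ) x ^ 2) := by ring
            _ ≤ 2 * ((eΛ b * Θ) ^ 2 * M ^ 2) * (axisWeight x * cut R x ^ 2) + 2 * eΛ t ^ 2 *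
                (C₁ / R ^ 6 * ((Γ τ x ^ 2 + gradSq (Γ τ) x) * cut (2 * R) x)) := by
                have e3 := hsq τ hτ x
                have e4 := hcle τ hτ
                gcongr
            _ = H τ x := by simp only [hH, hH₁, hH₂, hP, hQ]; ring)
    have hIocut : ∫ x, axisWeight x * cut R x ^ 2 ≤ I := by
      refine integral_mono_of_nonneg (Eventually.of_forall fun x =>
        mul_nonneg (axisWeight_nonneg x) (sq_nonneg _)) integrable_axisWeight
        (Eventually.of_forall fun x => ?_)
      exact mul_le_of_le_one_right (axisWeight_nonneg x)
        (pow_le_one₀ (cut_nonneg x) (cut_le_one x))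
    have hsub' : uIcc a t ⊆ Ioo 0 T := by rwa [uIcc_of_le hat.le]
    have zH₂ : ∀ τ ∈ Ioo 0 T, ∀ x ∉ KK, H₂ τ x = 0 := fun τ _ x hx => by simp [hH₂, hz2 x hx]
    have iH₂ : IntervalIntegrable _ volume a t :=
      ((cH₂.continuousOn_integral hKKc zH₂).mono hsub').intervalIntegrable
    have jH₁ : Integrable H₁ := hH₁c.integrable_of_hasCompactSupport
      (HasCompactSupport.intro hKKc fun x hx => by simp [hH₁, hz1 x hx])
    have hHint : ∫ τ in a..t, ∫ x, H τ x ≤ (t - a) * (P * I) + Q * (C₂ * (2 * R) ^ 3) := by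
      have e1 : ∫ τ in a..t, ∫ x, H τ x = ∫ τ in a..t, ((∫ x, H₁ x) + Q * ∫ x, H₂ τ x) := by
        refine intervalIntegral.integral_congr fun τ hτ => ?_
        have jH₂ := cH₂.integrable_slice hKKc (hsub' hτ) (zH₂ τ (hsub' hτ))
        simp only [hH]
        rw [integral_add jH₁ (jH₂.const_mul _), integral_const_mul Q (H₂ τ)]
      rw [e1, intervalIntegral.integral_add (by simp) (iH₂.const_mul _),
        intervalIntegral.integral_const, intervalIntegral.integral_const_mul, smul_eq_mul]
      have e2 : ∫ x, H₁ x ≤ P * I := by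
        simp only [hH₁]
        rw [integral_const_mul]
        gcongr
      have e3 := hC₂ (2 * R) (by linarith)
      have e4 : 0 ≤ t - a := by linarith
      gcongr
    -- the lower bound
    have cF : SlabCont T fun τ x => axisWeight x * f τ x ^ 2 :=
      (SlabCont.of_space hwc).mul (hfS.slabCont.comp (η := fun y => y ^ 2) (by fun_prop))
    have zF : ∀ τ ∈ Ioo 0 T, ∀ x ∉ KK, axisWeight x * f τ x ^ 2 = 0 := fun τ _ x hx => by
      simp [hf, hz1 x hx]
    have iF : IntervalIntegrable (fun τ => ∫ x, axisWeight x * f τ x ^ 2) volume a t :=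
      ((cF.continuousOn_integral hKKc zF).mono hsub').intervalIntegrable
    have cJ : SlabCont T fun τ x => axisWeight x * (cut R₀ x * Γ τ x ^ 2) :=
      (SlabCont.of_space hwc).mul ((SlabCont.of_space (hcutc R₀)).mul
        (hS.slabCont.comp (η := fun y => y ^ 2) (by fun_prop)))
    have hK0c : IsCompact (tsupport (cut R₀)) := hasCompactSupport_cut hR₀0
    have zJ : ∀ τ ∈ Ioo 0 T, ∀ x ∉ tsupport (cut R₀),
        axisWeight x * (cut R₀ x * Γ τ x ^ 2) = 0 := fun τ _ x hx => by
      simp [image_eq_zero_of_notMem_tsupport hx]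
    have hsubs : Icc s t ⊆ Icc a t := Icc_subset_Icc (by linarith) le_rfl
    have iJ : IntervalIntegrable (fun τ => ∫ x, axisWeight x * (cut R₀ x * Γ τ x ^ 2))
        volume s t := ((cJ.continuousOn_integral hK0c zJ).mono (by
          rw [uIcc_of_le hst.le]; exact hsubs.trans hsub)).intervalIntegrable
    have iFs : IntervalIntegrable (fun τ => ∫ x, axisWeight x * f τ x ^ 2) volume s t :=
      iF.mono_set (by rw [uIcc_of_le hst.le, uIcc_of_le hat.le]; exact hsubs)
    have hlow : eΛ s ^ 2 * J ≤ ∫ τ in a..t, ∫ x, axisWeight x * f τ x ^ 2 := by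
      calc eΛ s ^ 2 * J = ∫ τ in s..t, eΛ s ^ 2 * ∫ x, axisWeight x * (cut R₀ x * Γ τ x ^ 2) := by
            rw [intervalIntegral.integral_const_mul]
        _ ≤ ∫ τ in s..t, ∫ x, axisWeight x * f τ x ^ 2 := by
            refine intervalIntegral.integral_mono_on hst.le (iJ.const_mul _) iFs fun τ hτ => ?_
            have hτ' := hsub (hsubs hτ)
            rw [← integral_const_mul]
            refine integral_mono ((cJ.integrable_slice hK0c hτ' (zJ τ hτ')).const_mul _)
              (cF.integrable_slice hKKc hτ' (zF τ hτ')) fun x => ?_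
            have h1 : c τ = eΛ τ := by
              simp only [hc]; rw [hθ1 τ (by linarith [hτ.1]), mul_one]
            have h2 : eΛ s ^ 2 ≤ eΛ τ ^ 2 := by
              have := heΛm s τ hτ.1
              have := heΛ0 s
              gcongr
            have h3 := cut_le_sq_cut hR₀0 hR x
            have h4 := axisWeight_nonneg x
            have h5 := cut_nonneg (R := R₀) x
            calc eΛ s ^ 2 * (axisWeight x * (cut R₀ x * Γ τ x ^ 2))
                ≤ eΛ τ ^ 2 * (axisWeight x * (cut R x ^ 2 * Γ τ x ^ 2)) := by gcongr
              _ = axisWeight x * f τ x ^ 2 := by simp only [hf, h1]; ring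
        _ ≤ ∫ τ in a..t, ∫ x, axisWeight x * f τ x ^ 2 := by
            refine intervalIntegral.integral_mono_interval (by linarith) hst.le le_rfl
              (Eventually.of_forall fun τ => integral_nonneg fun x =>
                mul_nonneg (axisWeight_nonneg x) (sq_nonneg _)) iF
    calc eΛ s ^ 2 * J ≤ (1 + B ^ 2) * ∫ τ in a..t, ∫ x, H τ x := hlow.trans hmain
      _ ≤ (1 + B ^ 2) * ((t - a) * (P * I) + Q * (C₂ * (2 * R) ^ 3)) := by gcongr
      _ = _ := by
        simp only [hP, hQ]
        field_simp
        ring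
  have hlim : Tendsto (fun R : ℝ => (1 + B ^ 2) * ((t - a) * (2 * Θ ^ 2 * M ^ 2 * I)) * eΛ b ^ 2 +
        (1 + B ^ 2) * (2 * eΛ t ^ 2 * C₁ * (C₂ * 8)) / R ^ 3) atTop
      (𝓝 ((1 + B ^ 2) * ((t - a) * (2 * Θ ^ 2 * M ^ 2 * I)) * eΛ b ^ 2 + 0)) :=
    tendsto_const_nhds.add (tendsto_const_nhds.div_atTop (tendsto_pow_atTop (by norm_num)))
  rw [add_zero] at hlim
  refine ge_of_tendsto hlim ?_
  filter_upwards [eventually_ge_atTop (2 * R₀)] with R hR using key R hR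

/-- Backward uniqueness. -/
lemma eq_zero_of_later_eq_zero (hv : IsSmoothVelocity T v)
    (hΓ : IsSmoothGammaSolution T q v Γ₀ Γ) {s t : ℝ} (hs : 0 < s) (hst : s < t) (ht : t < T)
    (hbdd : ∀ a, 0 < a → a ≤ t → ∃ M, ∀ τ ∈ Icc a t, ∀ x, |Γ τ x| ≤ M)
    (hzero : ∀ x, Γ t x = 0) (x : Space3) : Γ s x = 0 := by
  have hS := hΓ.slabSmooth
  have hsT : s ∈ Ioo 0 T := ⟨hs, hst.trans ht⟩
  have hsub : Icc s t ⊆ Ioo 0 T := fun τ hτ => ⟨hs.trans_le hτ.1, hτ.2.trans_lt ht⟩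
  have hcont : Continuous (Γ s) := hS.slabCont.slice hsT
  obtain ⟨M, hM⟩ := hbdd (s / 4) (by linarith) (by linarith)
  -- The time cutoff acts on [s/4, s/2], strictly before s, so the Carleman weight on [s, t] exceeds
  -- its value at the cutoff by a factor exponentially large in Λ.
  obtain ⟨K, Y, hK, hbound⟩ := hΓ.exists_carleman_bound hv (a := s / 4) (b := s / 2) (by linarith)
    (by linarith) (by linarith) hst ht hM hzero
  have hoff : ∀ x₁ : Space3, 0 < axisSq x₁ → Γ s x₁ = 0 := by
    intro x₁ hx₁
    by_contra hne
    set R₀ := 1 + ‖x₁‖ with hR₀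
    have hR1 : 1 ≤ R₀ := by have := norm_nonneg x₁; linarith
    have hR0 : 0 < R₀ := by linarith
    have hwc : Continuous axisWeight := (contDiff_axisWeight (n := 0)).continuous
    have hcutc : Continuous (cut R₀) := (contDiff_cut (n := 0)).continuous
    have cJ : SlabCont T fun τ x => axisWeight x * (cut R₀ x * Γ τ x ^ 2) :=
      (SlabCont.of_space hwc).mul ((SlabCont.of_space hcutc).mul
        (hS.slabCont.comp (η := fun y => y ^ 2) (by fun_prop)))
    have hK0c : IsCompact (tsupport (cut R₀)) := hasCompactSupport_cut hR0
    have zJ : ∀ τ ∈ Ioo 0 T, ∀ x ∉ tsupport (cut R₀),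
        axisWeight x * (cut R₀ x * Γ τ x ^ 2) = 0 := fun τ _ x hx => by
      simp [image_eq_zero_of_notMem_tsupport hx]
    have hnn : ∀ τ x, 0 ≤ axisWeight x * (cut R₀ x * Γ τ x ^ 2) := fun τ x =>
      mul_nonneg (axisWeight_nonneg x) (mul_nonneg (cut_nonneg x) (sq_nonneg _))
    have hpos : 0 < ∫ x, axisWeight x * (cut R₀ x * Γ s x ^ 2) := by
      refine (cJ.slice hsT).integral_pos_of_hasCompactSupport_nonneg_nonzero
        (HasCompactSupport.intro hK0c (zJ s hsT)) (hnn s) (x := x₁) (ne_of_gt ?_)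
      have h1 : cut R₀ x₁ = 1 := cut_eq_one hR0 (by
        rw [normSq3_eq, hR₀]; have := norm_nonneg x₁; gcongr; linarith)
      have h2 : 0 < axisWeight x₁ := by
        have := one_add_normSq3_pos x₁
        unfold axisWeight; positivity
      rw [h1]
      positivity
    have hJpos : 0 < ∫ τ in s..t, ∫ x, axisWeight x * (cut R₀ x * Γ τ x ^ 2) :=
      intervalIntegral.integral_pos hst ((cJ.continuousOn_integral hK0c zJ).mono hsub)
        (fun τ _ => integral_nonneg (hnn τ)) ⟨s, ⟨le_rfl, hst.le⟩, hpos⟩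
    set J := ∫ τ in s..t, ∫ x, axisWeight x * (cut R₀ x * Γ τ x ^ 2)
    set δ := Real.exp (K * s) - Real.exp (K * (s / 2)) with hδ
    have hδ0 : 0 < δ := by
      rw [hδ, sub_pos]
      exact Real.exp_lt_exp.2 (by nlinarith)
    -- After division by the weight at s/2 the left side grows exponentially in Λ unless J = 0.
    have hle : ∀ Λ : ℝ, 1 ≤ Λ → J * Real.exp (Λ * δ) ^ 2 ≤ Y := by
      intro Λ hΛ
      have h1 := hbound R₀ hR1 Λ hΛ
      have e1 : Real.exp (Λ * Real.exp (K * s)) =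
          Real.exp (Λ * δ) * Real.exp (Λ * Real.exp (K * (s / 2))) := by
        rw [← Real.exp_add, hδ]; ring_nf
      rw [e1] at h1
      have h2 : 0 < Real.exp (Λ * Real.exp (K * (s / 2))) ^ 2 := by positivity
      refine le_of_mul_le_mul_right (le_of_eq_of_le ?_ h1) h2
      ring
    have htend : Tendsto (fun Λ : ℝ => J * Real.exp (Λ * δ) ^ 2) atTop atTop :=
      ((tendsto_pow_atTop (by norm_num)).comp (Real.tendsto_exp_atTop.comp
        (tendsto_id.atTop_mul_const hδ0))).const_mul_atTop hJpos
    obtain ⟨Λ, h1, h2⟩ := ((htend.eventually_gt_atTop Y).and (eventually_ge_atTop 1)).exists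
    exact absurd (hle Λ h2) (not_le.2 h1)
  have hae : Γ s =ᵐ[volume] fun _ => 0 := by
    filter_upwards [ae_axisSq_pos] with y hy using hoff y hy
  exact congrFun ((hcont.ae_eq_iff_eq volume continuous_const).1 hae) x

end IsSmoothGammaSolution

/-! ### From excesses to L^p norms. -/

/-- The integral of the excess of `|f|` over the level `k`, with values in `[0, ∞]`. -/
def absExcess (f : Space3 → ℝ) (k : ℝ) : ℝ≥0∞ := ∫⁻ x, ENNReal.ofReal (|f x| - k)

lemma antitone_absExcess (f : Space3 → ℝ) : Antitone (absExcess f) := fun _ _ h =>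
  lintegral_mono fun _ => ENNReal.ofReal_le_ofReal (by linarith)

lemma aemeasurable_absExcess_integrand {f : Space3 → ℝ} (hf : AEStronglyMeasurable f volume)
    (k : ℝ) : AEMeasurable fun x => ENNReal.ofReal (|f x| - k) := by
  have : AEMeasurable fun x => |f x| := hf.norm.aemeasurable
  exact (this.sub_const k).ennreal_ofReal

/-- Taylor's formula with integral remainder for y^p/(p(p-1)), whose second derivative is y^(p-2)
and whose value and slope at 0 vanish as p > 1. -/
lemma lintegral_rpow_mul_sub {p y : ℝ} (hp : 1 < p) (hy : 0 ≤ y) :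
    ∫⁻ k in Ioi (0 : ℝ), ENNReal.ofReal (k ^ (p - 2)) * ENNReal.ofReal (y - k) =
      ENNReal.ofReal (y ^ p / (p * (p - 1))) := by
  have hz : ∫⁻ k in Ioi y, ENNReal.ofReal (k ^ (p - 2)) * ENNReal.ofReal (y - k) = 0 := by
    rw [setLIntegral_congr_fun measurableSet_Ioi (g := fun _ => 0) fun k hk => by
      have : y < k := hk
      simp [ENNReal.ofReal_of_nonpos (show y - k ≤ 0 by linarith)]]
    simp
  rw [← Ioc_union_Ioi_eq_Ioi hy, lintegral_union measurableSet_Ioi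
    (Set.disjoint_left.2 fun k h1 h2 => absurd h1.2 (not_le.2 h2)), hz, add_zero]
  have hi1 : IntervalIntegrable (fun k : ℝ => k ^ (p - 2)) volume 0 y :=
    intervalIntegral.intervalIntegrable_rpow' (by linarith)
  have hi : IntervalIntegrable (fun k : ℝ => k ^ (p - 2) * (y - k)) volume 0 y :=
    hi1.mul_continuousOn (by fun_prop)
  have hi2 : IntervalIntegrable (fun k : ℝ => k ^ (p - 1)) volume 0 y :=
    intervalIntegral.intervalIntegrable_rpow' (by linarith)
  have e1 : ∫⁻ k in Ioc 0 y, ENNReal.ofReal (k ^ (p - 2)) * ENNReal.ofReal (y - k) =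
      ∫⁻ k in Ioc 0 y, ENNReal.ofReal (k ^ (p - 2) * (y - k)) :=
    setLIntegral_congr_fun measurableSet_Ioc fun k hk =>
      (ENNReal.ofReal_mul (Real.rpow_nonneg hk.1.le _)).symm
  have hnn : 0 ≤ᵐ[volume.restrict (Ioc 0 y)] fun k : ℝ => k ^ (p - 2) * (y - k) := by
    filter_upwards [self_mem_ae_restrict measurableSet_Ioc] with k hk
    exact mul_nonneg (Real.rpow_nonneg hk.1.le _) (by linarith [hk.2])
  rw [e1, ← ofReal_integral_eq_lintegral_ofReal
    ((intervalIntegrable_iff_integrableOn_Ioc_of_le hy).1 hi) hnn,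
    ← intervalIntegral.integral_of_le hy]
  congr 1
  have e2 : ∫ k in (0 : ℝ)..y, k ^ (p - 2) * (y - k) =
      ∫ k in (0 : ℝ)..y, (y * k ^ (p - 2) - k ^ (p - 1)) := by
    rw [intervalIntegral.integral_of_le hy, intervalIntegral.integral_of_le hy]
    refine setIntegral_congr_fun measurableSet_Ioc fun k hk => ?_
    have : k ^ (p - 1) = k ^ (p - 2) * k := by
      rw [← Real.rpow_add_one hk.1.ne']; ring_nf
    simp only [this]; ring
  rw [e2, intervalIntegral.integral_sub (hi1.const_mul y) hi2, intervalIntegral.integral_const_mul,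
    integral_rpow (Or.inl (by linarith)), integral_rpow (Or.inl (by linarith))]
  have h1 : p - 1 ≠ 0 := by linarith
  have h0 : p ≠ 0 := by linarith
  rw [show p - 2 + 1 = p - 1 by ring, show p - 1 + 1 = p by ring, Real.zero_rpow h1,
    Real.zero_rpow h0]
  rcases hy.eq_or_lt with rfl | hy'
  · simp [Real.zero_rpow h0]
  · have : y ^ p = y * y ^ (p - 1) := by
      rw [mul_comm, ← Real.rpow_add_one hy'.ne']; ring_nf
    rw [this]
    field_simp
    ring

/-- The layer-cake identity integrated in x by Tonelli. The density k^(p-2) is positive, so both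
weak and strict comparisons of excesses pass to L^p norms. -/
lemma lintegral_enorm_rpow_eq {f : Space3 → ℝ} (hf : AEStronglyMeasurable f volume) {p : ℝ}
    (hp : 1 < p) : ∫⁻ x, ‖f x‖ₑ ^ p = ENNReal.ofReal (p * (p - 1)) *
      ∫⁻ k in Ioi (0 : ℝ), ENNReal.ofReal (k ^ (p - 2)) * absExcess f k := by
  have hpp : 0 < p * (p - 1) := mul_pos (by linarith) (by linarith)
  have h1 : ∀ x, ‖f x‖ₑ ^ p = ENNReal.ofReal (p * (p - 1)) *
      ∫⁻ k in Ioi (0 : ℝ), ENNReal.ofReal (k ^ (p - 2)) * ENNReal.ofReal (|f x| - k) := by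
    intro x
    rw [lintegral_rpow_mul_sub hp (abs_nonneg _), ← ENNReal.ofReal_mul hpp.le,
      mul_div_cancel₀ _ hpp.ne', Real.enorm_eq_ofReal_abs, ENNReal.ofReal_rpow_of_nonneg
      (abs_nonneg _) (by linarith)]
  have hm : AEMeasurable (Function.uncurry fun (x : Space3) (k : ℝ) =>
      ENNReal.ofReal (k ^ (p - 2)) * ENNReal.ofReal (|f x| - k))
      (volume.prod (volume.restrict (Ioi (0 : ℝ)))) := by
    have hfst : AEMeasurable (fun z : Space3 × ℝ => |f z.1|)
        (volume.prod (volume.restrict (Ioi (0 : ℝ)))) :=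
      (hf.norm.aemeasurable).comp_quasiMeasurePreserving Measure.quasiMeasurePreserving_fst
    have hsnd : AEMeasurable (fun z : Space3 × ℝ => z.2)
        (volume.prod (volume.restrict (Ioi (0 : ℝ)))) := measurable_snd.aemeasurable
    exact (hsnd.pow_const _).ennreal_ofReal.mul (hfst.sub hsnd).ennreal_ofReal
  simp only [h1]
  rw [lintegral_const_mul' _ _ ENNReal.ofReal_ne_top, lintegral_lintegral_swap hm]
  congr 1
  refine lintegral_congr fun k => ?_
  rw [lintegral_const_mul' _ _ ENNReal.ofReal_ne_top, absExcess]

lemma tendsto_absExcess_zero {f : Space3 → ℝ} (hf : AEStronglyMeasurable f volume) :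
    Tendsto (fun n : ℕ => absExcess f (1 / ((n : ℝ) + 1))) atTop (𝓝 (absExcess f 0)) := by
  refine lintegral_tendsto_of_tendsto_of_monotone
    (fun n => aemeasurable_absExcess_integrand hf _) (Eventually.of_forall fun x m n h => ?_)
    (Eventually.of_forall fun x => ?_)
  · refine ENNReal.ofReal_le_ofReal ?_
    have : (1 : ℝ) / ((n : ℝ) + 1) ≤ 1 / ((m : ℝ) + 1) := by gcongr
    linarith
  · exact ENNReal.tendsto_ofReal (tendsto_const_nhds.sub tendsto_one_div_add_atTop_nhds_zero_nat)

lemma eLpNorm_one_eq_absExcess (f : Space3 → ℝ) : eLpNorm f 1 volume = absExcess f 0 := by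
  rw [eLpNorm_one_eq_lintegral_enorm, absExcess]
  exact lintegral_congr fun x => by rw [Real.enorm_eq_ofReal_abs, sub_zero]

lemma absExcess_zero_le {f g : Space3 → ℝ} (hf : AEStronglyMeasurable f volume)
    (h : ∀ k, 0 < k → absExcess f k ≤ absExcess g k) : absExcess f 0 ≤ absExcess g 0 :=
  le_of_tendsto' (tendsto_absExcess_zero hf) fun n =>
    (h _ (by positivity)).trans (antitone_absExcess g (by positivity))

lemma absExcess_eq_zero_iff {f : Space3 → ℝ} (hf : AEStronglyMeasurable f volume) {k : ℝ} :
    absExcess f k = 0 ↔ ∀ᵐ x, |f x| ≤ k := by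
  rw [absExcess, lintegral_eq_zero_iff' (aemeasurable_absExcess_integrand hf k)]
  refine eventually_congr (Eventually.of_forall fun x => ?_)
  simp

lemma eLpNorm_top_le_iff {f : Space3 → ℝ} {M : ℝ} (hM : 0 ≤ M) :
    eLpNorm f ⊤ volume ≤ ENNReal.ofReal M ↔ ∀ᵐ x, |f x| ≤ M := by
  rw [eLpNorm_exponent_top]
  refine ⟨fun h => ?_, fun h => eLpNormEssSup_le_of_ae_bound h⟩
  filter_upwards [ae_le_eLpNormEssSup (f := f) (μ := volume)] with x hx
  have := hx.trans h
  rwa [Real.enorm_eq_ofReal_abs, ENNReal.ofReal_le_ofReal_iff hM] at this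

/-- A comparison of the excesses over all levels gives a comparison of all `L^p` norms. -/
lemma eLpNorm_le_of_absExcess_le {f g : Space3 → ℝ} (hf : AEStronglyMeasurable f volume)
    (hg : AEStronglyMeasurable g volume) (h : ∀ k, 0 < k → absExcess f k ≤ absExcess g k)
    {p : ℝ≥0∞} (hp : 1 ≤ p) : eLpNorm f p volume ≤ eLpNorm g p volume := by
  rcases eq_or_ne p ⊤ with rfl | hp'
  · rcases eq_or_ne (eLpNorm g ⊤ volume) ⊤ with hgt | hgt
    · rw [hgt]; exact le_top
    · set M := (eLpNorm g ⊤ volume).toReal with hM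
      have hM0 : 0 ≤ M := ENNReal.toReal_nonneg
      have hMe : eLpNorm g ⊤ volume = ENNReal.ofReal M := (ENNReal.ofReal_toReal hgt).symm
      have hgM := (eLpNorm_top_le_iff hM0).1 hMe.le
      refine ENNReal.le_of_forall_pos_le_add fun ε hε _ => ?_
      have hε' : (0 : ℝ) < ε := hε
      -- Only positive levels are compared and M may be 0, hence the extra ε.
      have h1 : absExcess f (M + ε) = 0 := by
        refine le_antisymm ((h _ (by linarith)).trans_eq ((absExcess_eq_zero_iff hg).2 ?_))
          zero_le
        filter_upwards [hgM] with x hx using by linarith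
      have h2 := (eLpNorm_top_le_iff (by linarith)).2 ((absExcess_eq_zero_iff hf).1 h1)
      rw [ENNReal.ofReal_add hM0 hε'.le, ← hMe, ENNReal.ofReal_coe_nnreal] at h2
      exact h2
  rcases hp.eq_or_lt with rfl | hp1
  · rw [eLpNorm_one_eq_absExcess, eLpNorm_one_eq_absExcess]
    exact absExcess_zero_le hf h
  · have hpr : 1 < p.toReal := by
      rw [← ENNReal.toReal_one]; exact (ENNReal.toReal_lt_toReal (by simp) hp').2 hp1
    have hp0 : p ≠ 0 := (zero_lt_one.trans hp1).ne'
    rw [eLpNorm_eq_lintegral_rpow_enorm_toReal hp0 hp',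
      eLpNorm_eq_lintegral_rpow_enorm_toReal hp0 hp', lintegral_enorm_rpow_eq hf hpr,
      lintegral_enorm_rpow_eq hg hpr]
    refine ENNReal.rpow_le_rpow ?_ (by positivity)
    refine mul_le_mul' le_rfl (setLIntegral_mono' measurableSet_Ioi fun k hk => ?_)
    exact mul_le_mul' le_rfl (h k hk)

/-- The strict version of `eLpNorm_le_of_absExcess_le` for `1 < p < ∞`. -/
lemma eLpNorm_lt_of_absExcess_lt {f g : Space3 → ℝ} (hf : AEStronglyMeasurable f volume)
    (hg : AEStronglyMeasurable g volume) (h : ∀ k, 0 < k → absExcess f k ≤ absExcess g k)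
    {k₀ : ℝ} (hk₀ : 0 < k₀) (h' : ∀ k, 0 < k → k < k₀ → absExcess f k < absExcess g k)
    {p : ℝ≥0∞} (hp : 1 < p) (hp' : p ≠ ⊤) (hfin : eLpNorm f p volume ≠ ⊤) :
    eLpNorm f p volume < eLpNorm g p volume := by
  have hpr : 1 < p.toReal := by
    rw [← ENNReal.toReal_one]; exact (ENNReal.toReal_lt_toReal (by simp) hp').2 hp
  have hp0 : p ≠ 0 := (zero_lt_one.trans hp).ne'
  have hpp : 0 < p.toReal * (p.toReal - 1) := mul_pos (by linarith) (by linarith)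
  have hfin' := (lintegral_rpow_enorm_lt_top_of_eLpNorm_lt_top hp0 hp' hfin.lt_top).ne
  rw [eLpNorm_eq_lintegral_rpow_enorm_toReal hp0 hp',
    eLpNorm_eq_lintegral_rpow_enorm_toReal hp0 hp']
  refine ENNReal.rpow_lt_rpow ?_ (by positivity)
  rw [lintegral_enorm_rpow_eq hf hpr] at hfin' ⊢
  rw [lintegral_enorm_rpow_eq hg hpr]
  have hc0 : ENNReal.ofReal (p.toReal * (p.toReal - 1)) ≠ 0 := (ENNReal.ofReal_pos.2 hpp).ne'
  refine (ENNReal.mul_lt_mul_iff_right hc0 ENNReal.ofReal_ne_top).2 ?_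
  have hfin2 : ∫⁻ k in Ioi (0 : ℝ), ENNReal.ofReal (k ^ (p.toReal - 2)) * absExcess f k ≠ ⊤ :=
    fun htop => hfin' (by rw [htop]; exact ENNReal.mul_top hc0)
  -- Strictness on the interval (0, k₀) of positive measure suffices, since the smaller integral is
  -- finite.
  refine lintegral_strict_mono_of_ae_le_of_ae_lt_on (s := Ioo 0 k₀) ?_ hfin2 ?_ ?_ ?_
  · exact ((measurable_id.pow_const _).ennreal_ofReal.mul
      (antitone_absExcess g).measurable).aemeasurable
  · filter_upwards [self_mem_ae_restrict measurableSet_Ioi] with k hk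
    gcongr
    exact h k hk
  · rw [Measure.restrict_apply measurableSet_Ioo, inter_eq_left.2 Ioo_subset_Ioi_self]
    simp [hk₀]
  · refine Eventually.of_forall fun k hk => ?_
    refine (ENNReal.mul_lt_mul_iff_right ?_ ENNReal.ofReal_ne_top).2 (h' k hk.1 hk.2)
    have : 0 < k ^ (p.toReal - 2) := Real.rpow_pos_of_pos hk.1 _
    exact (ENNReal.ofReal_pos.2 this).ne'

lemma absExcess_eq_ofReal {f : Space3 → ℝ} {k : ℝ} (hk : 0 ≤ k)
    (h1 : Integrable fun x => max (f x - k) 0) (h2 : Integrable fun x => max (-f x - k) 0) :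
    absExcess f k = ENNReal.ofReal ((∫ x, max (f x - k) 0) + ∫ x, max (-f x - k) 0) := by
  rw [← integral_add h1 h2, ofReal_integral_eq_lintegral_ofReal
    (f := fun x => max (f x - k) 0 + max (-f x - k) 0) (h1.add h2)
    (Eventually.of_forall fun x => add_nonneg (le_max_right _ _) (le_max_right _ _)), absExcess]
  refine lintegral_congr fun x => ?_
  rcases le_total 0 (f x) with h | h
  · rw [abs_of_nonneg h, max_eq_right (show -f x - k ≤ 0 by linarith), add_zero,
      ENNReal.ofReal_max]
    simp
  · rw [abs_of_nonpos h, max_eq_right (show f x - k ≤ 0 by linarith), zero_add,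
      ENNReal.ofReal_max]
    simp

lemma memLp_of_memLp_of_bound {f : Space3 → ℝ} {q p : ℝ≥0∞} (hq : 1 ≤ q) (hqp : q ≤ p)
    (hf : MemLp f q volume) {M : ℝ} (hM : ∀ x, |f x| ≤ M) : MemLp f p volume := by
  have hM0 : 0 ≤ M := (abs_nonneg _).trans (hM 0)
  rcases eq_or_ne p ⊤ with rfl | hp'
  · exact memLp_top_of_bound hf.1 M (Eventually.of_forall hM)
  have hq' : q ≠ ⊤ := ne_top_of_le_ne_top hp' hqp
  have hq0 : q ≠ 0 := (zero_lt_one.trans_le hq).ne'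
  have hp0 : p ≠ 0 := (zero_lt_one.trans_le (hq.trans hqp)).ne'
  refine ⟨hf.1, (eLpNorm_lt_top_iff_lintegral_rpow_enorm_lt_top hp0 hp').2 ?_⟩
  have hle : q.toReal ≤ p.toReal := ENNReal.toReal_mono hp' hqp
  have h := (eLpNorm_lt_top_iff_lintegral_rpow_enorm_lt_top hq0 hq').1 hf.2
  have hb : ∀ x, ‖f x‖ₑ ^ p.toReal ≤
      ENNReal.ofReal M ^ (p.toReal - q.toReal) * ‖f x‖ₑ ^ q.toReal := by
    intro x
    have e : p.toReal = (p.toReal - q.toReal) + q.toReal := by ring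
    rw [e, ENNReal.rpow_add_of_nonneg _ _ (by linarith) ENNReal.toReal_nonneg, ← e]
    refine mul_le_mul' (ENNReal.rpow_le_rpow ?_ (by linarith)) le_rfl
    rw [Real.enorm_eq_ofReal_abs]; exact ENNReal.ofReal_le_ofReal (hM x)
  have hc : ENNReal.ofReal M ^ (p.toReal - q.toReal) ≠ ⊤ :=
    ENNReal.rpow_ne_top_of_nonneg (by linarith) ENNReal.ofReal_ne_top
  refine (lintegral_mono hb).trans_lt ?_
  rw [lintegral_const_mul' _ _ hc]
  exact ENNReal.mul_lt_top hc.lt_top h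

/-! ### Decrease of the L^p norms of the solution. -/

namespace IsSmoothGammaSolution

variable {T : ℝ} {q : ℝ≥0∞} {v : ℝ → Space3 → Space3} {Γ₀ : Space3 → ℝ} {Γ : ℝ → Space3 → ℝ}

lemma continuous_slice (hΓ : IsSmoothGammaSolution T q v Γ₀ Γ) {t : ℝ} (ht : t ∈ Ioo 0 T) :
    Continuous (Γ t) := hΓ.slabSmooth.slabCont.slice ht

lemma absExcess_antitone (hv : IsSmoothVelocity T v) (hΓ : IsSmoothGammaSolution T q v Γ₀ Γ)
    (hq : 1 ≤ q) (hq' : q ≠ ⊤) {k s t : ℝ} (hk : 0 < k) (hs : 0 ≤ s) (hst : s ≤ t) (ht : t < T) :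
    absExcess (Γ t) k ≤ absExcess (Γ s) k := by
  have hsI : s ∈ Ico 0 T := ⟨hs, hst.trans_lt ht⟩
  have htI : t ∈ Ico 0 T := ⟨hs.trans hst, ht⟩
  rw [absExcess_eq_ofReal hk.le (hΓ.integrable_excess hq hq' hk htI)
      (hΓ.neg.integrable_excess hq hq' hk htI),
    absExcess_eq_ofReal hk.le (hΓ.integrable_excess hq hq' hk hsI)
      (hΓ.neg.integrable_excess hq hq' hk hsI)]
  exact ENNReal.ofReal_le_ofReal (add_le_add (hΓ.excess_antitone hv hq hq' hk hs hst ht)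
    (hΓ.neg.excess_antitone hv hq hq' hk hs hst ht))

lemma eLpNorm_antitone (hv : IsSmoothVelocity T v) (hΓ : IsSmoothGammaSolution T q v Γ₀ Γ)
    (hq : 1 ≤ q) (hq' : q ≠ ⊤) {p : ℝ≥0∞} (hp : 1 ≤ p) {s t : ℝ} (hs : 0 ≤ s) (hst : s ≤ t)
    (ht : t < T) : eLpNorm (Γ t) p volume ≤ eLpNorm (Γ s) p volume :=
  eLpNorm_le_of_absExcess_le (hΓ.memLp t ⟨hs.trans hst, ht⟩).1
    (hΓ.memLp s ⟨hs, hst.trans_lt ht⟩).1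
    (fun _ hk => hΓ.absExcess_antitone hv hq hq' hk hs hst ht) hp

lemma eLpNorm_le_initial (hv : IsSmoothVelocity T v) (hΓ : IsSmoothGammaSolution T q v Γ₀ Γ)
    (hq : 1 ≤ q) (hq' : q ≠ ⊤) {p : ℝ≥0∞} (hp : 1 ≤ p) {t : ℝ} (ht : t ∈ Ico 0 T) :
    eLpNorm (Γ t) p volume ≤ eLpNorm Γ₀ p volume :=
  (hΓ.eLpNorm_antitone hv hq hq' hp le_rfl ht.1 ht.2).trans_eq (eLpNorm_congr_ae hΓ.initial)

/-- A positive upper bound persists. -/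
lemma le_of_forall_le (hv : IsSmoothVelocity T v) (hΓ : IsSmoothGammaSolution T q v Γ₀ Γ)
    (hq : 1 ≤ q) (hq' : q ≠ ⊤) {k s t : ℝ} (hk : 0 < k) (hs : 0 < s) (hst : s ≤ t) (ht : t < T)
    (hle : ∀ x, Γ s x ≤ k) (x : Space3) : Γ t x ≤ k := by
  have h0 : excess Γ k s = 0 := by simp [excess, hle]
  have h1 : excess Γ k t = 0 :=
    le_antisymm ((hΓ.excess_antitone hv hq hq' hk hs.le hst ht).trans_eq h0) (excess_nonneg _ _ _)
  have htI : t ∈ Ioo 0 T := ⟨hs.trans_le hst, ht⟩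
  have hc : Continuous fun x => max (Γ t x - k) 0 :=
    ((hΓ.continuous_slice htI).sub continuous_const).max continuous_const
  have hae := (integral_eq_zero_iff_of_nonneg (fun _ => le_max_right _ _)
    (hΓ.integrable_excess hq hq' hk ⟨htI.1.le, ht⟩)).1 h1
  have : max (Γ t x - k) 0 = 0 :=
    congrFun ((hc.ae_eq_iff_eq volume continuous_const).1 hae) x
  have h2 : Γ t x - k ≤ 0 := (le_max_left _ _).trans_eq this
  linarith

/-- Smoothing from time a/2 to a at level 1, with h large enough to absorb the finite excess. -/
lemma exists_forall_le (hv : IsSmoothVelocity T v) (hΓ : IsSmoothGammaSolution T q v Γ₀ Γ)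
    (hq : 1 ≤ q) (hq' : q ≠ ⊤) {a : ℝ} (ha : 0 < a) (haT : a < T) :
    ∃ M : ℝ, 0 < M ∧ ∀ x, Γ a x ≤ M := by
  obtain ⟨c, hc, h⟩ := exists_smoothing (half_pos ha) (half_lt_self ha)
  have he := excess_nonneg Γ 1 (a / 2)
  have hpos : 0 < (excess Γ 1 (a / 2) + 1) / c := by positivity
  refine ⟨1 + (excess Γ 1 (a / 2) + 1) / c, by positivity,
    h hv hΓ hq hq' haT 1 _ one_pos hpos ?_⟩
  rw [mul_div_cancel₀ _ hc.ne']
  linarith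

lemma exists_abs_le (hv : IsSmoothVelocity T v) (hΓ : IsSmoothGammaSolution T q v Γ₀ Γ)
    (hq : 1 ≤ q) (hq' : q ≠ ⊤) {a t : ℝ} (ha : 0 < a) (haT : a < T) (ht : t < T) :
    ∃ M : ℝ, ∀ τ ∈ Icc a t, ∀ x, |Γ τ x| ≤ M := by
  obtain ⟨M₁, h₁, hM₁⟩ := hΓ.exists_forall_le hv hq hq' ha haT
  obtain ⟨M₂, h₂, hM₂⟩ := hΓ.neg.exists_forall_le hv hq hq' ha haT
  refine ⟨max M₁ M₂, fun τ hτ x => abs_le'.2 ⟨?_, ?_⟩⟩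
  · exact (hΓ.le_of_forall_le hv hq hq' h₁ ha hτ.1 (hτ.2.trans_lt ht) hM₁ x).trans
      (le_max_left _ _)
  · exact (hΓ.neg.le_of_forall_le hv hq hq' h₂ ha hτ.1 (hτ.2.trans_lt ht) hM₂ x).trans
      (le_max_right _ _)

/-- A solution with nonzero initial value is nonzero at all times. -/
lemma exists_ne_zero (hv : IsSmoothVelocity T v) (hΓ : IsSmoothGammaSolution T q v Γ₀ Γ)
    (hq : 1 ≤ q) (hq' : q ≠ ⊤) (h0 : ¬ Γ₀ =ᵐ[volume] 0) {t : ℝ} (ht : t ∈ Ioo 0 T) :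
    ∃ x, Γ t x ≠ 0 := by
  by_contra! hz
  -- Backward uniqueness spreads the zero to all earlier positive times, and L^q continuity at 0
  -- then forces the initial value to vanish.
  have hzero : ∀ s ∈ Ioo 0 t, Γ s = 0 := fun s hs => funext fun x =>
    hΓ.eq_zero_of_later_eq_zero hv hs.1 hs.2 ht.2
      (fun a ha hat => hΓ.exists_abs_le hv hq hq' ha (hat.trans_lt ht.2) ht.2) hz x
  have hT : (0 : ℝ) ∈ Ico 0 T := ⟨le_rfl, ht.1.trans ht.2⟩
  have hsub : Ioo 0 t ⊆ Ico 0 T := fun s hs => ⟨hs.1.le, hs.2.trans ht.2⟩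
  have hlim : Tendsto (fun s => eLpNorm (Γ s - Γ 0) q volume) (𝓝[Ioo 0 t] 0) (𝓝 0) :=
    (hΓ.continuous_Lq 0 hT).mono_left (nhdsWithin_mono _ hsub)
  have hconst : Tendsto (fun s => eLpNorm (Γ s - Γ 0) q volume) (𝓝[Ioo 0 t] 0)
      (𝓝 (eLpNorm (Γ 0) q volume)) := by
    refine tendsto_const_nhds.congr' ?_
    filter_upwards [self_mem_nhdsWithin] with s hs
    rw [hzero s hs, zero_sub, eLpNorm_neg]
  have : (𝓝[Ioo 0 t] (0 : ℝ)).NeBot := left_nhdsWithin_Ioo_neBot ht.1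
  have h := tendsto_nhds_unique hconst hlim
  rw [eLpNorm_eq_zero_iff (hΓ.memLp 0 hT).1 (zero_lt_one.trans_le hq).ne'] at h
  exact h0 (hΓ.initial.symm.trans h)

/-- The excess of `|Γ|` over a level that it exceeds somewhere is strictly decreasing. -/
lemma absExcess_lt (hv : IsSmoothVelocity T v) (hΓ : IsSmoothGammaSolution T q v Γ₀ Γ)
    {k M N s t : ℝ} (hk : 0 ≤ k) (hs : 0 < s) (hst : s < t) (ht : t < T)
    (hM : ∀ τ ∈ Icc s t, Integrable (fun x => max (Γ τ x - k) 0) ∧ excess Γ k τ ≤ M)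
    (hN : ∀ τ ∈ Icc s t, Integrable (fun x => max (-Γ τ x - k) 0) ∧
      excess (fun t x => -Γ t x) k τ ≤ N)
    {x₀ : Space3} (hx₀ : k < |Γ s x₀|) : absExcess (Γ t) k < absExcess (Γ s) k := by
  have hsm : s ∈ Icc s t := ⟨le_rfl, hst.le⟩
  have htm : t ∈ Icc s t := ⟨hst.le, le_rfl⟩
  rw [absExcess_eq_ofReal hk (hM t htm).1 (hN t htm).1,
    absExcess_eq_ofReal hk (hM s hsm).1 (hN s hsm).1]
  have h1 : excess Γ k t ≤ excess Γ k s := hΓ.excess_le_of_integrable hv hs hst.le ht hM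
  have h2 : excess (fun t x => -Γ t x) k t ≤ excess (fun t x => -Γ t x) k s :=
    hΓ.neg.excess_le_of_integrable hv hs hst.le ht hN
  have h3 : excess Γ k t + excess (fun t x => -Γ t x) k t <
      excess Γ k s + excess (fun t x => -Γ t x) k s := by
    rcases lt_abs.1 hx₀ with h | h
    · exact add_lt_add_of_lt_of_le (hΓ.excess_lt hv hs hst ht hM h) h2
    · exact add_lt_add_of_le_of_lt h1 (hΓ.neg.excess_lt hv hs hst ht hN h)
  exact (ENNReal.ofReal_lt_ofReal_iff ((add_nonneg (excess_nonneg _ _ _)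
    (excess_nonneg _ _ _)).trans_lt h3)).2 h3

/-- Strict decrease of the `L^p` norm for `1 < p < ∞`. -/
lemma eLpNorm_lt_of_one_lt (hv : IsSmoothVelocity T v) (hΓ : IsSmoothGammaSolution T q v Γ₀ Γ)
    (hq : 1 ≤ q) (hq' : q ≠ ⊤) {p : ℝ≥0∞} (hp : 1 < p) (hp' : p ≠ ⊤) {s t : ℝ} (hs : 0 < s)
    (hst : s < t) (ht : t < T) (hfin : eLpNorm (Γ t) p volume ≠ ⊤) {x₀ : Space3}
    (hx₀ : Γ s x₀ ≠ 0) : eLpNorm (Γ t) p volume < eLpNorm (Γ s) p volume := by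
  refine eLpNorm_lt_of_absExcess_lt (hΓ.memLp t ⟨(hs.trans hst).le, ht⟩).1
    (hΓ.memLp s ⟨hs.le, hst.trans ht⟩).1
    (fun k hk => hΓ.absExcess_antitone hv hq hq' hk hs.le hst.le ht)
    -- The strict range of levels is 0 < k < |Γ(s, x₀)|, where the level is exceeded at x₀.
    (abs_pos.2 hx₀) (fun k hk hk' => ?_) hp hp' hfin
  have hmem : ∀ τ ∈ Icc s t, τ ∈ Ico 0 T := fun τ hτ => ⟨hs.le.trans hτ.1, hτ.2.trans_lt ht⟩
  exact hΓ.absExcess_lt hv (M := excess Γ k s) (N := excess (fun t x => -Γ t x) k s) hk.le hs hst ht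
    (fun τ hτ => ⟨hΓ.integrable_excess hq hq' hk (hmem τ hτ),
      hΓ.excess_antitone hv hq hq' hk hs.le hτ.1 (hτ.2.trans_lt ht)⟩)
    (fun τ hτ => ⟨hΓ.neg.integrable_excess hq hq' hk (hmem τ hτ),
      hΓ.neg.excess_antitone hv hq hq' hk hs.le hτ.1 (hτ.2.trans_lt ht)⟩) hk'

/-- Strict decrease of the `L^1` norm. -/
lemma eLpNorm_one_lt (hv : IsSmoothVelocity T v) (hΓ : IsSmoothGammaSolution T q v Γ₀ Γ)
    (hq : 1 ≤ q) (hq' : q ≠ ⊤) {s t : ℝ} (hs : 0 < s)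
    (hst : s < t) (ht : t < T) (hfin : eLpNorm (Γ t) 1 volume ≠ ⊤) {x₀ : Space3}
    (hx₀ : Γ s x₀ ≠ 0) : eLpNorm (Γ t) 1 volume < eLpNorm (Γ s) 1 volume := by
  -- If the earlier norm is infinite, finiteness of the later one suffices. Otherwise the solution
  -- is integrable on [s, t] and the level k = 0 is admissible.
  rcases eq_or_ne (eLpNorm (Γ s) 1 volume) ⊤ with htop | hne
  · rw [htop]; exact hfin.lt_top
  have hint : ∀ τ ∈ Icc s t, Integrable (Γ τ) := fun τ hτ => memLp_one_iff_integrable.1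
    ⟨(hΓ.memLp τ ⟨hs.le.trans hτ.1, hτ.2.trans_lt ht⟩).1,
      (hΓ.eLpNorm_antitone hv hq hq' le_rfl hs.le hτ.1 (hτ.2.trans_lt ht)).trans_lt hne.lt_top⟩
  have hbd : ∀ τ ∈ Icc s t, ∫ x, |Γ τ x| ≤ (eLpNorm (Γ s) 1 volume).toReal := by
    intro τ hτ
    have h := hΓ.eLpNorm_antitone hv hq hq' le_rfl hs.le hτ.1 (hτ.2.trans_lt ht)
    refine le_trans (le_of_eq ?_) (ENNReal.toReal_mono hne h)
    rw [eLpNorm_one_eq_lintegral_enorm, ← integral_norm_eq_lintegral_enorm (hint τ hτ).1]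
    rfl
  have hpos : ∀ f : Space3 → ℝ, Integrable f → Integrable fun x => max (f x - 0) 0 := by
    intro f hf
    simpa using hf.pos_part
  rw [eLpNorm_one_eq_absExcess, eLpNorm_one_eq_absExcess]
  refine hΓ.absExcess_lt hv le_rfl hs hst ht (fun τ hτ => ⟨hpos _ (hint τ hτ), le_trans ?_ (hbd τ hτ)⟩)
    (fun τ hτ => ⟨hpos _ (hint τ hτ).neg, le_trans ?_ (hbd τ hτ)⟩) (abs_pos.2 hx₀)
  · exact integral_mono (hpos _ (hint τ hτ)) (hint τ hτ).abs
      fun x => max_le (by simpa using le_abs_self _) (abs_nonneg _)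
  · exact integral_mono (hpos _ (hint τ hτ).neg) (hint τ hτ).abs
      fun x => max_le (by simpa using neg_le_abs _) (abs_nonneg _)

/-- A positive upper bound improves at later times. -/
lemma exists_lt_forall_le (hv : IsSmoothVelocity T v) (hΓ : IsSmoothGammaSolution T q v Γ₀ Γ)
    (hq : 1 ≤ q) (hq' : q ≠ ⊤) {M s t : ℝ} (hM0 : 0 < M) (hs : 0 < s) (hst : s < t) (ht : t < T)
    (hM : ∀ x, Γ s x ≤ M) : ∃ M' < M, ∀ x, Γ t x ≤ M' := by
  set u : ℝ := (s + t) / 2 with hu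
  have hsu : s < u := by linarith
  have hut : u < t := by linarith
  have huT : u < T := hut.trans ht
  have huI : u ∈ Ico 0 T := ⟨(hs.trans hsu).le, huT⟩
  have hMτ : ∀ τ ∈ Icc s u, ∀ x, Γ τ x ≤ M := fun τ hτ =>
    hΓ.le_of_forall_le hv hq hq' hM0 hs hτ.1 (hτ.2.trans_lt huT) hM
  -- Otherwise Γ(s) = M > 0 almost everywhere, and the excess over M/2 would be a positive constant
  -- with finite integral over ℝ³.
  obtain ⟨y, hy, hyM⟩ : ∃ y, 0 < axisSq y ∧ Γ s y < M := by
    by_contra! hcon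
    have hint := hΓ.integrable_excess hq hq' (half_pos hM0) (t := s) ⟨hs.le, hst.trans ht⟩
    have hae : (fun x => max (Γ s x - M / 2) 0) =ᵐ[volume] fun _ => M / 2 := by
      filter_upwards [ae_axisSq_pos] with x hx
      rw [le_antisymm (hM x) (hcon x hx), max_eq_left (by linarith)]; ring
    have := (integrable_congr hae).1 hint
    rw [integrable_const_iff] at this
    rcases this with h | h
    · linarith
    · have := (isFiniteMeasure_iff _).1 h
      simp at this
  have hlt : ∀ᵐ x, Γ u x < M := by
    filter_upwards [ae_axisSq_pos] with x hx
    exact hΓ.lt_of_exists_lt hv hs hsu huT hMτ hx hy hyM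
  obtain ⟨c, hc, hsm⟩ := exists_smoothing (hs.trans hsu) hut
  set k : ℕ → ℝ := fun n => M * (1 - 1 / ((n : ℝ) + 2)) with hk
  have hkM : ∀ n, M - k n = M / ((n : ℝ) + 2) := fun n => by simp only [hk]; ring
  have hd0 : ∀ n, 0 < M - k n := fun n => by rw [hkM]; positivity
  have hk2 : ∀ n, M / 2 ≤ k n := fun n => by
    have : M / ((n : ℝ) + 2) ≤ M / 2 :=
      div_le_div_of_nonneg_left hM0.le two_pos (by linarith [n.cast_nonneg (α := ℝ)])
    linarith [hkM n]
  have hint := hΓ.integrable_excess hq hq' (show 0 < M / 4 by linarith) huI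
  -- The quotient is at most 1 and vanishes unless Γ(u) > k_n ≥ M/2, where (Γ(u) - M/4)₊ · 4/M is at
  -- least 1; this integrable function dominates. For each x with Γ(u, x) < M the quotient is
  -- eventually 0.
  have hlim : Tendsto (fun n => ∫ x, max (Γ u x - k n) 0 / (M - k n)) atTop (𝓝 (∫ _ : Space3, 0)) := by
    refine tendsto_integral_of_dominated_convergence
      (fun x => max (Γ u x - M / 4) 0 * (4 / M)) (fun n => ?_) (hint.mul_const _) (fun n => ?_) ?_
    · exact ((hΓ.integrable_excess hq hq' (by linarith [hk2 n]) huI).div_const _).1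
    · refine Eventually.of_forall fun x => ?_
      rw [Real.norm_eq_abs, abs_of_nonneg (div_nonneg (le_max_right _ _) (hd0 n).le)]
      rcases le_total (Γ u x) (k n) with h | h
      · rw [max_eq_right (by linarith), zero_div]
        positivity
      · have hx := hMτ u ⟨hsu.le, le_rfl⟩ x
        rw [max_eq_left (by linarith), max_eq_left (by linarith [hk2 n])]
        have h1 : (Γ u x - k n) / (M - k n) ≤ 1 := (div_le_one (hd0 n)).2 (by linarith)
        refine h1.trans ?_
        rw [← mul_div_assoc, le_div_iff₀ hM0]
        linarith [hk2 n]
    · filter_upwards [hlt] with x hx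
      refine tendsto_const_nhds.congr' ?_
      have hkt : Tendsto k atTop (𝓝 (M * (1 - 0))) := by
        refine tendsto_const_nhds.mul (tendsto_const_nhds.sub ?_)
        have := (tendsto_one_div_add_atTop_nhds_zero_nat (𝕜 := ℝ)).comp (tendsto_add_atTop_nat 1)
        refine this.congr fun n => ?_
        simp only [Function.comp, Nat.cast_add, Nat.cast_one]
        ring_nf
      rw [sub_zero, mul_one] at hkt
      filter_upwards [hkt.eventually (lt_mem_nhds hx)] with n hn
      rw [max_eq_right (by linarith), zero_div]
  rw [integral_zero] at hlim
  obtain ⟨n, hn⟩ := (hlim.eventually (gt_mem_nhds (half_pos hc))).exists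
  have he : excess Γ (k n) u ≤ c * ((M - k n) / 2) := by
    rw [integral_div, div_lt_iff₀ (hd0 n)] at hn
    unfold excess
    linarith
  -- Smoothing with h = (M - k_n)/2 gives the midpoint between k_n and M, strictly below M.
  exact ⟨k n + (M - k n) / 2, by linarith [hd0 n], hsm hv hΓ hq hq' ht _ _
    (by linarith [hk2 n]) (half_pos (hd0 n)) he⟩

/-- Strict decrease of the `L^∞` norm. -/
lemma eLpNorm_top_lt (hv : IsSmoothVelocity T v) (hΓ : IsSmoothGammaSolution T q v Γ₀ Γ)
    (hq : 1 ≤ q) (hq' : q ≠ ⊤) {s t : ℝ} (hs : 0 < s) (hst : s < t) (ht : t < T) {x₀ : Space3}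
    (hx₀ : Γ s x₀ ≠ 0) : eLpNorm (Γ t) ⊤ volume < eLpNorm (Γ s) ⊤ volume := by
  have hsI : s ∈ Ioo 0 T := ⟨hs, hst.trans ht⟩
  have hcont := hΓ.continuous_slice hsI
  obtain ⟨B, hB⟩ := hΓ.exists_abs_le hv hq hq' hs hsI.2 ht
  have hBs := hB s ⟨le_rfl, hst.le⟩
  have hfin : eLpNorm (Γ s) ⊤ volume ≠ ⊤ := ne_top_of_le_ne_top ENNReal.ofReal_ne_top
    ((eLpNorm_top_le_iff ((abs_nonneg _).trans (hBs 0))).2 (Eventually.of_forall hBs))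
  set M := (eLpNorm (Γ s) ⊤ volume).toReal with hM
  have hMe : eLpNorm (Γ s) ⊤ volume = ENNReal.ofReal M := (ENNReal.ofReal_toReal hfin).symm
  -- Continuity upgrades the essential bound to a pointwise one, as required by the comparison
  -- arguments.
  have hM1 : ∀ x, |Γ s x| ≤ M := by
    have h1 := (eLpNorm_top_le_iff ENNReal.toReal_nonneg).1 hMe.le
    have h2 : (fun x => max (|Γ s x|) M) =ᵐ[volume] fun _ => M := by
      filter_upwards [h1] with x hx using max_eq_right hx
    intro x
    have := congrFun (((hcont.abs.max continuous_const).ae_eq_iff_eq volume continuous_const).1 h2) x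
    exact (le_max_left _ _).trans_eq this
  have hM0 : 0 < M := (abs_pos.2 hx₀).trans_le (hM1 x₀)
  obtain ⟨M₁, hM₁, h₁⟩ := hΓ.exists_lt_forall_le hv hq hq' hM0 hs hst ht
    fun x => (le_abs_self _).trans (hM1 x)
  obtain ⟨M₂, hM₂, h₂⟩ := hΓ.neg.exists_lt_forall_le hv hq hq' hM0 hs hst ht
    fun x => (neg_le_abs _).trans (hM1 x)
  have habs : ∀ x, |Γ t x| ≤ max M₁ M₂ := fun x =>
    abs_le'.2 ⟨(h₁ x).trans (le_max_left _ _), (h₂ x).trans (le_max_right _ _)⟩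
  rw [hMe]
  exact ((eLpNorm_top_le_iff ((abs_nonneg _).trans (habs 0))).2 (Eventually.of_forall habs)).trans_lt
    ((ENNReal.ofReal_lt_ofReal_iff hM0).2 (max_lt hM₁ hM₂))

end IsSmoothGammaSolution

end

theorem proposition4p2 (T : ℝ) (hT : 0 < T) (q : ℝ≥0∞) (hq : 1 ≤ q) (hq_top : q ≠ ⊤)
    (v : ℝ → Space3 → Space3) (hv : IsSmoothVelocity T v)
    (Γ₀ : Space3 → ℝ) (Γ : ℝ → Space3 → ℝ) (hΓ : IsSmoothGammaSolution T q v Γ₀ Γ)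
    (p : ℝ≥0∞) (hp : 1 ≤ p) :
    (∀ t ∈ Ico 0 T, eLpNorm (Γ t) p volume ≤ eLpNorm Γ₀ p volume) ∧
      (¬ Γ₀ =ᵐ[volume] 0 → (q ≤ p ∨ MemLp Γ₀ p volume) →
        StrictAntiOn (fun t => eLpNorm (Γ t) p volume) (Ico 0 T)) := by
  refine ⟨fun t ht => hΓ.eLpNorm_le_initial hv hq hq_top hp ht, fun h0 hqp => ?_⟩
  -- Finiteness at positive times: for p ≥ q by boundedness and membership in L^q, otherwise from
  -- the initial norm.
  have hfin : ∀ t ∈ Ioo 0 T, eLpNorm (Γ t) p volume ≠ ⊤ := by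
    intro t ht
    rcases hqp with hqp | hmem
    · obtain ⟨M, hM⟩ := hΓ.exists_abs_le hv hq hq_top ht.1 ht.2 ht.2
      exact (memLp_of_memLp_of_bound hq hqp (hΓ.memLp t ⟨ht.1.le, ht.2⟩)
        (hM t ⟨le_rfl, le_rfl⟩)).2.ne
    · exact ((hΓ.eLpNorm_le_initial hv hq hq_top hp ⟨ht.1.le, ht.2⟩).trans_lt hmem.2).ne
  have key : ∀ s t, 0 < s → s < t → t < T →
      eLpNorm (Γ t) p volume < eLpNorm (Γ s) p volume := by
    intro s t hs hst ht
    obtain ⟨x₀, hx₀⟩ := hΓ.exists_ne_zero hv hq hq_top h0 ⟨hs, hst.trans ht⟩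
    have hft := hfin t ⟨hs.trans hst, ht⟩
    rcases hp.eq_or_lt with rfl | hp1
    · exact hΓ.eLpNorm_one_lt hv hq hq_top hs hst ht hft hx₀
    rcases eq_or_ne p ⊤ with rfl | hp'
    · exact hΓ.eLpNorm_top_lt hv hq hq_top hs hst ht hx₀
    · exact hΓ.eLpNorm_lt_of_one_lt hv hq hq_top hp1 hp' hs hst ht hft hx₀
  intro s hs t ht hst
  rcases hs.1.eq_or_lt with rfl | hs0
  -- At the initial time the norm may be infinite and Γ need not be smooth, so strictness is taken
  -- between t/2 and t and combined with monotonicity on [0, t/2].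
  · exact (key (t / 2) t (half_pos hst) (half_lt_self hst) ht.2).trans_le
      (hΓ.eLpNorm_antitone hv hq hq_top hp le_rfl (half_pos hst).le ((half_lt_self hst).trans ht.2))
  · exact key s t hs0 hst ht.2
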